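/- \textbf{Setting.} Let $\Omega=\{(x,y,z)\in\mathbb R^3: x^2+y^2<1,\ 0<z<1\}$ and let $B$ be the open unit disc of $\mathbb R^2$ centred at the origin. Let $\varphi\in C^2(\overline B)$ be radial with radial profile $\phi$ (i.e. $\varphi(x,y)=\phi(\sqrt{x^2+y^2})$), such that $$(\mathbf f1)\qquad \Delta\varphi\not\equiv 0 \text{ in } B,\qquad \phi(1)=\phi'(1)=\int_0^1 r^2\phi'(r)\,dr=0,$$ and let $\psi$ satisfy $$(\mathbf f2)\qquad \psi\in C^0([0,1]),\qquad \int_0^1\psi(z)\,dz=0,\qquad \int_0^1 z\,\psi(z)\,dz\ge 0 .$$ Put $\mathbf f(x,y,z)=(\varphi_x(x,y),\varphi_y(x,y),\psi(z))$ and $\mathcal L(\mathbf u)=\int_\Omega \mathbf f\cdot\mathbf u\,d\mathbf x$ (there are no surface forces). Let $p\in(1,2]$ and let $\mathcal W:\mathbb R^{3\times3}\to[0,+\infty]$ be Borel measurable such that, with $|\cdot|$ the Euclidean (Frobenius) norm: (W1) $\mathcal W(\mathbf R\mathbf F)=\mathcal W(\mathbf F)$ for all $\mathbf R\in SO(3)$,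 $\mathbf F\in\mathbb R^{3\times 3}$; (W2) $\mathcal W(\mathbf I)=0$; (W3) there are an open neighbourhood $\mathcal U$ of $SO(3)$, an increasing $\omega$ on $[0,\infty)$ with $\omega(t)\to0$ as $t\to0^+$, and $K>0$ with $\mathcal W\in C^2(\mathcal U)$, $|D^2\mathcal W(\mathbf I)|\le K$ and $|D^2\mathcal W(\mathbf F)-D^2\mathcal W(\mathbf G)|\le\omega(|\mathbf F-\mathbf G|)$ for all $\mathbf F,\mathbf G\in\mathcal U$; (W4) there is $C>0$ with $\mathcal W(\mathbf F)\ge C\,g_p(d(\mathbf F,SO(3)))$ for all $\mathbf F$, where $g_p(t)=t^2$ for $0\le t\le1$, $g_p(t)=\frac{2t^p}{p}-\frac2p+1$ for $t\ge1$, and $d(\mathbf F,SO(3))$ is the distance from $\mathbf F$ to $SO(3)$. Assume moreover that the quadratic form $\mathcal Q(\mathbf F)=\frac12\mathbf F^TD^2\mathcal W(\mathbf I)\mathbf F$ satisfies $\mathcal Q(\mathbf F)=4|\mathbf F|^2$ for every symmetric $\mathbf F\in\mathbb R^{3\times3}$ (equivalently, $\mathcal Q(\mathbf F)=4|\mathrm{sym}\,\mathbf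 F|^2$ for all $\mathbf F$). Let $\mathcal Q^I(\mathbf F)=\mathcal Q(\mathbf F)$ if $\mathrm{Tr}\,\mathbf F=0$ and $\mathcal Q^I(\mathbf F)=+\infty$ otherwise. With $\mathbb E(\mathbf u)=\frac12(\nabla\mathbf u^T+\nabla\mathbf u)$ and $\mathcal S^0_{\mathcal L}=\{\mathbf R\in SO(3):\mathcal L((\mathbf R-\mathbf I)\mathbf x)=0\}$, define on $W^{1,p}(\Omega,\mathbb R^3)$ $$\mathcal E(\mathbf u)=\int_\Omega\mathcal Q(\mathbb E(\mathbf u))\,d\mathbf x-\mathcal L(\mathbf u),\qquad \mathcal G(\mathbf u)=\int_\Omega\mathcal Q(\mathbb E(\mathbf u))\,d\mathbf x-\mathcal L(\mathbf u)-\max_{\mathbf R\in\mathcal S^0_{\mathcal L}}\mathcal L((\mathbf R-\mathbf I)\mathbf u)$$ if $\mathbf u\in H^1(\Omega,\mathbb R^3)$, and $\mathcal E(\mathbf u)=\mathcal G(\mathbf u)=+\infty$ otherwise; define $\mathcal E^I$, $\mathcal G^I$ in the same way with $\mathcal Q^I$ in place of $\mathcal Q$. \textbf{Theorem.} (i) $\Omega$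 is a bounded connected open set with Lipschitz boundary, $\partial\Omega$ has finitely many connected components, $\mathbf f\in L^{3p/(4p-3)}(\Omega,\mathbb R^3)$, and $$(\mathcal L1)\quad \mathcal L(\mathbf c)=0\ \ \forall\,\mathbf c\in\mathbb R^3,\qquad\qquad (\mathcal L2)\quad \mathcal L((\mathbf R-\mathbf I)\mathbf x)\le0\ \ \forall\,\mathbf R\in SO(3).$$ (ii) $\mathcal G$ and $\mathcal E$ attain their minima over $W^{1,p}(\Omega,\mathbb R^3)$, and $$\min_{W^{1,p}(\Omega,\mathbb R^3)}\mathcal G<\min_{W^{1,p}(\Omega,\mathbb R^3)}\mathcal E .$$ (iii) There is $\delta>0$, depending only on $\varphi$, such that if $\|\psi\|_{L^2(0,1)}<\delta$ then $\mathcal G^I$ and $\mathcal E^I$ attain their minima over $W^{1,p}(\Omega,\mathbb R^3)$, and $$\min_{W^{1,p}(\Omega,\mathbb R^3)}\mathcal G^I<\min_{W^{1,p}(\Omega,\mathbb R^3)}\mathcal E^I .$$ -/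

import Mathlib

open MeasureTheory Set Filter Topology
open scoped ENNReal NNReal ContDiff

noncomputable section

namespace TractionGap

/-- The plane with its Euclidean norm. -/
abbrev E2 : Type := EuclideanSpace ℝ (Fin 2)

/-- Three-dimensional space with its Euclidean norm. -/
abbrev E3 : Type := EuclideanSpace ℝ (Fin 3)

/-- Real 3 × 3 matrices. -/
abbrev Mat3 : Type := Matrix (Fin 3) (Fin 3) ℝ

/-- The special orthogonal group as a set of matrices. -/
def SO3 : Set Mat3 := {R | R ∈ Matrix.specialOrthogonalGroup (Fin 3) ℝ}

/-- The matrix `A` applied to the vector `v`. -/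
def act (A : Mat3) (v : E3) : E3 := Matrix.toEuclideanLin A v

/-! ### Domains -/

/-- Near each of its boundary points, and up to a rigid motion, `Ω` is the strict subgraph of a
Lipschitz function of two variables. -/
def HasLipschitzBoundary (Ω : Set E3) : Prop :=
  ∀ x ∈ frontier Ω, ∃ U ∈ 𝓝 x, ∃ (e : E3 ≃ᵃⁱ[ℝ] E3) (K : ℝ≥0) (γ : E2 → ℝ),
    LipschitzWith K γ ∧ ∀ y ∈ U, (y ∈ Ω ↔ e y 2 < γ !₂[e y 0, e y 1])

/-- Bounded connected open sets with Lipschitz boundary. -/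
structure IsReferenceConfiguration (Ω : Set E3) : Prop where
  isOpen : IsOpen Ω
  isBounded : Bornology.IsBounded Ω
  isConnected : IsConnected Ω
  lipschitz : HasLipschitzBoundary Ω

/-- The unit cylinder `x² + y² < 1`, `0 < z < 1`. -/
def cylinder : Set E3 := {x | x 0 ^ 2 + x 1 ^ 2 < 1 ∧ 0 < x 2 ∧ x 2 < 1}

/-! ### Sobolev spaces -/

/-- `G` is the weak (distributional) gradient of `u` on `Ω`, with `G i j = ∂ⱼ uᵢ`. -/
structure IsWeakGradient (Ω : Set E3) (u : E3 → E3) (G : E3 → Mat3) : Prop where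
  locallyIntegrable : LocallyIntegrableOn u Ω
  locallyIntegrable_grad : ∀ i j, LocallyIntegrableOn (fun x => G x i j) Ω
  integral_eq : ∀ (i j : Fin 3) (θ : E3 → ℝ), ContDiff ℝ ∞ θ → HasCompactSupport θ →
    tsupport θ ⊆ Ω →
    ∫ x in Ω, u x i * fderiv ℝ θ x (EuclideanSpace.single j 1) = -∫ x in Ω, G x i j * θ x

/-- `u ∈ W^{1,p}(Ω, ℝ³)`. -/
def MemW1 (Ω : Set E3) (p : ℝ≥0∞) (u : E3 → E3) : Prop :=
  MemLp u p (volume.restrict Ω) ∧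
    ∃ G : E3 → Mat3, IsWeakGradient Ω u G ∧
      ∀ i j, MemLp (fun x => G x i j) p (volume.restrict Ω)

open Classical in
/-- The weak gradient of `u` on `Ω` (unique up to null sets, zero if there is none). -/
def weakGrad (Ω : Set E3) (u : E3 → E3) : E3 → Mat3 :=
  if h : ∃ G, IsWeakGradient Ω u G then h.choose else 0

/-- The linearized strain: the symmetric part of the weak gradient. -/
def strain (Ω : Set E3) (u : E3 → E3) (x : E3) : Mat3 :=
  (1 / 2 : ℝ) • ((weakGrad Ω u x).transpose + weakGrad Ω u x)

/-! ### Stored energy densities -/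

section Density

open scoped Matrix.Norms.Frobenius

/-- The growth function `g_p`. -/
def growth (p t : ℝ) : ℝ := if t ≤ 1 then t ^ 2 else 2 * t ^ p / p - 2 / p + 1

/-- The second derivative of the (near rotations finite) density `W` at `F`. -/
def hess (W : Mat3 → ℝ≥0∞) (F : Mat3) :=
  iteratedFDeriv ℝ 2 (fun F' => (W F').toReal) F

/-- The quadratic form `Q(F) = ½ Fᵀ D²W(I) F`. -/
def quad (W : Mat3 → ℝ≥0∞) (F : Mat3) : ℝ := (1 / 2) * hess W 1 ![F, F]

/-- The assumptions on a homogeneous stored energy density `W : ℝ^{3×3} → [0,+∞]` with growth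
exponent `p`. All matrix norms and distances are Euclidean (Frobenius). -/
structure IsEnergyDensity (p : ℝ) (W : Mat3 → ℝ≥0∞) : Prop where
  measurable : Measurable fun F : Fin 3 → Fin 3 → ℝ => W (Matrix.of F)
  frame_indifferent : ∀ R ∈ SO3, ∀ F, W (R * F) = W F
  eq_zero : W 1 = 0
  regular : ∃ (U : Set Mat3) (m : ℝ → ℝ) (K : ℝ),
    IsOpen U ∧ SO3 ⊆ U ∧ MonotoneOn m (Ici 0) ∧ Tendsto m (𝓝[>] 0) (𝓝 0) ∧ 0 < K ∧
    (∀ F ∈ U, W F ≠ ⊤) ∧ ContDiffOn ℝ 2 (fun F => (W F).toReal) U ∧ ‖hess W 1‖ ≤ K ∧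
    ∀ F ∈ U, ∀ F' ∈ U, ‖hess W F - hess W F'‖ ≤ m ‖F - F'‖
  coercive : ∃ C : ℝ, 0 < C ∧
    ∀ F, ENNReal.ofReal (C * growth p (Metric.infDist F SO3)) ≤ W F

/-- On symmetric matrices the quadratic form of `W` is `4 |F|²`. -/
def HasModelLinearization (W : Mat3 → ℝ≥0∞) : Prop :=
  ∀ F : Mat3, F.IsSymm → quad W F = 4 * ‖F‖ ^ 2

end Density

/-- The compressible density `Q` as a function with values in `[0,+∞]`
(`quad W` is nonnegative since `W` is minimal at the identity). -/
def Q (W : Mat3 → ℝ≥0∞) (F : Mat3) : ℝ≥0∞ := ENNReal.ofReal (quad W F)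

open Classical in
/-- The incompressible density `Q^I`. -/
def QI (W : Mat3 → ℝ≥0∞) (F : Mat3) : ℝ≥0∞ := if F.trace = 0 then Q W F else ⊤

/-! ### Loads -/

/-- The load functional `L(u) = ∫_Ω f · u` of a body force `f`. -/
def load (Ω : Set E3) (f u : E3 → E3) : ℝ := ∫ x in Ω, inner ℝ (f x) (u x)

/-- The loads have null resultant. -/
def NullResultant (L : (E3 → E3) → ℝ) : Prop := ∀ c : E3, L (fun _ => c) = 0

/-- The weak compatibility condition. -/
def WeaklyCompatible (L : (E3 → E3) → ℝ) : Prop := ∀ R ∈ SO3, L (fun x => act (R - 1) x) ≤ 0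

/-- The rotation kernel of `L`. -/
def rotationKernel (L : (E3 → E3) → ℝ) : Set Mat3 :=
  {R | R ∈ SO3 ∧ L (fun x => act (R - 1) x) = 0}

/-! ### Energy functionals -/

open Classical in
/-- The functional of linearized elasticity, with strain energy density `q` and load `L`:
`∫_Ω q(E(u)) - L(u)` on `H¹`, and `+∞` elsewhere. -/
def linearEnergy (Ω : Set E3) (q : Mat3 → ℝ≥0∞) (L : (E3 → E3) → ℝ) (u : E3 → E3) : EReal :=
  if MemW1 Ω 2 u then ((∫⁻ x in Ω, q (strain Ω u x) : ℝ≥0∞) : EReal) - (L u : ℝ) else ⊤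

open Classical in
/-- The limit functional:
`∫_Ω q(E(u)) - L(u) - max {L((R - I)u) : R in the rotation kernel}` on `H¹`, and `+∞` elsewhere. -/
def limitEnergy (Ω : Set E3) (q : Mat3 → ℝ≥0∞) (L : (E3 → E3) → ℝ) (u : E3 → E3) : EReal :=
  if MemW1 Ω 2 u then
    ((∫⁻ x in Ω, q (strain Ω u x) : ℝ≥0∞) : EReal) - (L u : ℝ)
      - (sSup ((fun R => L (fun x => act (R - 1) (u x))) '' rotationKernel L) : ℝ)
  else ⊤

/-- Both functionals attain a finite minimum over `W^{1,p}(Ω, ℝ³)`, and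
`min limitEnergy < min linearEnergy`. -/
def HasEnergyGap (Ω : Set E3) (p : ℝ) (q : Mat3 → ℝ≥0∞) (L : (E3 → E3) → ℝ) : Prop :=
  ∃ mG mE : ℝ,
    IsLeast (limitEnergy Ω q L '' {u | MemW1 Ω (ENNReal.ofReal p) u}) (mG : EReal) ∧
    IsLeast (linearEnergy Ω q L '' {u | MemW1 Ω (ENNReal.ofReal p) u}) (mE : EReal) ∧
    mG < mE

/-! ### The special loads -/

/-- The body force `(φ_x(x,y), φ_y(x,y), ψ(z))`. -/
def bodyForce (φ : E2 → ℝ) (ψ : ℝ → ℝ) (x : E3) : E3 :=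
  !₂[fderiv ℝ φ !₂[x 0, x 1] (EuclideanSpace.single 0 1),
     fderiv ℝ φ !₂[x 0, x 1] (EuclideanSpace.single 1 1), ψ (x 2)]

/-- The condition on the horizontal potential `φ`, with radial profile `Φ`. -/
structure IsHorizontalPotential (φ : E2 → ℝ) (Φ : ℝ → ℝ) : Prop where
  contDiffOn : ContDiffOn ℝ 2 φ (Metric.closedBall 0 1)
  radial : ∀ y ∈ Metric.closedBall (0 : E2) 1, φ y = Φ ‖y‖
  laplacian_ne : ∃ y ∈ Metric.ball (0 : E2) 1, Laplacian.laplacian φ y ≠ 0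
  profile_one : Φ 1 = 0
  deriv_one : derivWithin Φ (Icc 0 1) 1 = 0
  moment : ∫ r in (0 : ℝ)..1, r ^ 2 * derivWithin Φ (Icc 0 1) r = 0

/-- The condition on the vertical load `ψ`. -/
structure IsVerticalLoad (ψ : ℝ → ℝ) : Prop where
  continuousOn : ContinuousOn ψ (Icc 0 1)
  mean : ∫ z in (0 : ℝ)..1, ψ z = 0
  moment : 0 ≤ ∫ z in (0 : ℝ)..1, z * ψ z

end TractionGap

end

noncomputable section

namespace TractionGap

/-! ### Geometry of the cylinder -/

/-! The gap is the difference between compressing and shearing. The force is `fᵢ = ∂ᵢPᵢ` with `P =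
(φ, φ, Ψ)`, where Ψ is the primitive of ψ. Because `Φ 1 = 0` and ψ has mean zero, `Pᵢ` vanishes on
the part of the boundary whose normal has an i-th component, so the work of `f` on `R u` is `-∑ R i
j ∫ ∂ᵢuⱼ Pᵢ`, without boundary terms (`work_force`). On affine fields only the mean of Ψ survives,
and the load of `(R - 1)x` is `m (R 2 2 - 1)` with `m ≥ 0` (`load_rotation`). This gives the
compatibility conditions, and it puts every rotation about the vertical axis, in particular the
quarter turn, into the rotation kernel.

Let `D` be the radial planar field `a(r)(x, y)` with divergence `-φ/8`. Its gradient is symmetric,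
and the moment condition on Φ' is what makes it vanish on the lateral boundary (`abs_radialPot_le`).
Hence the determinant of `∇D`, and its polarization paired with any planar `∇u`, integrate to zero.
Completing the square around `∇D` (`elastic_pointwise`) and discarding these null Lagrangians gives
`E(u) ≥ -(1/16)(∫φ² + ∫Ψ²)` on all of `H¹` (`energy_ge`).

The load turned by a right angle does on the turned field `JD` the work that the original load does
on `D`. But `∇D` is symmetric, so `D` pays for its whole squared gradient, while `JD` is divergence
free with zero lateral values, so its strain carries only half of it. The optimal multiple `2JD`,
together with the optimal vertical stretch, has limit energy at most `-(1/8)∫φ² - (1/16)∫Ψ²`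
(`energy_trial`), which is strictly lower since `∫φ² > 0`. Without the stretch the trial field is
trace free and still reaches `-(1/8)∫φ²`; this beats the lower bound as soon as `∫Ψ² < ∫φ²`, which
smallness of ψ in `L²` guarantees.

Existence of the minima: the limit energy is a minimum over `R` in the compact rotation kernel of a
convex quadratic functional minus the work of a rotated load. Rigid motions cost no strain and do no
work for such `R` (`work_rigid`). Modulo rigid motions the quadratic part is coercive by Korn's
inequality, so each `R` has a minimizer given by Lax–Milgram and depending continuously on `R`;
compactness then selects the best `R` (`exists_min_of_coercive`).

Korn's inequality (`korn`) is proved from scratch. A Helmholtz projection yields a correction,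
bounded by the strain, after which the rows of the gradient are curl free and divergence free, hence
harmonic. First derivatives of such a matrix field are combinations of first derivatives of its
symmetric part. A Caccioppoli estimate bounds the latter in a weighted norm, the weight being the
square of a function `zeta` comparable to the distance from the boundary, and a weighted Poincaré
inequality (Hardy near the boundary, ordinary Poincaré on a convex core) recovers the field up to a
constant. Pointwise identities are applied to mollifications and passed to the limit. -/

theorem isOpen_cylinder : IsOpen cylinder := by
  have h1 : IsOpen {x : E3 | x 0 ^ 2 + x 1 ^ 2 < 1} :=
    isOpen_lt (by fun_prop) (by fun_prop)
  have h2 : IsOpen {x : E3 | 0 < x 2} := isOpen_lt (by fun_prop) (by fun_prop)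
  have h3 : IsOpen {x : E3 | x 2 < 1} := isOpen_lt (by fun_prop) (by fun_prop)
  exact h1.inter (h2.inter h3)

theorem measurableSet_cylinder : MeasurableSet cylinder := isOpen_cylinder.measurableSet

theorem norm_sq_E3 (x : E3) : ‖x‖ ^ 2 = x 0 ^ 2 + x 1 ^ 2 + x 2 ^ 2 := by
  simp [EuclideanSpace.norm_sq_eq, Fin.sum_univ_three]

theorem inner_E3 (x y : E3) : inner ℝ x y = x 0 * y 0 + x 1 * y 1 + x 2 * y 2 := by
  simp [PiLp.inner_apply, Fin.sum_univ_three, mul_comm]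

theorem norm_sq_E2 (x : E2) : ‖x‖ ^ 2 = x 0 ^ 2 + x 1 ^ 2 := by
  simp [EuclideanSpace.norm_sq_eq, Fin.sum_univ_two]

theorem norm_lt_two_of_mem_cylinder {x : E3} (hx : x ∈ cylinder) : ‖x‖ < 2 := by
  obtain ⟨h1, h2, h3⟩ := hx
  have := norm_sq_E3 x
  nlinarith [norm_nonneg x]

theorem isBounded_cylinder : Bornology.IsBounded cylinder :=
  (Metric.isBounded_ball (x := (0 : E3)) (r := 2)).subset fun x hx => by
    simpa using norm_lt_two_of_mem_cylinder hx

theorem sq_combo_le {a b x y : ℝ} (ha : 0 ≤ a) (hb : 0 ≤ b) (hab : a + b = 1) :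
    (a * x + b * y) ^ 2 ≤ a * x ^ 2 + b * y ^ 2 := by
  obtain rfl : b = 1 - a := by linarith
  nlinarith [mul_nonneg (mul_nonneg ha hb) (sq_nonneg (x - y))]

theorem combo_lt {a b x y c : ℝ} (ha : 0 ≤ a) (hb : 0 ≤ b) (hab : a + b = 1) (hx : x < c)
    (hy : y < c) : a * x + b * y < c := by
  obtain rfl : b = 1 - a := by linarith
  rcases ha.eq_or_lt with rfl | h
  · linarith
  · nlinarith

theorem convex_cylinder : Convex ℝ cylinder := by
  rintro x ⟨h1, h2, h3⟩ y ⟨k1, k2, k3⟩ a b ha hb hab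
  refine ⟨?_, ?_, ?_⟩
  · have := combo_lt ha hb hab h1 k1
    have e0 := sq_combo_le (x := x 0) (y := y 0) ha hb hab
    have e1 := sq_combo_le (x := x 1) (y := y 1) ha hb hab
    simp only [PiLp.add_apply, PiLp.smul_apply, smul_eq_mul]
    linarith
  · have := combo_lt ha hb hab (neg_lt_zero.2 h2) (neg_lt_zero.2 k2)
    simp only [PiLp.add_apply, PiLp.smul_apply, smul_eq_mul]
    linarith
  · simpa using combo_lt ha hb hab h3 k3

theorem nonempty_cylinder : cylinder.Nonempty :=
  ⟨!₂[0, 0, 1 / 2], by simp, by simp, by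
    change (1 / 2 : ℝ) < 1
    norm_num⟩

instance : IsFiniteMeasure (volume.restrict cylinder) :=
  isFiniteMeasure_restrict.2 isBounded_cylinder.measure_lt_top.ne

theorem one_lt_rank_E3 : 1 < Module.rank ℝ E3 := by
  rw [← Module.finrank_eq_rank]
  simp only [finrank_euclideanSpace, Fintype.card_fin]
  exact_mod_cast (by norm_num : (1 : ℕ) < 3)

/-- A bounded convex set with interior points is carried onto the unit ball by a homeomorphism of
the whole space, frontier onto sphere, and spheres are connected in dimension above one. -/
theorem isConnected_frontier_cylinder : IsConnected (frontier cylinder) := by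
  obtain ⟨e, -, -, he⟩ := exists_homeomorph_image_interior_closure_frontier_eq_unitBall
    convex_cylinder (by rw [isOpen_cylinder.interior_eq]; exact nonempty_cylinder)
    isBounded_cylinder
  have : frontier cylinder = e.symm '' Metric.sphere (0 : E3) 1 := by
    rw [← he, ← Set.image_comp]; simp
  rw [this]
  exact (isConnected_sphere one_lt_rank_E3 0 zero_le_one).image _ e.symm.continuous.continuousOn

theorem finite_connectedComponents_frontier :
    Finite (ConnectedComponents (frontier cylinder)) := by
  have : ConnectedSpace (frontier cylinder) :=
    isConnected_iff_connectedSpace.1 isConnected_frontier_cylinder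
  infer_instance

/-- An orthonormal family of three vectors gives a rigid motion onto coordinates. -/
theorem exists_frame (v : Fin 3 → E3) (hv : Orthonormal ℝ v) :
    ∃ e : E3 ≃ᵃⁱ[ℝ] E3, ∀ y i, e y i = inner ℝ (v i) y := by
  have hs : ⊤ ≤ Submodule.span ℝ (Set.range v) := by
    have := hv.linearIndependent.span_eq_top_of_card_eq_finrank' (by simp)
    exact this.ge
  refine ⟨(OrthonormalBasis.mk hv hs).repr.toAffineIsometryEquiv, fun y i => ?_⟩
  simp [OrthonormalBasis.repr_apply_apply]

/-- The upper half of the unit circle as a graph, made globally Lipschitz. -/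
def arc (s : ℝ) : ℝ := √(1 - (max (-(1 / 2)) (min (1 / 2) s)) ^ 2)

/-- Clamping to `[-1/2, 1/2]` keeps both square roots at least `1/2`. In the difference of squares
`key` the sum of the roots is therefore at least `1`, while `|c + d| ≤ 1`, whence the constant `1`.
-/
theorem abs_arc_sub_le (s t : ℝ) : |arc s - arc t| ≤ |s - t| := by
  set c := max (-(1 / 2 : ℝ)) (min (1 / 2) s) with hc
  set d := max (-(1 / 2 : ℝ)) (min (1 / 2) t) with hd
  have hc1 : |c| ≤ 1 / 2 := abs_le.2 ⟨le_max_left _ _, max_le (by norm_num) (min_le_left _ _)⟩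
  have hd1 : |d| ≤ 1 / 2 := abs_le.2 ⟨le_max_left _ _, max_le (by norm_num) (min_le_left _ _)⟩
  have hcd : |c - d| ≤ |s - t| := by
    refine (abs_max_sub_max_le_max _ _ _ _).trans (max_le (by simp) ?_)
    exact (abs_min_sub_min_le_max _ _ _ _).trans (max_le (by simp) le_rfl)
  have hA : (3 / 4 : ℝ) ≤ 1 - c ^ 2 := by nlinarith [sq_abs c, abs_nonneg c]
  have hB : (3 / 4 : ℝ) ≤ 1 - d ^ 2 := by nlinarith [sq_abs d, abs_nonneg d]
  have hA' : 1 / 2 ≤ √(1 - c ^ 2) := Real.le_sqrt_of_sq_le (by linarith)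
  have hB' : 1 / 2 ≤ √(1 - d ^ 2) := Real.le_sqrt_of_sq_le (by linarith)
  have key : (√(1 - c ^ 2) - √(1 - d ^ 2)) * (√(1 - c ^ 2) + √(1 - d ^ 2)) = (d - c) * (c + d) := by
    have h1 := Real.sq_sqrt (show (0 : ℝ) ≤ 1 - c ^ 2 by linarith)
    have h2 := Real.sq_sqrt (show (0 : ℝ) ≤ 1 - d ^ 2 by linarith)
    linear_combination h1 - h2
  have h3 : |c + d| ≤ 1 := (abs_add_le _ _).trans (by linarith)
  have key' := congrArg abs key
  rw [abs_mul, abs_mul, abs_of_pos (show 0 < √(1 - c ^ 2) + √(1 - d ^ 2) by linarith),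
    abs_sub_comm d c] at key'
  have : |√(1 - c ^ 2) - √(1 - d ^ 2)| ≤ |c - d| := by
    nlinarith [abs_nonneg (√(1 - c ^ 2) - √(1 - d ^ 2)), abs_nonneg (c - d)]
  exact this.trans hcd

theorem lipschitzWith_arc : LipschitzWith 1 arc :=
  LipschitzWith.of_dist_le_mul fun s t => by simpa [Real.dist_eq] using abs_arc_sub_le s t

theorem lt_arc_iff {p s : ℝ} (hp : 0 < p) (hs : |s| < 1 / 2) : p < arc s ↔ p ^ 2 + s ^ 2 < 1 := by
  obtain ⟨h1, h2⟩ := abs_lt.1 hs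
  have : max (-(1 / 2 : ℝ)) (min (1 / 2) s) = s := by
    rw [min_eq_right h2.le, max_eq_right h1.le]
  rw [arc, this, Real.lt_sqrt hp.le]
  constructor <;> intro h <;> linarith

theorem lipschitzWith_coord (i : Fin 2) : LipschitzWith 1 (fun w : E2 => w i) :=
  LipschitzWith.of_dist_le_mul fun w w' => by
    simpa [Real.dist_eq, dist_eq_norm] using PiLp.norm_apply_le (w - w') i

/-- The pairs `(1, 1)` and `(-1, 0)` describe the top and the bottom by the same inequality `σ z <
d`, so that one chart construction serves both bases. -/
theorem mem_cylinder_iff_oriented {σ d : ℝ} (h : (σ = 1 ∧ d = 1) ∨ (σ = -1 ∧ d = 0)) (y : E3) :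
    y ∈ cylinder ↔ y 0 ^ 2 + y 1 ^ 2 < 1 ∧ σ * y 2 < d ∧ d - 1 < σ * y 2 := by
  rcases h with ⟨rfl, rfl⟩ | ⟨rfl, rfl⟩ <;> simp only [cylinder, mem_ofPred_eq] <;>
    constructor <;> rintro ⟨h1, h2, h3⟩ <;> refine ⟨h1, ?_, ?_⟩ <;> linarith

theorem graph_near_base {σ d : ℝ} (h : (σ = 1 ∧ d = 1) ∨ (σ = -1 ∧ d = 0)) (x : E3)
    (hx : x 0 ^ 2 + x 1 ^ 2 < 1) (hx2 : σ * x 2 = d) :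
    ∃ U ∈ 𝓝 x, ∃ (e : E3 ≃ᵃⁱ[ℝ] E3) (K : ℝ≥0) (γ : E2 → ℝ),
    LipschitzWith K γ ∧ ∀ y ∈ U, (y ∈ cylinder ↔ e y 2 < γ !₂[e y 0, e y 1]) := by
  have hσ : σ * σ = 1 := by rcases h with ⟨rfl, -⟩ | ⟨rfl, -⟩ <;> norm_num
  obtain ⟨e, he⟩ := exists_frame ![!₂[1, 0, 0], !₂[0, 1, 0], !₂[0, 0, σ]] (by
    rw [orthonormal_iff_ite]
    intro i j
    rw [inner_E3]
    fin_cases i <;> fin_cases j <;> simp [hσ])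
  have h1 : IsOpen {y : E3 | y 0 ^ 2 + y 1 ^ 2 < 1} := isOpen_lt (by fun_prop) (by fun_prop)
  have h2 : IsOpen {y : E3 | d - 1 < σ * y 2} := isOpen_lt (by fun_prop) (by fun_prop)
  refine ⟨_, (h1.inter h2).mem_nhds ⟨hx, by simp [hx2]⟩, e, 0, fun _ => d,
    LipschitzWith.const _, fun y hy => ?_⟩
  have e2 : e y 2 = σ * y 2 := by
    rw [he]; simp [inner_E3]
  rw [e2, mem_cylinder_iff_oriented h]
  exact ⟨fun H => H.2.1, fun H => ⟨hy.1, H, hy.2⟩⟩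

/-- The graph direction is the bisector of the radial and the vertical outward normals, so the chart
also works on the rim. With radial coordinate `p` and tangential coordinate `s`, the side condition
`p < arc s` becomes `e₂ < e₁ + 2c arc e₀` and the base condition `σ z < d` becomes `e₂ < 2cd - e₁`;
the graph function is the minimum of the two. Here `c = 1/√2` normalizes the frame. -/
theorem graph_near_side {σ d : ℝ} (h : (σ = 1 ∧ d = 1) ∨ (σ = -1 ∧ d = 0)) (x : E3)
    (hx : x 0 ^ 2 + x 1 ^ 2 = 1) (hx2 : d - 1 < σ * x 2) :
    ∃ U ∈ 𝓝 x, ∃ (e : E3 ≃ᵃⁱ[ℝ] E3) (K : ℝ≥0) (γ : E2 → ℝ),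
    LipschitzWith K γ ∧ ∀ y ∈ U, (y ∈ cylinder ↔ e y 2 < γ !₂[e y 0, e y 1]) := by
  have hσ : σ * σ = 1 := by rcases h with ⟨rfl, -⟩ | ⟨rfl, -⟩ <;> norm_num
  obtain ⟨c, hc0, hc⟩ : ∃ c : ℝ, 0 < c ∧ c * c = 1 / 2 :=
    ⟨√(1 / 2), by positivity, Real.mul_self_sqrt (by norm_num)⟩
  set n := x 0
  set m := x 1
  obtain ⟨e, he⟩ := exists_frame
    ![!₂[-m, n, 0], !₂[-c * n, -c * m, c * σ], !₂[c * n, c * m, c * σ]] (by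
    rw [orthonormal_iff_ite]
    intro i j
    rw [inner_E3]
    fin_cases i <;> fin_cases j <;> simp <;>
      first
        | ring1
        | linear_combination hx
        | linear_combination c * c * hx + c * c * hσ + 2 * hc
        | linear_combination - c * c * hx + c * c * hσ)
  have e0 (y) : e y 0 = n * y 1 - m * y 0 := by
    rw [he]; simp [inner_E3]; try ring
  have e1 (y) : e y 1 = c * (σ * y 2 - (n * y 0 + m * y 1)) := by
    rw [he]; simp [inner_E3]; try ring
  have e2 (y) : e y 2 = c * (σ * y 2 + (n * y 0 + m * y 1)) := by
    rw [he]; simp [inner_E3]; try ring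
  have h1 : IsOpen {y : E3 | 0 < n * y 0 + m * y 1} := isOpen_lt (by fun_prop) (by fun_prop)
  have h2 : IsOpen {y : E3 | |n * y 1 - m * y 0| < 1 / 2} := isOpen_lt (by fun_prop) (by fun_prop)
  have h3 : IsOpen {y : E3 | d - 1 < σ * y 2} := isOpen_lt (by fun_prop) (by fun_prop)
  have hl1 : LipschitzWith (1 + (2 * c).toNNReal)
      (fun w : E2 => w 1 + (2 * c) * arc (w 0)) := by
    refine (lipschitzWith_coord 1).add ?_
    have := (lipschitzWith_arc.comp (lipschitzWith_coord 0))
    refine LipschitzWith.of_dist_le_mul fun w w' => ?_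
    have h4 := this.dist_le_mul w w'
    rw [Real.coe_toNNReal _ (by positivity)]
    simp only [Function.comp, Real.dist_eq, NNReal.coe_one, one_mul, mul_one] at h4 ⊢
    rw [← mul_sub, abs_mul, abs_of_pos (by positivity : 0 < 2 * c)]
    gcongr
  have hl2 : LipschitzWith (0 + 1) (fun w : E2 => 2 * c * d - w 1) :=
    (LipschitzWith.const _).sub (lipschitzWith_coord 1)
  refine ⟨_, (h1.inter (h2.inter h3)).mem_nhds ⟨?_, ?_, hx2⟩, e, _, _, hl1.min hl2, ?_⟩
  · change 0 < n * n + m * m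
    nlinarith
  · change |n * m - m * n| < 1 / 2
    norm_num [mul_comm]
  rintro y ⟨hy1, hy2, hy3⟩
  rw [mem_cylinder_iff_oriented h]
  have hr : y 0 ^ 2 + y 1 ^ 2 = (n * y 0 + m * y 1) ^ 2 + (n * y 1 - m * y 0) ^ 2 := by
    linear_combination (-(y 0 ^ 2 + y 1 ^ 2)) * hx
  rw [hr, ← lt_arc_iff hy1 hy2, lt_min_iff]
  simp only [e0, e1, e2, Matrix.cons_val_zero, Matrix.cons_val_one]
  set p := n * y 0 + m * y 1
  set s := n * y 1 - m * y 0
  constructor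
  · rintro ⟨k1, k2, -⟩
    constructor
    · nlinarith
    · nlinarith
  · rintro ⟨k1, k2⟩
    refine ⟨?_, ?_, hy3⟩
    · by_contra hcon
      nlinarith
    · by_contra hcon
      nlinarith

theorem hasLipschitzBoundary_cylinder : HasLipschitzBoundary cylinder := by
  intro x hx
  rw [isOpen_cylinder.frontier_eq] at hx
  have hcl : closure cylinder ⊆ {x : E3 | x 0 ^ 2 + x 1 ^ 2 ≤ 1 ∧ 0 ≤ x 2 ∧ x 2 ≤ 1} := by
    refine closure_minimal (fun x hx => ⟨hx.1.le, hx.2.1.le, hx.2.2.le⟩) ?_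
    have c1 : IsClosed {x : E3 | x 0 ^ 2 + x 1 ^ 2 ≤ 1} := isClosed_le (by fun_prop) (by fun_prop)
    have c2 : IsClosed {x : E3 | 0 ≤ x 2} := isClosed_le (by fun_prop) (by fun_prop)
    have c3 : IsClosed {x : E3 | x 2 ≤ 1} := isClosed_le (by fun_prop) (by fun_prop)
    exact c1.inter (c2.inter c3)
  obtain ⟨h1, h2, h3⟩ := hcl hx.1
  rcases h1.eq_or_lt with h1 | h1
  · rcases le_total (1 / 2) (x 2) with hz | hz
    · exact graph_near_side (Or.inl ⟨rfl, rfl⟩) x h1 (by linarith)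
    · exact graph_near_side (Or.inr ⟨rfl, rfl⟩) x h1 (by linarith)
  · rcases h2.eq_or_lt with h2 | h2
    · exact graph_near_base (Or.inr ⟨rfl, rfl⟩) x h1 (by linarith)
    rcases h3.eq_or_lt with h3 | h3
    · exact graph_near_base (Or.inl ⟨rfl, rfl⟩) x h1 (by linarith)
    exact absurd ⟨h1, h2, h3⟩ hx.2

theorem isReferenceConfiguration_cylinder : IsReferenceConfiguration cylinder where
  isOpen := isOpen_cylinder
  isBounded := isBounded_cylinder
  isConnected := convex_cylinder.isConnected nonempty_cylinder
  lipschitz := hasLipschitzBoundary_cylinder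

/-! ### Mollification and weak identities -/

/-- The partial derivative in direction `k`. -/
def pd (k : Fin 3) (f : E3 → ℝ) (x : E3) : ℝ := fderiv ℝ f x (EuclideanSpace.single k 1)

theorem continuous_pd {f : E3 → ℝ} (hf : ContDiff ℝ 1 f) (k : Fin 3) : Continuous (pd k f) :=
  (hf.continuous_fderiv one_ne_zero).clm_apply continuous_const

theorem pd_eq_zero_of_notMem_tsupport {f : E3 → ℝ} {x : E3} (hx : x ∉ tsupport f) (k : Fin 3) :
    pd k f x = 0 := by
  have : fderiv ℝ f x = 0 := by
    by_contra h
    exact hx (support_fderiv_subset ℝ h)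
  simp [pd, this]

theorem hasCompactSupport_pd {f : E3 → ℝ} (hf : HasCompactSupport f) (k : Fin 3) :
    HasCompactSupport (pd k f) :=
  HasCompactSupport.intro hf fun _ hx => pd_eq_zero_of_notMem_tsupport hx k

theorem pd_mul {f g : E3 → ℝ} {x : E3} (hf : DifferentiableAt ℝ f x) (hg : DifferentiableAt ℝ g x)
    (k : Fin 3) : pd k (fun y => f y * g y) x = pd k f x * g x + f x * pd k g x := by
  simp only [pd, fderiv_fun_mul hf hg]
  simp
  ring

theorem memLp_of_continuous_compactSupport {f : E3 → ℝ} (hf : Continuous f)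
    (hc : HasCompactSupport f) {μ : Measure E3} [IsFiniteMeasureOnCompacts μ] {p : ℝ≥0∞} :
    MemLp f p μ :=
  hf.memLp_of_hasCompactSupport hc

/-- The mollifying kernels. -/
def bump (n : ℕ) : ContDiffBump (0 : E3) where
  rIn := 1 / (2 * (n + 1))
  rOut := 1 / (n + 1)
  rIn_pos := by positivity
  rIn_lt_rOut := by
    apply one_div_lt_one_div_of_lt <;> linarith [(Nat.cast_nonneg n : (0 : ℝ) ≤ n)]

def kernel (n : ℕ) : E3 → ℝ := (bump n).normed volume

theorem contDiff_kernel (n : ℕ) {m : ℕ∞} : ContDiff ℝ m (kernel n) := (bump n).contDiff_normed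
theorem hasCompactSupport_kernel (n : ℕ) : HasCompactSupport (kernel n) :=
  (bump n).hasCompactSupport_normed
theorem kernel_nonneg (n : ℕ) (x : E3) : 0 ≤ kernel n x := (bump n).nonneg_normed x
theorem integral_kernel (n : ℕ) : ∫ x, kernel n x = 1 := (bump n).integral_normed
theorem tsupport_kernel (n : ℕ) : tsupport (kernel n) = Metric.closedBall 0 (1 / (n + 1)) :=
  (bump n).tsupport_normed_eq

def mollify (n : ℕ) (f : E3 → ℝ) : E3 → ℝ :=
  convolution f (kernel n) (ContinuousLinearMap.mul ℝ ℝ) volume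

theorem mollify_apply (n : ℕ) (f : E3 → ℝ) (x : E3) :
    mollify n f x = ∫ y, f y * kernel n (x - y) := rfl

theorem contDiff_mollify (n : ℕ) {f : E3 → ℝ} (hf : LocallyIntegrable f) {m : ℕ∞} :
    ContDiff ℝ m (mollify n f) :=
  (hasCompactSupport_kernel n).contDiff_convolution_right _ hf (contDiff_kernel n)

/-- The derivative is put on the kernel, so that it can be read as a test function. -/
theorem pd_mollify (n : ℕ) {f : E3 → ℝ} (hf : LocallyIntegrable f) (k : Fin 3) (x : E3) :
    pd k (mollify n f) x = ∫ y, f y * pd k (kernel n) (x - y) := by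
  have h := (hasCompactSupport_kernel n).hasFDerivAt_convolution_right
    (ContinuousLinearMap.mul ℝ ℝ) hf (contDiff_kernel n (m := 1)) x
  rw [pd, mollify, h.fderiv, convolution_precompR_apply _ hf
    ((hasCompactSupport_kernel n).fderiv ℝ)
    ((contDiff_kernel n (m := 1)).continuous_fderiv one_ne_zero)]
  rfl

theorem mollify_sub (n : ℕ) {f g : E3 → ℝ} (hf : LocallyIntegrable f) (hg : LocallyIntegrable g) :
    mollify n (fun x => f x - g x) = fun x => mollify n f x - mollify n g x := by
  ext x
  have hc : Continuous (fun y => kernel n (x - y)) :=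
    (contDiff_kernel n (m := 0)).continuous.comp (by fun_prop)
  have hs : HasCompactSupport (fun y => kernel n (x - y)) :=
    (hasCompactSupport_kernel n).comp_homeomorph (Homeomorph.subLeft x)
  simp only [mollify_apply, sub_mul]
  refine integral_sub ?_ ?_
  · simpa only [smul_eq_mul, mul_comm] using hf.integrable_smul_left_of_hasCompactSupport hc hs
  · simpa only [smul_eq_mul, mul_comm] using hg.integrable_smul_left_of_hasCompactSupport hc hs

/-! ### Mollification in `L²`. -/

theorem sq_lintegral_mul_le {α : Type*} [MeasurableSpace α] {μ : Measure α} {r F : α → ℝ≥0∞}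
    (hr : AEMeasurable r μ) (hF : AEMeasurable F μ) (h1 : ∫⁻ a, r a ∂μ = 1) :
    (∫⁻ a, r a * F a ∂μ) ^ 2 ≤ ∫⁻ a, r a * F a ^ 2 ∂μ := by
  have h := ENNReal.lintegral_mul_norm_pow_le hr (hr.mul (hF.pow_const 2))
    (p := 1 / 2) (q := 1 / 2) (by norm_num) (by norm_num) (by norm_num)
  have e : ∀ a, r a ^ (1 / 2 : ℝ) * (r * fun a => F a ^ 2) a ^ (1 / 2 : ℝ) = r a * F a := by
    intro a
    simp only [Pi.mul_apply]
    rw [ENNReal.mul_rpow_of_nonneg _ _ (by norm_num), ← mul_assoc,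
      ← ENNReal.rpow_add_of_nonneg _ _ (by norm_num) (by norm_num), ← ENNReal.rpow_natCast,
      ← ENNReal.rpow_mul]
    norm_num
  simp only [e, h1, ENNReal.one_rpow, one_mul] at h
  calc (∫⁻ a, r a * F a ∂μ) ^ 2 ≤ ((∫⁻ a, (r * fun a => F a ^ 2) a ∂μ) ^ (1 / 2 : ℝ)) ^ 2 := by
        gcongr
    _ = ∫⁻ a, r a * F a ^ 2 ∂μ := by
        rw [← ENNReal.rpow_natCast, ← ENNReal.rpow_mul]; norm_num

theorem eLpNorm_two_sq {α : Type*} [MeasurableSpace α] {μ : Measure α} (f : α → ℝ) :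
    eLpNorm f 2 μ ^ 2 = ∫⁻ a, ‖f a‖ₑ ^ 2 ∂μ := by
  rw [eLpNorm_eq_lintegral_rpow_enorm_toReal (by norm_num) (by norm_num), ← ENNReal.rpow_natCast,
    ← ENNReal.rpow_mul]
  norm_num

theorem lintegral_kernel (n : ℕ) : ∫⁻ x, ENNReal.ofReal (kernel n x) = 1 := by
  rw [← ofReal_integral_eq_lintegral_ofReal (f := kernel n) (bump n).integrable_normed
    (ae_of_all _ (kernel_nonneg n)), integral_kernel, ENNReal.ofReal_one]

/-- Jensen's inequality for the probability density `kernel n (x - ·)` at each `x`, then Tonelli,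
since the kernel has mass one in `x` as well as in `y`. -/
theorem eLpNorm_mollify_le (n : ℕ) {f : E3 → ℝ} (hf : AEStronglyMeasurable f) :
    eLpNorm (mollify n f) 2 volume ≤ eLpNorm f 2 volume := by
  have hk : Measurable (fun x => ENNReal.ofReal (kernel n x)) :=
    ((contDiff_kernel n (m := 0)).continuous.measurable).ennreal_ofReal
  have h1 (x) : ∫⁻ y, ENNReal.ofReal (kernel n (x - y)) = 1 := by
    rw [lintegral_sub_left_eq_self (fun z => ENNReal.ofReal (kernel n z)) x, lintegral_kernel]
  have h2 (y) : ∫⁻ x, ENNReal.ofReal (kernel n (x - y)) = 1 := by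
    rw [lintegral_sub_right_eq_self (fun z => ENNReal.ofReal (kernel n z)) y, lintegral_kernel]
  suffices H : eLpNorm (mollify n f) 2 volume ^ 2 ≤ eLpNorm f 2 volume ^ 2 by
    by_contra hcon
    exact absurd H (not_le.2 (by gcongr; exact not_le.1 hcon))
  rw [eLpNorm_two_sq, eLpNorm_two_sq]
  calc ∫⁻ x, ‖mollify n f x‖ₑ ^ 2
      ≤ ∫⁻ x, ∫⁻ y, ENNReal.ofReal (kernel n (x - y)) * ‖f y‖ₑ ^ 2 := by
        refine lintegral_mono fun x => ?_
        refine le_trans ?_ (sq_lintegral_mul_le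
          (hk.comp (measurable_const.sub measurable_id)).aemeasurable hf.enorm (h1 x))
        gcongr
        rw [mollify_apply]
        refine (enorm_integral_le_lintegral_enorm _).trans (le_of_eq ?_)
        refine lintegral_congr fun y => ?_
        rw [enorm_mul, mul_comm, Real.enorm_eq_ofReal (kernel_nonneg n _)]
    _ = ∫⁻ y, ∫⁻ x, ENNReal.ofReal (kernel n (x - y)) * ‖f y‖ₑ ^ 2 := by
        refine lintegral_lintegral_swap ?_
        refine AEMeasurable.mul (hk.comp (measurable_fst.sub measurable_snd)).aemeasurable ?_
        exact (hf.enorm.pow_const 2).comp_snd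
    _ = ∫⁻ y, ‖f y‖ₑ ^ 2 := by
        refine lintegral_congr fun y => ?_
        have : Measurable (fun x => ENNReal.ofReal (kernel n (x - y))) :=
          hk.comp (measurable_id.sub_const y)
        rw [lintegral_mul_const _ this, h2, one_mul]

theorem mollify_eq_normed_convolution (n : ℕ) (f : E3 → ℝ) :
    mollify n f = convolution ((bump n).normed volume) f
      (ContinuousLinearMap.lsmul ℝ ℝ) volume := by
  ext x
  rw [convolution_lsmul_swap, mollify_apply]
  simp [kernel, mul_comm]

/-- Convergence is uniform by uniform continuity, and all differences live in the closed
`1`-neighbourhood of the support, which has finite measure. -/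
theorem tendsto_mollify_of_continuous {f : E3 → ℝ} (hf : Continuous f) (hc : HasCompactSupport f) :
    Tendsto (fun n => eLpNorm (fun x => mollify n f x - f x) 2 volume) atTop (𝓝 0) := by
  have huc : UniformContinuous f := hc.uniformContinuous_of_continuous hf
  set S := Metric.cthickening 1 (tsupport f) with hS
  have hSc : IsCompact S := hc.isCompact.cthickening
  have hSm : volume S ≠ ⊤ := hSc.measure_lt_top.ne
  have hsupp : ∀ n x, x ∉ S → mollify n f x - f x = 0 := by
    intro n x hx
    have hx' : x ∉ tsupport f := fun h => hx (Metric.self_subset_cthickening _ h)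
    rw [image_eq_zero_of_notMem_tsupport hx', sub_zero, mollify_apply]
    refine integral_eq_zero_of_ae (ae_of_all _ fun y => ?_)
    by_cases hy : y ∈ tsupport f
    · have : x - y ∉ tsupport (kernel n) := by
        rw [tsupport_kernel, mem_closedBall_zero_iff]
        intro h
        refine hx (Metric.mem_cthickening_of_dist_le x y 1 _ hy ?_)
        rw [dist_eq_norm]
        refine h.trans ?_
        rw [div_le_one (by positivity)]
        linarith [(Nat.cast_nonneg n : (0 : ℝ) ≤ n)]
      simp [image_eq_zero_of_notMem_tsupport this]
    · simp [image_eq_zero_of_notMem_tsupport hy]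
  have hbound : ∀ ε : ℝ, 0 < ε → ∀ᶠ n in atTop, ∀ x, |mollify n f x - f x| ≤ ε := by
    intro ε hε
    obtain ⟨δ, hδ, hd⟩ := Metric.uniformContinuous_iff.1 huc ε hε
    have : ∀ᶠ n : ℕ in atTop, 1 / ((n : ℝ) + 1) < δ :=
      tendsto_one_div_add_atTop_nhds_zero_nat.eventually_lt_const hδ
    filter_upwards [this] with n hn x
    rw [← Real.dist_eq, mollify_eq_normed_convolution]
    refine ContDiffBump.dist_normed_convolution_le hf.aestronglyMeasurable fun y hy => ?_
    exact (hd ((Metric.mem_ball.1 hy).trans hn)).le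
  rw [ENNReal.tendsto_nhds_zero]
  intro η hη
  have hfin : volume S ^ (1 / (2 : ℝ)) ≠ ⊤ := ENNReal.rpow_ne_top_of_nonneg (by norm_num) hSm
  obtain ⟨ε, hε, hε'⟩ : ∃ ε : ℝ, 0 < ε ∧ volume S ^ (1 / (2 : ℝ)) * ENNReal.ofReal ε ≤ η := by
    rcases eq_or_ne η ⊤ with rfl | hη'
    · exact ⟨1, one_pos, le_top⟩
    obtain ⟨δ, hδ0, hδ⟩ := ENNReal.exists_nnreal_pos_mul_lt hfin hη.ne'
    refine ⟨δ, by exact_mod_cast hδ0, ?_⟩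
    rw [ENNReal.ofReal_coe_nnreal, mul_comm]
    exact hδ.le
  filter_upwards [hbound ε hε] with n hn
  have : (fun x => mollify n f x - f x) = S.indicator (fun x => mollify n f x - f x) := by
    ext x
    by_cases hx : x ∈ S
    · simp [hx]
    · simp [hx, hsupp n x hx]
  rw [this, eLpNorm_indicator_eq_eLpNorm_restrict hSc.measurableSet]
  refine (eLpNorm_le_of_ae_bound (ae_of_all _ hn)).trans ?_
  simpa using hε'

theorem memLp_mollify (n : ℕ) {f : E3 → ℝ} (hf : MemLp f 2 volume) :
    MemLp (mollify n f) 2 volume :=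
  ⟨(contDiff_mollify n (hf.locallyIntegrable (by norm_num))
      (m := 0)).continuous.aestronglyMeasurable,
    (eLpNorm_mollify_le n hf.1).trans_lt hf.2⟩

/-- Approximation by a compactly supported continuous function; the error survives mollification
because mollifying is an `L²` contraction. -/
theorem tendsto_mollify {f : E3 → ℝ} (hf : MemLp f 2 volume) :
    Tendsto (fun n => eLpNorm (fun x => mollify n f x - f x) 2 volume) atTop (𝓝 0) := by
  rw [ENNReal.tendsto_nhds_zero]
  intro η hη
  obtain ⟨g, hgc, hfg, hg, hgm⟩ := hf.exists_hasCompactSupport_eLpNorm_sub_le (by norm_num)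
    (ε := η / 3) (by simpa using hη.ne')
  filter_upwards [ENNReal.tendsto_nhds_zero.1 (tendsto_mollify_of_continuous hg hgc) (η / 3)
    (ENNReal.div_pos hη.ne' (by norm_num))] with n hn
  have hloc : LocallyIntegrable f := hf.locallyIntegrable (by norm_num)
  have hlocg : LocallyIntegrable g := hgm.locallyIntegrable (by norm_num)
  have hd : MemLp (fun x => f x - g x) 2 volume := hf.sub hgm
  have e : (fun x => mollify n f x - f x) =
      (mollify n (fun x => f x - g x) + fun x => mollify n g x - g x) - (f - g) := by
    ext x
    simp [mollify_sub n hloc hlocg]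
  have hm1 := (memLp_mollify n hd).1
  have hm2 := ((memLp_mollify n hgm).sub hgm).1
  rw [e]
  calc _ ≤ eLpNorm (mollify n (fun x => f x - g x) + fun x => mollify n g x - g x) 2 volume
        + eLpNorm (f - g) 2 volume := eLpNorm_sub_le (hm1.add hm2) (hf.1.sub hgm.1) (by norm_num)
    _ ≤ (eLpNorm (mollify n (fun x => f x - g x)) 2 volume
        + eLpNorm (fun x => mollify n g x - g x) 2 volume) + eLpNorm (f - g) 2 volume := by
        gcongr
        exact eLpNorm_add_le hm1 hm2 (by norm_num)
    _ ≤ (η / 3 + η / 3) + η / 3 := by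
        gcongr
        exact (eLpNorm_mollify_le n hd.1).trans hfg
    _ = η := ENNReal.add_thirds η

/-- Products of `L²`-convergent sequences converge in mean. -/
theorem tendsto_integral_mul {α : Type*} [MeasurableSpace α] {μ : Measure α}
    {f g : ℕ → α → ℝ} {f' g' : α → ℝ} (hf : ∀ n, MemLp (f n) 2 μ) (hg : ∀ n, MemLp (g n) 2 μ)
    (hf' : MemLp f' 2 μ) (hg' : MemLp g' 2 μ)
    (h1 : Tendsto (fun n => eLpNorm (fun x => f n x - f' x) 2 μ) atTop (𝓝 0))
    (h2 : Tendsto (fun n => eLpNorm (fun x => g n x - g' x) 2 μ) atTop (𝓝 0)) :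
    Tendsto (fun n => ∫ x, f n x * g n x ∂μ) atTop (𝓝 (∫ x, f' x * g' x ∂μ)) := by
  have key {u v : α → ℝ} (hu : MemLp u 2 μ) (hv : MemLp v 2 μ) :
      inner ℝ (hu.toLp u) (hv.toLp v) = ∫ x, u x * v x ∂μ := by
    rw [L2.inner_def]
    refine integral_congr_ae ?_
    filter_upwards [hu.coeFn_toLp, hv.coeFn_toLp] with x h1 h2
    simp [h1, h2, mul_comm]
  simp only [← fun n => key (hf n) (hg n), ← key hf' hg']
  refine Tendsto.inner ?_ ?_
  · exact (Lp.tendsto_Lp_iff_tendsto_eLpNorm'' _ hf _ hf').2 h1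
  · exact (Lp.tendsto_Lp_iff_tendsto_eLpNorm'' _ hg _ hg').2 h2

/-! ### Test functions and distributional identities on the cylinder. -/

theorem integrable_mul_of_compactSupport {f g : E3 → ℝ} (hf : LocallyIntegrable f)
    (hg : Continuous g) (hc : HasCompactSupport g) : Integrable (fun x => f x * g x) := by
  simpa only [smul_eq_mul, mul_comm] using hf.integrable_smul_left_of_hasCompactSupport hg hc

/-- Smooth functions compactly supported in the cylinder. -/
structure IsTest (θ : E3 → ℝ) : Prop where
  smooth : ContDiff ℝ ∞ θ
  compact : HasCompactSupport θ
  subset : tsupport θ ⊆ cylinder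

theorem IsTest.contDiff_one {θ : E3 → ℝ} (h : IsTest θ) : ContDiff ℝ 1 θ :=
  h.smooth.of_le (by norm_cast)

theorem IsTest.memLp_pd {θ : E3 → ℝ} (h : IsTest θ) (k : Fin 3) : MemLp (pd k θ) 2 volume :=
  memLp_of_continuous_compactSupport (continuous_pd h.contDiff_one k)
    (hasCompactSupport_pd h.compact k)

theorem IsTest.memLp {θ : E3 → ℝ} (h : IsTest θ) : MemLp θ 2 volume :=
  memLp_of_continuous_compactSupport h.smooth.continuous h.compact

theorem IsTest.integrable_mul_pd {θ f : E3 → ℝ} (h : IsTest θ) (hf : LocallyIntegrable f)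
    (k : Fin 3) : Integrable fun x => f x * pd k θ x :=
  integrable_mul_of_compactSupport hf (continuous_pd h.contDiff_one k)
    (hasCompactSupport_pd h.compact k)

/-- Inside the cylinder, mollification is testing against a smooth function. -/
theorem exists_test_mollify (n : ℕ) {x : E3}
    (hx : Metric.closedBall x (1 / (n + 1)) ⊆ cylinder) :
    ∃ θ : E3 → ℝ, IsTest θ ∧ (∀ f : E3 → ℝ, mollify n f x = ∫ y, f y * θ y) ∧
      ∀ f : E3 → ℝ, LocallyIntegrable f → ∀ k, pd k (mollify n f) x = - ∫ y, f y * pd k θ y := by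
  set θ : E3 → ℝ := fun y => kernel n (x - y) with hθ
  have hsm : ContDiff ℝ ∞ θ := (contDiff_kernel n).comp (contDiff_const.sub contDiff_id)
  have hcs : HasCompactSupport θ :=
    (hasCompactSupport_kernel n).comp_homeomorph (Homeomorph.subLeft x)
  have hts : tsupport θ ⊆ cylinder := by
    have : tsupport θ = Homeomorph.subLeft x ⁻¹' tsupport (kernel n) :=
      tsupport_comp_eq_preimage (kernel n) (Homeomorph.subLeft x)
    rw [this, tsupport_kernel]
    intro y hy
    refine hx ?_
    simpa [dist_eq_norm, norm_sub_rev] using hy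
  have hpd (k y) : pd k θ y = - pd k (kernel n) (x - y) := by
    have h1 : HasFDerivAt (kernel n) (fderiv ℝ (kernel n) (x - y)) (x - y) :=
      ((contDiff_kernel n (m := 1)).differentiable one_ne_zero _).hasFDerivAt
    have h2 : HasFDerivAt (fun y => x - y) (-ContinuousLinearMap.id ℝ E3) y :=
      (hasFDerivAt_id y).const_sub x
    have h3 : HasFDerivAt θ _ y := h1.comp y h2
    rw [pd, h3.fderiv]
    simp [pd]
  refine ⟨θ, ⟨hsm, hcs, hts⟩, fun f => rfl, fun f hf k => ?_⟩
  simp only [pd_mollify n hf, hpd, mul_neg, integral_neg, neg_neg]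

/-- `div b = c` in the sense of distributions on the cylinder. -/
def IsWeakDiv (b : Fin 3 → E3 → ℝ) (c : E3 → ℝ) : Prop :=
  ∀ θ : E3 → ℝ, IsTest θ → (∑ k, ∫ x, b k x * pd k θ x) + ∫ x, c x * θ x = 0

/-- A translated kernel supported in the cylinder is an admissible test function, so the weak
equation becomes a classical one for the mollified fields. -/
theorem IsWeakDiv.mollify_eq {b : Fin 3 → E3 → ℝ} {c : E3 → ℝ} (h : IsWeakDiv b c)
    (hb : ∀ k, LocallyIntegrable (b k)) (n : ℕ) {x : E3}
    (hx : Metric.closedBall x (1 / (n + 1)) ⊆ cylinder) :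
    ∑ k, pd k (mollify n (b k)) x = mollify n c x := by
  obtain ⟨θ, hθ, h1, h2⟩ := exists_test_mollify n hx
  have h0 := h θ hθ
  simp only [h1, h2 _ (hb _), Finset.sum_neg_distrib]
  linarith

theorem pd_integral_by_parts {f g : E3 → ℝ} (hf : ContDiff ℝ 1 f) (hg : ContDiff ℝ 1 g)
    (hc : HasCompactSupport g) (k : Fin 3) :
    ∫ x, f x * pd k g x = - ∫ x, pd k f x * g x := by
  refine integral_mul_fderiv_eq_neg_fderiv_mul_of_integrable ?_ ?_ ?_ ?_ ?_
  · exact ((continuous_pd hf k).mul hg.continuous).integrable_of_hasCompactSupport hc.mul_left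
  · exact (hf.continuous.mul (continuous_pd hg k)).integrable_of_hasCompactSupport
      (hasCompactSupport_pd hc k).mul_left
  · exact (hf.continuous.mul hg.continuous).integrable_of_hasCompactSupport hc.mul_left
  · exact fun x _ => hf.differentiable one_ne_zero x
  · exact fun x _ => hg.differentiable one_ne_zero x

theorem eventually_closedBall_subset {K : Set E3} (hK : IsCompact K) (hKs : K ⊆ cylinder) :
    ∀ᶠ n : ℕ in atTop, ∀ x ∈ K, Metric.closedBall x (1 / (n + 1)) ⊆ cylinder := by
  obtain ⟨δ, hδ, hsub⟩ := hK.exists_cthickening_subset_open isOpen_cylinder hKs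
  have : ∀ᶠ n : ℕ in atTop, 1 / ((n : ℝ) + 1) < δ :=
    tendsto_one_div_add_atTop_nhds_zero_nat.eventually_lt_const hδ
  filter_upwards [this] with n hn x hx
  refine Subset.trans ?_ hsub
  exact (Metric.closedBall_subset_closedBall hn.le).trans
    (Metric.closedBall_subset_cthickening hx δ)

theorem tendsto_integral_mollify_mul {f w : E3 → ℝ} (hf : MemLp f 2 volume)
    (hw : MemLp w 2 volume) :
    Tendsto (fun n => ∫ x, mollify n f x * w x) atTop (𝓝 (∫ x, f x * w x)) :=
  tendsto_integral_mul (fun n => memLp_mollify n hf) (fun _ => hw) hf hw (tendsto_mollify hf)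
    (by simp)

/-- Weak identities hold for `C¹` test functions. -/
theorem IsWeakDiv.integral_eq {b : Fin 3 → E3 → ℝ} {c : E3 → ℝ} (h : IsWeakDiv b c)
    (hb : ∀ k, MemLp (b k) 2 volume) (hc : MemLp c 2 volume) {V : E3 → ℝ} (hV : ContDiff ℝ 1 V)
    (hVc : HasCompactSupport V) (hVs : tsupport V ⊆ cylinder) :
    (∑ k, ∫ x, b k x * pd k V x) + ∫ x, c x * V x = 0 := by
  have hbl (k) : LocallyIntegrable (b k) := (hb k).locallyIntegrable (by norm_num)
  have hlim : Tendsto (fun n => (∑ k, ∫ x, mollify n (b k) x * pd k V x) + ∫ x, mollify n c x * V x)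
      atTop (𝓝 ((∑ k, ∫ x, b k x * pd k V x) + ∫ x, c x * V x)) := by
    refine Tendsto.add (tendsto_finsetSum _ fun k _ => ?_) ?_
    · exact tendsto_integral_mollify_mul (hb k) (memLp_of_continuous_compactSupport
        (continuous_pd hV k) (hasCompactSupport_pd hVc k))
    · exact tendsto_integral_mollify_mul hc (memLp_of_continuous_compactSupport hV.continuous hVc)
  refine tendsto_nhds_unique hlim (tendsto_const_nhds.congr' ?_)
  -- For large `n` the mollified equation holds classically on the support of `V`, so the
  -- approximating expression is exactly zero, not merely small.
  filter_upwards [eventually_closedBall_subset hVc.isCompact hVs] with n hn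
  have hC (k) : ContDiff ℝ 1 (mollify n (b k)) := contDiff_mollify n (hbl k) (m := 1)
  have i1 (k) : Integrable (fun x => pd k (mollify n (b k)) x * V x) :=
    ((continuous_pd (hC k) k).mul hV.continuous).integrable_of_hasCompactSupport hVc.mul_left
  simp only [pd_integral_by_parts (hC _) hV hVc]
  rw [Finset.sum_neg_distrib, ← integral_finsetSum _ fun k _ => i1 k]
  have : ∀ x, ∑ k, pd k (mollify n (b k)) x * V x = mollify n c x * V x := by
    intro x
    by_cases hx : x ∈ tsupport V
    · rw [← Finset.sum_mul, h.mollify_eq hbl n (hn x hx)]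
    · simp [image_eq_zero_of_notMem_tsupport hx]
  simp [this]

/-! ### The Poincaré inequality on convex sets -/

/-- The squared length of the gradient. -/
def grad2 (h : E3 → ℝ) (x : E3) : ℝ := ∑ k, pd k h x ^ 2

theorem grad2_nonneg (h : E3 → ℝ) (x : E3) : 0 ≤ grad2 h x := Finset.sum_nonneg fun _ _ => sq_nonneg _

theorem continuous_grad2 {h : E3 → ℝ} (hh : ContDiff ℝ 1 h) : Continuous (grad2 h) :=
  continuous_finsetSum _ fun k _ => (continuous_pd hh k).pow 2

theorem fderiv_apply_eq_sum (h : E3 → ℝ) (x v : E3) : fderiv ℝ h x v = ∑ k, v k * pd k h x := by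
  have : v = ∑ k, v k • EuclideanSpace.single k (1 : ℝ) := by
    ext i; simp [Finset.sum_apply, Pi.single_apply]
  conv_lhs => rw [this]
  simp [map_sum, pd]

theorem sq_fderiv_apply_le (h : E3 → ℝ) (x v : E3) :
    fderiv ℝ h x v ^ 2 ≤ grad2 h x * ‖v‖ ^ 2 := by
  rw [fderiv_apply_eq_sum, EuclideanSpace.norm_sq_eq, mul_comm]
  simpa [grad2] using Finset.sum_mul_sq_le_sq_mul_sq Finset.univ (fun k => v k) fun k => pd k h x

theorem enorm_sq_eq_ofReal (r : ℝ) : ‖r‖ₑ ^ 2 = ENNReal.ofReal (r ^ 2) := by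
  rw [Real.enorm_eq_ofReal_abs, ← ENNReal.ofReal_pow (abs_nonneg r), sq_abs]

/-- The fundamental theorem of calculus along the segment, followed by Cauchy–Schwarz on the unit
interval. -/
theorem sq_sub_le_lintegral_segment {h : E3 → ℝ} (hh : ContDiff ℝ 1 h) (x y : E3) {D : ℝ}
    (hD : ‖y - x‖ ≤ D) :
    ‖h y - h x‖ₑ ^ 2 ≤ ENNReal.ofReal (D ^ 2) *
      ∫⁻ t in Ioc (0 : ℝ) 1, ENNReal.ofReal (grad2 h (x + t • (y - x))) := by
  have hder (t : ℝ) : HasDerivAt (fun t : ℝ => h (x + t • (y - x)))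
      (fderiv ℝ h (x + t • (y - x)) (y - x)) t := by
    have h1 : HasDerivAt (fun t : ℝ => x + t • (y - x)) (y - x) t := by
      simpa using ((hasDerivAt_id t).smul_const (y - x)).const_add x
    exact ((hh.differentiable one_ne_zero _).hasFDerivAt).comp_hasDerivAt t h1
  have hcont : Continuous fun t : ℝ => fderiv ℝ h (x + t • (y - x)) (y - x) :=
    ((hh.continuous_fderiv one_ne_zero).comp (by fun_prop)).clm_apply continuous_const
  have hint := intervalIntegral.integral_eq_sub_of_hasDerivAt (fun t _ => hder t)
    (hcont.intervalIntegrable 0 1)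
  simp only [one_smul, add_sub_cancel, zero_smul, add_zero] at hint
  rw [← hint, intervalIntegral.integral_of_le zero_le_one, ← lintegral_const_mul' _ _ (by simp)]
  have h1 : ∫⁻ t : ℝ, (1 : ℝ≥0∞) ∂(volume.restrict (Ioc (0 : ℝ) 1)) = 1 := by simp
  refine le_trans ?_ ((sq_lintegral_mul_le (μ := volume.restrict (Ioc (0 : ℝ) 1))
    (r := fun _ => 1) (F := fun t => ‖fderiv ℝ h (x + t • (y - x)) (y - x)‖ₑ) (by fun_prop)
    hcont.enorm.aemeasurable h1).trans ?_)
  · gcongr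
    simpa using enorm_integral_le_lintegral_enorm (μ := volume.restrict (Ioc (0 : ℝ) 1))
      fun t => fderiv ℝ h (x + t • (y - x)) (y - x)
  · refine lintegral_mono fun t => ?_
    simp only [one_mul]
    rw [enorm_sq_eq_ofReal, ← ENNReal.ofReal_mul (sq_nonneg D)]
    apply ENNReal.ofReal_le_ofReal
    refine (sq_fderiv_apply_le _ _ _).trans ?_
    rw [mul_comm]
    gcongr
    exact grad2_nonneg _ _

/-- The dilation by `t` has Jacobian `t³ ≥ 1/8`. -/
theorem lintegral_comp_add_smul_le {F : E3 → ℝ≥0∞} (hF : Measurable F) (x : E3) {t : ℝ}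
    (ht : 1 / 2 ≤ t) : ∫⁻ y, F (x + t • y) ≤ 8 * ∫⁻ y, F y := by
  have ht0 : t ≠ 0 := by linarith
  have h1 : ∫⁻ y, F (x + t • y) = ∫⁻ z, F (x + z) ∂(Measure.map (t • ·) volume) := by
    exact (lintegral_map (hF.comp (measurable_const_add x)) (measurable_const_smul t)).symm
  rw [h1, Measure.map_addHaar_smul _ ht0, lintegral_smul_measure, lintegral_add_left_eq_self]
  simp only [smul_eq_mul]
  gcongr
  rw [show (8 : ℝ≥0∞) = ENNReal.ofReal 8 by norm_num]
  apply ENNReal.ofReal_le_ofReal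
  rw [finrank_euclideanSpace, Fintype.card_fin, abs_of_pos (by positivity)]
  have : (1 / 8 : ℝ) ≤ t ^ 3 := by
    calc (1 / 8 : ℝ) = (1 / 2) ^ 3 := by norm_num
      _ ≤ t ^ 3 := by gcongr
  calc (t ^ 3)⁻¹ ≤ (1 / 8 : ℝ)⁻¹ := by gcongr
    _ = 8 := by norm_num

/-- One of `t` and `1 - t` is at least `1/2`; integrating first over the endpoint that carries this
coefficient gives a change of variables whose Jacobian stays away from zero. -/
theorem lintegral_segments_le {K : Set E3} {F : E3 → ℝ≥0∞}
    (hF : Measurable F) {t : ℝ} :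
    ∫⁻ x in K, ∫⁻ y in K, F (x + t • (y - x)) ≤ volume K * (8 * ∫⁻ y, F y) := by
  have e (x y : E3) : x + t • (y - x) = (1 - t) • x + t • y := by module
  have hm : Measurable (Function.uncurry fun x y : E3 => F ((1 - t) • x + t • y)) :=
    hF.comp (by fun_prop)
  simp only [e]
  rcases le_total (1 / 2) t with ht | ht
  · calc _ ≤ ∫⁻ x in K, 8 * ∫⁻ y, F y := by
          refine lintegral_mono fun x => ?_
          exact (setLIntegral_le_lintegral _ _).trans (lintegral_comp_add_smul_le hF _ ht)
      _ = _ := by rw [setLIntegral_const, mul_comm]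
  · rw [lintegral_lintegral_swap hm.aemeasurable]
    calc _ ≤ ∫⁻ y in K, 8 * ∫⁻ y, F y := by
          refine lintegral_mono fun y => ?_
          refine (setLIntegral_le_lintegral _ _).trans ?_
          simp only [add_comm _ (t • y)]
          exact lintegral_comp_add_smul_le hF _ (by linarith)
      _ = _ := by rw [setLIntegral_const, mul_comm]

/-- The Poincaré inequality on a bounded convex set. -/
theorem poincare_convex {K : Set E3} (hK : MeasurableSet K) (hKc : Convex ℝ K)
    (hK0 : volume K ≠ 0) {D : ℝ} (hKf : volume K ≠ ⊤)
    (hD : ∀ x ∈ K, ∀ y ∈ K, ‖y - x‖ ≤ D) {h : E3 → ℝ} (hh : ContDiff ℝ 1 h)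
    (hint : IntegrableOn h K) :
    ∫⁻ x in K, ‖h x - ⨍ y in K, h y‖ₑ ^ 2 ≤
      ENNReal.ofReal (8 * D ^ 2) * ∫⁻ x in K, ENNReal.ofReal (grad2 h x) := by
  -- Convexity keeps every segment inside `K`, so the squared gradient may be cut off outside `K`;
  -- the inner integrals can then be extended to the whole space.
  set F : E3 → ℝ≥0∞ := K.indicator fun x => ENNReal.ofReal (grad2 h x) with hFdef
  have hg : Measurable fun x => ENNReal.ofReal (grad2 h x) :=
    (continuous_grad2 hh).measurable.ennreal_ofReal
  have hF : Measurable F := hg.indicator hK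
  have hFint : ∫⁻ y, F y = ∫⁻ x in K, ENNReal.ofReal (grad2 h x) := lintegral_indicator hK _
  have hpt (x : E3) : ‖h x - ⨍ y in K, h y‖ₑ ^ 2 ≤
      (volume K)⁻¹ * ∫⁻ y in K, ‖h y - h x‖ₑ ^ 2 := by
    have hr : ∫⁻ _ in K, (volume K)⁻¹ = 1 := by
      rw [setLIntegral_const, ENNReal.inv_mul_cancel hK0 hKf]
    have := sq_lintegral_mul_le (μ := volume.restrict K) (r := fun _ => (volume K)⁻¹)
      (F := fun y => ‖h y - h x‖ₑ) (by fun_prop)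
      (hh.continuous.sub continuous_const).enorm.aemeasurable hr
    rw [lintegral_const_mul' _ _ (by simpa using hK0),
      lintegral_const_mul' _ _ (by simpa using hK0)] at this
    refine le_trans ?_ this
    have hfin : IsFiniteMeasure (volume.restrict K) := isFiniteMeasure_restrict.2 hKf
    have e : ⨍ y in K, h y - h x = -(h x - ⨍ y in K, h y) := by
      rw [setAverage_eq, setAverage_eq, integral_sub hint (integrable_const _),
        integral_const, smul_sub, smul_smul]
      have : (volume.real K)⁻¹ * ((volume.restrict K).real univ) = 1 := by
        rw [measureReal_restrict_apply_univ]
        exact inv_mul_cancel₀ (ENNReal.toReal_ne_zero.2 ⟨hK0, hKf⟩)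
      rw [this, one_smul]; ring
    rw [← enorm_neg, ← e, setAverage_eq, enorm_smul]
    gcongr
    · rw [measureReal_def, enorm_inv (ENNReal.toReal_ne_zero.2 ⟨hK0, hKf⟩),
        Real.enorm_eq_ofReal ENNReal.toReal_nonneg, ENNReal.ofReal_toReal hKf]
    · exact enorm_integral_le_lintegral_enorm _
  have hm : Measurable fun q : (E3 × E3) × ℝ => F (q.1.1 + q.2 • (q.1.2 - q.1.1)) :=
    hF.comp (by fun_prop)
  calc ∫⁻ x in K, ‖h x - ⨍ y in K, h y‖ₑ ^ 2
      ≤ ∫⁻ x in K, (volume K)⁻¹ * ∫⁻ y in K, ENNReal.ofReal (D ^ 2) *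
          ∫⁻ t in Ioc (0 : ℝ) 1, F (x + t • (y - x)) := by
        refine setLIntegral_mono' hK fun x hx => (hpt x).trans (mul_le_mul_right ?_ _)
        refine setLIntegral_mono' hK fun y hy =>
          (sq_sub_le_lintegral_segment hh x y (hD x hx y hy)).trans (mul_le_mul_right ?_ _)
        refine setLIntegral_mono' measurableSet_Ioc fun t ht => ?_
        rw [hFdef, indicator_of_mem]
        exact hKc.add_smul_sub_mem hx hy ⟨ht.1.le, ht.2⟩
    _ = (volume K)⁻¹ * (ENNReal.ofReal (D ^ 2) *
          ∫⁻ x in K, ∫⁻ y in K, ∫⁻ t in Ioc (0 : ℝ) 1, F (x + t • (y - x))) := by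
        have hi : (volume K)⁻¹ ≠ ⊤ := by simpa using hK0
        rw [lintegral_const_mul' _ _ hi]
        congr 1
        rw [← lintegral_const_mul' _ _ ENNReal.ofReal_ne_top]
        refine lintegral_congr fun x => ?_
        rw [lintegral_const_mul' _ _ ENNReal.ofReal_ne_top]
    _ = (volume K)⁻¹ * (ENNReal.ofReal (D ^ 2) *
          ∫⁻ t in Ioc (0 : ℝ) 1, ∫⁻ x in K, ∫⁻ y in K, F (x + t • (y - x))) := by
        congr 2
        trans ∫⁻ x in K, ∫⁻ t in Ioc (0 : ℝ) 1, ∫⁻ y in K, F (x + t • (y - x))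
        · refine lintegral_congr fun x => ?_
          exact lintegral_lintegral_swap (hm.comp (by fun_prop :
            Measurable fun q : E3 × ℝ => ((x, q.1), q.2))).aemeasurable
        · refine lintegral_lintegral_swap (Measurable.aemeasurable ?_)
          exact Measurable.lintegral_prod_right' (f := fun q : (E3 × ℝ) × E3 =>
            F (q.1.1 + q.1.2 • (q.2 - q.1.1))) (hF.comp (by fun_prop))
    _ ≤ (volume K)⁻¹ * (ENNReal.ofReal (D ^ 2) *
          ∫⁻ t in Ioc (0 : ℝ) 1, volume K * (8 * ∫⁻ y, F y)) := by
        gcongr with t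
        exact lintegral_segments_le hF
    _ = _ := by
        rw [setLIntegral_const, hFint, Real.volume_Ioc, sub_zero, ENNReal.ofReal_one, mul_one,
          ENNReal.ofReal_mul (by norm_num)]
        calc _ = ((volume K)⁻¹ * volume K) * (ENNReal.ofReal (D ^ 2) *
              (8 * ∫⁻ x in K, ENNReal.ofReal (grad2 h x))) := by ring
          _ = _ := by
            rw [ENNReal.inv_mul_cancel hK0 hKf, show ENNReal.ofReal 8 = 8 by norm_num]; ring

/-! ### A weight comparable to the distance from the boundary -/

/-- Vanishes on the lateral boundary. -/
def fa (x : E3) : ℝ := 1 - x 0 ^ 2 - x 1 ^ 2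
/-- Vanishes on the bases. -/
def fb (x : E3) : ℝ := 1 - 4 * (x 2 - 1 / 2) ^ 2

theorem mem_cylinder_iff (x : E3) : x ∈ cylinder ↔ 0 < fa x ∧ 0 < fb x := by
  have e : fb x = 4 * (x 2 * (1 - x 2)) := by rw [fb]; ring
  rw [e]
  constructor
  · rintro ⟨h1, h2, h3⟩
    refine ⟨by rw [fa]; linarith, ?_⟩
    have := mul_pos h2 (sub_pos.2 h3)
    linarith
  · rintro ⟨h1, h2⟩
    have h3 : 0 < x 2 * (1 - x 2) := by linarith
    refine ⟨by rw [fa] at h1; linarith, ?_, ?_⟩ <;> nlinarith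

theorem fa_le_one (x : E3) : fa x ≤ 1 := by rw [fa]; nlinarith [sq_nonneg (x 0), sq_nonneg (x 1)]
theorem fb_le_one (x : E3) : fb x ≤ 1 := by rw [fb]; nlinarith [sq_nonneg (x 2 - 1 / 2)]

theorem contDiff_fa {n : WithTop ℕ∞} : ContDiff ℝ n fa := by unfold fa; fun_prop
theorem contDiff_fb {n : WithTop ℕ∞} : ContDiff ℝ n fb := by unfold fb; fun_prop

/-- A smooth substitute for `min (fa x) (fb x)` inside the cylinder: it lies between half of this
minimum and the minimum itself, and vanishes linearly at the boundary without a kink along the set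
where the two are equal. -/
def zeta (x : E3) : ℝ := fa x * fb x / (fa x + fb x)

theorem zeta_pos {x : E3} (hx : x ∈ cylinder) : 0 < zeta x := by
  obtain ⟨h1, h2⟩ := (mem_cylinder_iff x).1 hx
  exact div_pos (mul_pos h1 h2) (add_pos h1 h2)

theorem zeta_lt_fa {x : E3} (hx : x ∈ cylinder) : zeta x < fa x := by
  obtain ⟨h1, h2⟩ := (mem_cylinder_iff x).1 hx
  rw [zeta, div_lt_iff₀ (add_pos h1 h2)]; nlinarith

theorem zeta_lt_fb {x : E3} (hx : x ∈ cylinder) : zeta x < fb x := by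
  obtain ⟨h1, h2⟩ := (mem_cylinder_iff x).1 hx
  rw [zeta, div_lt_iff₀ (add_pos h1 h2)]; nlinarith

theorem zeta_le_half {x : E3} (hx : x ∈ cylinder) : zeta x ≤ 1 / 2 := by
  obtain ⟨h1, h2⟩ := (mem_cylinder_iff x).1 hx
  rw [zeta, div_le_iff₀ (add_pos h1 h2)]
  nlinarith [fa_le_one x, fb_le_one x]

theorem contDiffOn_zeta {n : WithTop ℕ∞} : ContDiffOn ℝ n zeta cylinder := by
  refine (contDiff_fa.mul contDiff_fb).contDiffOn.div (contDiff_fa.add contDiff_fb).contDiffOn ?_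
  intro x hx
  obtain ⟨h1, h2⟩ := (mem_cylinder_iff x).1 hx
  exact (add_pos h1 h2).ne'

theorem differentiableAt_zeta {x : E3} (hx : x ∈ cylinder) : DifferentiableAt ℝ zeta x :=
  ((contDiffOn_zeta (n := 1)).differentiableOn one_ne_zero).differentiableAt
    (isOpen_cylinder.mem_nhds hx)

theorem hasFDerivAt_coord (j : Fin 3) (x : E3) :
    HasFDerivAt (fun y : E3 => y j) (EuclideanSpace.proj j : E3 →L[ℝ] ℝ) x :=
  (EuclideanSpace.proj j : E3 →L[ℝ] ℝ).hasFDerivAt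

theorem pd_fa (k : Fin 3) (x : E3) : pd k fa x = ![-2 * x 0, -2 * x 1, 0] k := by
  have h := ((((hasFDerivAt_coord 0 x).pow 2).const_sub 1).sub ((hasFDerivAt_coord 1 x).pow 2))
  have h' : HasFDerivAt fa _ x := h
  rw [pd, h'.fderiv]
  fin_cases k <;> simp

theorem pd_fb (k : Fin 3) (x : E3) : pd k fb x = ![0, 0, -8 * (x 2 - 1 / 2)] k := by
  have h := (((((hasFDerivAt_coord 2 x).sub_const (1 / 2)).pow 2).const_mul 4).const_sub 1)
  have h' : HasFDerivAt fb _ x := h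
  rw [pd, h'.fderiv]
  fin_cases k <;> simp; ring

/-- Obtained by differentiating the identity `zeta * (fa + fb) = fa * fb` instead of a quotient. -/
theorem pd_zeta {x : E3} (hx : x ∈ cylinder) (k : Fin 3) :
    pd k zeta x = (fb x ^ 2 * pd k fa x + fa x ^ 2 * pd k fb x) / (fa x + fb x) ^ 2 := by
  obtain ⟨h1, h2⟩ := (mem_cylinder_iff x).1 hx
  have hs : fa x + fb x ≠ 0 := (add_pos h1 h2).ne'
  have ha : DifferentiableAt ℝ fa x := (contDiff_fa (n := 1)).differentiable one_ne_zero x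
  have hb : DifferentiableAt ℝ fb x := (contDiff_fb (n := 1)).differentiable one_ne_zero x
  have heq : (fun y => zeta y * (fa y + fb y)) =ᶠ[𝓝 x] fun y => fa y * fb y := by
    filter_upwards [isOpen_cylinder.mem_nhds hx] with y hy
    obtain ⟨k1, k2⟩ := (mem_cylinder_iff y).1 hy
    rw [zeta, div_mul_cancel₀ _ (add_pos k1 k2).ne']
  have h : pd k (fun y => zeta y * (fa y + fb y)) x = pd k (fun y => fa y * fb y) x := by
    rw [pd, heq.fderiv_eq]; rfl
  have hadd : pd k (fun y => fa y + fb y) x = pd k fa x + pd k fb x := by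
    rw [pd, fderiv_fun_add ha hb]; rfl
  rw [pd_mul (differentiableAt_zeta hx) (ha.fun_add hb), pd_mul ha hb, hadd] at h
  have hz : zeta x * (fa x + fb x) = fa x * fb x := by rw [zeta, div_mul_cancel₀ _ hs]
  rw [eq_div_iff (pow_ne_zero 2 hs)]
  linear_combination (fa x + fb x) * h - (pd k fa x + pd k fb x) * hz

/-- The position relative to the centre of the cylinder. -/
def cent (k : Fin 3) (x : E3) : ℝ := ![x 0, x 1, x 2 - 1 / 2] k

/-- The field pointing away from the centre is transversal to the boundary, with slope tending to
`-1` or below; this drives the Hardy inequality. After clearing denominators the inequality is `0 ≤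
(fa - fb)²`. -/
theorem sum_cent_mul_pd_zeta_le {x : E3} (hx : x ∈ cylinder) :
    ∑ k, cent k x * pd k zeta x ≤ -(1 - 2 * zeta x) := by
  obtain ⟨h1, h2⟩ := (mem_cylinder_iff x).1 hx
  have hs : 0 < fa x + fb x := add_pos h1 h2
  simp only [Fin.sum_univ_three, pd_zeta hx, pd_fa, pd_fb, cent, Matrix.cons_val_zero,
    Matrix.cons_val_one, Matrix.cons_val, zeta]
  have ea : x 0 ^ 2 + x 1 ^ 2 = 1 - fa x := by rw [fa]; ring
  have eb : 4 * (x 2 - 1 / 2) ^ 2 = 1 - fb x := by rw [fb]; ring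
  have e1 : x 0 * ((fb x ^ 2 * (-2 * x 0) + fa x ^ 2 * 0) / (fa x + fb x) ^ 2) +
      x 1 * ((fb x ^ 2 * (-2 * x 1) + fa x ^ 2 * 0) / (fa x + fb x) ^ 2) +
      (x 2 - 1 / 2) * ((fb x ^ 2 * 0 + fa x ^ 2 * (-8 * (x 2 - 1 / 2))) / (fa x + fb x) ^ 2) =
      -(2 * (fb x ^ 2 * (1 - fa x) + fa x ^ 2 * (1 - fb x))) / (fa x + fb x) ^ 2 := by
    rw [← ea, ← eb]; ring
  rw [e1, div_le_iff₀ (by positivity)]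
  have e2 : -(1 - 2 * (fa x * fb x / (fa x + fb x))) * (fa x + fb x) ^ 2 =
      -((fa x + fb x) ^ 2 - 2 * (fa x * fb x) * (fa x + fb x)) := by
    field_simp
  rw [e2]
  nlinarith [sq_nonneg (fa x - fb x)]

theorem grad2_zeta_le {x : E3} (hx : x ∈ cylinder) : grad2 zeta x ≤ 16 := by
  obtain ⟨h1, h2⟩ := (mem_cylinder_iff x).1 hx
  have hs : 0 < fa x + fb x := add_pos h1 h2
  have ea : x 0 ^ 2 + x 1 ^ 2 = 1 - fa x := by rw [fa]; ring
  have eb : 4 * (x 2 - 1 / 2) ^ 2 = 1 - fb x := by rw [fb]; ring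
  have e : grad2 zeta x = (4 * (1 - fa x) * fb x ^ 4 + 16 * (1 - fb x) * fa x ^ 4) /
      (fa x + fb x) ^ 4 := by
    rw [← ea, ← eb]
    simp only [grad2, Fin.sum_univ_three, pd_zeta hx, pd_fa, pd_fb, Matrix.cons_val_zero,
      Matrix.cons_val_one, Matrix.cons_val]
    field_simp
    ring
  rw [e, div_le_iff₀ (by positivity)]
  have p1 : 0 ≤ fa x * fb x ^ 4 := by positivity
  have p2 : 0 ≤ fb x * fa x ^ 4 := by positivity
  have p3 : 0 ≤ fa x ^ 3 * fb x := by positivity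
  have p4 : 0 ≤ fa x * fb x ^ 3 := by positivity
  have p5 : 0 ≤ fa x ^ 2 * fb x ^ 2 := by positivity
  have p6 : 0 ≤ fb x ^ 4 := by positivity
  nlinarith

/-- Compact subsets exhausting the cylinder. -/
def slab (τ : ℝ) : Set E3 := {x | τ ≤ fa x ∧ τ ≤ fb x}

theorem slab_subset {τ : ℝ} (hτ : 0 < τ) : slab τ ⊆ cylinder := fun x hx =>
  (mem_cylinder_iff x).2 ⟨hτ.trans_le hx.1, hτ.trans_le hx.2⟩

theorem isClosed_slab (τ : ℝ) : IsClosed (slab τ) := by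
  have h1 : IsClosed {x : E3 | τ ≤ fa x} :=
    isClosed_le continuous_const (contDiff_fa (n := 0)).continuous
  have h2 : IsClosed {x : E3 | τ ≤ fb x} :=
    isClosed_le continuous_const (contDiff_fb (n := 0)).continuous
  exact h1.inter h2

theorem isCompact_slab {τ : ℝ} (hτ : 0 < τ) : IsCompact (slab τ) :=
  Metric.isCompact_of_isClosed_isBounded (isClosed_slab τ)
    (isBounded_cylinder.subset (slab_subset hτ))

/-! ### Truncated weights, extended by zero to the whole space. -/

theorem tsupport_indicator_subset {f : E3 → ℝ} {τ : ℝ}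
    (h0 : ∀ x ∈ cylinder, x ∉ slab τ → f x = 0) : tsupport (cylinder.indicator f) ⊆ slab τ := by
  refine closure_minimal (fun x hx => ?_) (isClosed_slab τ)
  by_contra hxs
  refine hx ?_
  by_cases hxc : x ∈ cylinder
  · simp [hxc, h0 x hxc hxs]
  · simp [hxc]

theorem contDiff_indicator {f : E3 → ℝ} {τ : ℝ} (hτ : 0 < τ) (hf : ContDiffOn ℝ 1 f cylinder)
    (h0 : ∀ x ∈ cylinder, x ∉ slab τ → f x = 0) : ContDiff ℝ 1 (cylinder.indicator f) := by
  rw [contDiff_iff_contDiffAt]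
  intro x
  by_cases hx : x ∈ cylinder
  · refine (hf.contDiffAt (isOpen_cylinder.mem_nhds hx)).congr_of_eventuallyEq ?_
    filter_upwards [isOpen_cylinder.mem_nhds hx] with y hy
    simp [hy]
  · have hx' : x ∈ (slab τ)ᶜ := fun h => hx (slab_subset hτ h)
    refine (contDiffAt_const (c := (0 : ℝ))).congr_of_eventuallyEq ?_
    filter_upwards [(isClosed_slab τ).isOpen_compl.mem_nhds hx'] with y hy
    exact image_eq_zero_of_notMem_tsupport fun h => hy (tsupport_indicator_subset h0 h)

theorem pd_indicator {f : E3 → ℝ} {x : E3} (hx : x ∈ cylinder) (k : Fin 3) :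
    pd k (cylinder.indicator f) x = pd k f x := by
  have : cylinder.indicator f =ᶠ[𝓝 x] f := by
    filter_upwards [isOpen_cylinder.mem_nhds hx] with y hy
    simp [hy]
  rw [pd, pd, this.fderiv_eq]

/-- The squared positive part of `s - τ`. -/
def posSq (τ s : ℝ) : ℝ := max (s - τ) 0 ^ 2

theorem hasDerivAt_posSq (τ s : ℝ) : HasDerivAt (posSq τ) (2 * max (s - τ) 0) s := by
  have hsq : HasDerivAt (fun s : ℝ => (s - τ) ^ 2) (2 * (s - τ)) s := by
    simpa using ((hasDerivAt_id' s).sub_const τ).fun_pow 2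
  rcases lt_trichotomy s τ with h | h | h
  · rw [max_eq_right (by linarith), mul_zero]
    refine (hasDerivAt_const s (0 : ℝ)).congr_of_eventuallyEq ?_
    filter_upwards [Iio_mem_nhds h] with t ht
    simp [posSq, max_eq_right (sub_nonpos.2 (mem_Iio.1 ht).le)]
  · subst h
    simp only [sub_self, max_self, mul_zero] at hsq ⊢
    rw [hasDerivAt_iff_isLittleO] at hsq ⊢
    refine Asymptotics.IsBigO.trans_isLittleO (Asymptotics.IsBigO.of_bound 1 ?_) hsq
    refine Eventually.of_forall fun t => ?_
    simp only [posSq, sub_self, max_self, smul_zero, sub_zero, one_mul, Real.norm_eq_abs]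
    rw [zero_pow two_ne_zero, sub_zero, sub_zero, abs_of_nonneg (sq_nonneg _),
      abs_of_nonneg (sq_nonneg _)]
    rcases le_total t s with ht | ht
    · rw [max_eq_right (sub_nonpos.2 ht)]; simpa using sq_nonneg (t - s)
    · rw [max_eq_left (sub_nonneg.2 ht)]
  · rw [max_eq_left (by linarith)]
    refine hsq.congr_of_eventuallyEq ?_
    filter_upwards [Ioi_mem_nhds h] with t ht
    simp [posSq, max_eq_left (sub_nonneg.2 (mem_Ioi.1 ht).le)]

theorem contDiff_posSq (τ : ℝ) : ContDiff ℝ 1 (posSq τ) := by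
  rw [contDiff_one_iff_deriv]
  refine ⟨fun s => (hasDerivAt_posSq τ s).differentiableAt, ?_⟩
  have : deriv (posSq τ) = fun s => 2 * max (s - τ) 0 := by
    ext s; exact (hasDerivAt_posSq τ s).deriv
  rw [this]
  fun_prop

theorem posSq_eq_zero {τ : ℝ} {x : E3} (hx : x ∈ cylinder) (hs : x ∉ slab τ) :
    posSq τ (zeta x) = 0 := by
  have : zeta x ≤ τ := by
    by_contra h
    push Not at h
    exact hs ⟨(h.trans (zeta_lt_fa hx)).le, (h.trans (zeta_lt_fb hx)).le⟩
  simp [posSq, max_eq_right (sub_nonpos.2 this)]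

/-- The weight `(ζ - τ)₊²`. -/
def om (τ : ℝ) : E3 → ℝ := cylinder.indicator fun x => posSq τ (zeta x)
/-- The weight `(ζ - τ)₊² / ζ`. -/
def ch (τ : ℝ) : E3 → ℝ := cylinder.indicator fun x => posSq τ (zeta x) / zeta x
/-- The derivative of `(ζ - τ)₊² / ζ` with respect to `ζ`. -/
def qq (τ : ℝ) : E3 → ℝ := cylinder.indicator fun x =>
  (2 * max (zeta x - τ) 0 * zeta x - max (zeta x - τ) 0 ^ 2) / zeta x ^ 2

theorem contDiffOn_posSq_zeta (τ : ℝ) : ContDiffOn ℝ 1 (fun x => posSq τ (zeta x)) cylinder :=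
  (contDiff_posSq τ).comp_contDiffOn contDiffOn_zeta

theorem contDiff_om {τ : ℝ} (hτ : 0 < τ) : ContDiff ℝ 1 (om τ) :=
  contDiff_indicator hτ (contDiffOn_posSq_zeta τ) fun _ => posSq_eq_zero

theorem contDiff_ch {τ : ℝ} (hτ : 0 < τ) : ContDiff ℝ 1 (ch τ) :=
  contDiff_indicator hτ
    ((contDiffOn_posSq_zeta τ).div contDiffOn_zeta fun _ hx => (zeta_pos hx).ne')
    fun _ hx hs => by simp [posSq_eq_zero hx hs]

theorem tsupport_om (τ : ℝ) : tsupport (om τ) ⊆ slab τ :=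
  tsupport_indicator_subset fun _ => posSq_eq_zero

theorem tsupport_ch (τ : ℝ) : tsupport (ch τ) ⊆ slab τ :=
  tsupport_indicator_subset fun _ hx hs => by simp [posSq_eq_zero hx hs]

theorem hasCompactSupport_om {τ : ℝ} (hτ : 0 < τ) : HasCompactSupport (om τ) :=
  (isCompact_slab hτ).of_isClosed_subset (isClosed_tsupport _) (tsupport_om τ)

theorem hasCompactSupport_ch {τ : ℝ} (hτ : 0 < τ) : HasCompactSupport (ch τ) :=
  (isCompact_slab hτ).of_isClosed_subset (isClosed_tsupport _) (tsupport_ch τ)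

theorem pd_om {τ : ℝ} {x : E3} (hx : x ∈ cylinder) (k : Fin 3) :
    pd k (om τ) x = 2 * max (zeta x - τ) 0 * pd k zeta x := by
  have h : HasFDerivAt (fun x => posSq τ (zeta x)) _ x :=
    (hasDerivAt_posSq τ (zeta x)).comp_hasFDerivAt x (differentiableAt_zeta hx).hasFDerivAt
  rw [om, pd_indicator hx, pd, h.fderiv]
  simp [pd]

theorem pd_ch {τ : ℝ} {x : E3} (hx : x ∈ cylinder) (k : Fin 3) :
    pd k (ch τ) x = qq τ x * pd k zeta x := by
  have hz := zeta_pos hx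
  have h2 : HasDerivAt (fun s => posSq τ s / s)
      ((2 * max (zeta x - τ) 0 * zeta x - posSq τ (zeta x) * 1) / zeta x ^ 2) (zeta x) :=
    (hasDerivAt_posSq τ (zeta x)).div (hasDerivAt_id _) hz.ne'
  have h : HasFDerivAt (fun x => posSq τ (zeta x) / zeta x) _ x :=
    h2.comp_hasFDerivAt x (differentiableAt_zeta hx).hasFDerivAt
  rw [ch, pd_indicator hx, pd, h.fderiv]
  simp [pd, qq, hx, posSq]

/-! ### Hardy and Caccioppoli inequalities -/

theorem max_zeta_mem {τ : ℝ} (hτ : 0 < τ) {x : E3} (hx : x ∈ cylinder) :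
    0 ≤ max (zeta x - τ) 0 ∧ max (zeta x - τ) 0 ≤ zeta x :=
  ⟨le_max_right _ _, max_le (by linarith) (zeta_pos hx).le⟩

theorem qq_mem_Icc {τ : ℝ} (hτ : 0 < τ) (x : E3) : 0 ≤ qq τ x ∧ qq τ x ≤ 1 := by
  by_cases hx : x ∈ cylinder
  · have hz := zeta_pos hx
    obtain ⟨h1, h2⟩ := max_zeta_mem hτ hx
    rw [qq, indicator_of_mem hx]
    set m := max (zeta x - τ) 0
    refine ⟨div_nonneg (by nlinarith) (by positivity), ?_⟩
    rw [div_le_one (by positivity)]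
    nlinarith [sq_nonneg (zeta x - m)]
  · simp [qq, hx]

/-- With `m = (ζ - τ)₊` and `m ≤ ζ` these reduce to `2m² ≤ 2mζ` and `m³(ζ - m) ≥ 0`. The last bound
lets the cross term in the Hardy inequality be split between `qq * f²` and `om * |∇f|²`. -/
theorem ch_bounds {τ : ℝ} (hτ : 0 < τ) {x : E3} (hx : x ∈ cylinder) :
    0 ≤ ch τ x ∧ ch τ x ≤ zeta x * qq τ x ∧ ch τ x ^ 2 ≤ qq τ x * om τ x := by
  have hz := zeta_pos hx
  obtain ⟨h1, h2⟩ := max_zeta_mem hτ hx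
  rw [qq, ch, om, indicator_of_mem hx, indicator_of_mem hx, indicator_of_mem hx, posSq]
  set m := max (zeta x - τ) 0
  set z := zeta x
  have e1 : z * ((2 * m * z - m ^ 2) / z ^ 2) = (2 * m * z - m ^ 2) / z := by field_simp
  have e2 : (2 * m * z - m ^ 2) / z ^ 2 * m ^ 2 = (2 * m * z - m ^ 2) * m ^ 2 / z ^ 2 := by ring
  refine ⟨by positivity, ?_, ?_⟩
  · rw [e1]
    gcongr
    nlinarith
  · rw [e2, div_pow]
    gcongr
    have : 0 ≤ m ^ 3 * (z - m) := mul_nonneg (by positivity) (by linarith)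
    nlinarith

theorem om_nonneg (τ : ℝ) (x : E3) : 0 ≤ om τ x :=
  indicator_nonneg (fun _ _ => sq_nonneg _) x

/-- The compact core of the cylinder. -/
def core : Set E3 := {x | 1 / 10 < fa x ∧ 1 / 10 < fb x}

theorem core_subset : core ⊆ cylinder := fun x hx =>
  (mem_cylinder_iff x).2 ⟨lt_trans (by norm_num) hx.1, lt_trans (by norm_num) hx.2⟩

theorem isOpen_core : IsOpen core := by
  have h1 : IsOpen {x : E3 | 1 / 10 < fa x} :=
    isOpen_lt continuous_const (contDiff_fa (n := 0)).continuous
  have h2 : IsOpen {x : E3 | 1 / 10 < fb x} :=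
    isOpen_lt continuous_const (contDiff_fb (n := 0)).continuous
  exact h1.inter h2

theorem convex_core : Convex ℝ core := by
  rintro x ⟨h1, h2⟩ y ⟨k1, k2⟩ a b ha hb hab
  simp only [fa, fb] at h1 h2 k1 k2
  have e0 := sq_combo_le (x := x 0) (y := y 0) ha hb hab
  have e1 := sq_combo_le (x := x 1) (y := y 1) ha hb hab
  have e2 := sq_combo_le (x := x 2 - 1 / 2) (y := y 2 - 1 / 2) ha hb hab
  have e3 : a * (x 2 - 1 / 2) + b * (y 2 - 1 / 2) = a * x 2 + b * y 2 - 1 / 2 := by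
    linear_combination (-1 / 2) * hab
  rw [e3] at e2
  constructor
  · simp only [fa, PiLp.add_apply, PiLp.smul_apply, smul_eq_mul]
    have := combo_lt (x := x 0 ^ 2 + x 1 ^ 2) (y := y 0 ^ 2 + y 1 ^ 2) (c := 9 / 10) ha hb hab
      (by linarith) (by linarith)
    linarith
  · simp only [fb, PiLp.add_apply, PiLp.smul_apply, smul_eq_mul]
    have := combo_lt (x := (x 2 - 1 / 2) ^ 2) (y := (y 2 - 1 / 2) ^ 2) (c := 9 / 40) ha hb hab
      (by linarith) (by linarith)
    linarith

theorem volume_core_ne_zero : volume core ≠ 0 :=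
  (isOpen_core.measure_pos volume ⟨!₂[0, 0, 1 / 2], by
    constructor
    · simp [fa]; norm_num
    · change 1 / 10 < 1 - 4 * ((1 / 2 : ℝ) - 1 / 2) ^ 2
      norm_num⟩).ne'

theorem volume_core_ne_top : volume core ≠ ⊤ :=
  (isBounded_cylinder.subset core_subset).measure_lt_top.ne

theorem zeta_ge_of_mem_core {x : E3} (hx : x ∈ core) : 1 / 20 ≤ zeta x := by
  obtain ⟨h1, h2⟩ := hx
  rw [zeta, le_div_iff₀ (by linarith)]
  nlinarith

theorem om_ge_of_mem_core {τ : ℝ} (hτ : τ ≤ 1 / 40) {x : E3} (hx : x ∈ core) :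
    1 / 1600 ≤ om τ x := by
  rw [om, indicator_of_mem (core_subset hx), posSq]
  have h := zeta_ge_of_mem_core hx
  have : 1 / 40 ≤ max (zeta x - τ) 0 := le_max_of_le_left (by linarith)
  nlinarith

theorem pd_cent (k : Fin 3) (x : E3) : pd k (cent k) x = 1 := by
  have h (j : Fin 3) (c : ℝ) : pd j (fun y : E3 => y j - c) x = 1 := by
    rw [pd, ((hasFDerivAt_coord j x).sub_const c).fderiv]
    simp
  fin_cases k
  · have := h 0 0
    simp only [sub_zero] at this
    exact this
  · have := h 1 0
    simp only [sub_zero] at this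
    exact this
  · exact h 2 (1 / 2)

theorem contDiff_cent (k : Fin 3) {n : WithTop ℕ∞} : ContDiff ℝ n (cent k) := by
  fin_cases k
  · change ContDiff ℝ n fun x : E3 => x 0
    fun_prop
  · change ContDiff ℝ n fun x : E3 => x 1
    fun_prop
  · change ContDiff ℝ n fun x : E3 => x 2 - 1 / 2
    fun_prop

theorem sum_cent_sq_le {x : E3} (hx : x ∈ cylinder) : ∑ k, cent k x ^ 2 ≤ 2 := by
  obtain ⟨h1, h2, h3⟩ := hx
  simp only [cent, Fin.sum_univ_three, Matrix.cons_val_zero, Matrix.cons_val_one, Matrix.cons_val]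
  nlinarith

theorem two_mul_abs_le_of_sq_le {p r u : ℝ} (hp : 0 ≤ p) (hr : 0 ≤ r) (h : u ^ 2 ≤ p * r) :
    2 * u ≤ p + r := by
  refine le_of_abs_le (abs_le_of_sq_le_sq ?_ (by positivity))
  nlinarith [sq_nonneg (p - r)]

/-- The right side is minus the divergence of `f² · ch · cent`, written so that it integrates to
zero. Since `ch ≤ ζ qq`, the zero-order part is at least `qq (1 - 5ζ) f²`, which is positive near
the boundary; the cross term is absorbed by weighted Young. -/
theorem hardy_pointwise {τ : ℝ} (hτ : 0 < τ) {f : E3 → ℝ} (hf : ContDiff ℝ 1 f) (x : E3) :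
    1 / 4 * (qq τ x * f x ^ 2) - 2 * core.indicator (fun x => f x ^ 2) x
        - 8 * (om τ x * grad2 f x) ≤
      ∑ k, -(f x ^ 2 * pd k (fun y => cent k y * ch τ y) x +
        pd k (fun y => f y ^ 2) x * (cent k x * ch τ x)) := by
  by_cases hx : x ∈ cylinder
  · have hd : DifferentiableAt ℝ f x := hf.differentiable one_ne_zero x
    have hz := zeta_pos hx
    have hz2 := zeta_le_half hx
    obtain ⟨hq0, hq1⟩ := qq_mem_Icc hτ x
    obtain ⟨hc0, hc1, hc2⟩ := ch_bounds hτ hx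
    have ho := om_nonneg τ x
    have hsum := sum_cent_mul_pd_zeta_le hx
    have hpc (k) : pd k (fun y => cent k y * ch τ y) x =
        ch τ x + cent k x * (qq τ x * pd k zeta x) := by
      rw [pd_mul ((contDiff_cent k (n := 1)).differentiable one_ne_zero x)
        ((contDiff_ch hτ).differentiable one_ne_zero x), pd_cent, pd_ch hx, one_mul]
    have hpf (k) : pd k (fun y => f y ^ 2) x = 2 * f x * pd k f x := by
      simp only [pow_two]
      rw [pd_mul hd hd]; ring
    set t := ∑ k, cent k x * pd k f x with ht
    have ht2 : t ^ 2 ≤ 2 * grad2 f x := by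
      have h := Finset.sum_mul_sq_le_sq_mul_sq Finset.univ (fun k => cent k x) fun k => pd k f x
      refine h.trans ?_
      have := sum_cent_sq_le hx
      have g := grad2_nonneg f x
      rw [grad2] at g ⊢
      gcongr
    have e : ∑ k, -(f x ^ 2 * pd k (fun y => cent k y * ch τ y) x +
        pd k (fun y => f y ^ 2) x * (cent k x * ch τ x)) =
        -(f x ^ 2 * (3 * ch τ x + qq τ x * ∑ k, cent k x * pd k zeta x))
          - 2 * (f x * ch τ x * t) := by
      simp only [hpc, hpf, ht, Fin.sum_univ_three]; ring
    rw [e]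
    have am : 2 * (f x * ch τ x * t) ≤ 1 / 4 * (qq τ x * f x ^ 2) + 4 * om τ x * t ^ 2 := by
      refine two_mul_abs_le_of_sq_le (by positivity) (by positivity) ?_
      calc (f x * ch τ x * t) ^ 2 = ch τ x ^ 2 * (f x ^ 2 * t ^ 2) := by ring
        _ ≤ (qq τ x * om τ x) * (f x ^ 2 * t ^ 2) := by gcongr
        _ = _ := by ring
    have b1 : om τ x * t ^ 2 ≤ om τ x * (2 * grad2 f x) := by gcongr
    have b2 : qq τ x * ∑ k, cent k x * pd k zeta x ≤ qq τ x * -(1 - 2 * zeta x) := by gcongr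
    have b3 : f x ^ 2 * (3 * ch τ x + qq τ x * ∑ k, cent k x * pd k zeta x) ≤
        f x ^ 2 * (-(qq τ x * (1 - 5 * zeta x))) := by
      gcongr
      linarith
    -- Off the core `ζ ≤ 1/10`, so `1 - 5ζ ≥ 1/2`; this fixes the threshold `1/10` of the core. On
    -- the core `ζ ≤ 1/2` and `qq ≤ 1`, so the deficit is at most `(5/2 - 1/2) f²`.
    have b4 : 1 / 2 * (qq τ x * f x ^ 2) - 2 * core.indicator (fun x => f x ^ 2) x ≤
        f x ^ 2 * (qq τ x * (1 - 5 * zeta x)) := by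
      have hq : 0 ≤ qq τ x * f x ^ 2 := by positivity
      by_cases hk : x ∈ core
      · rw [indicator_of_mem hk]
        have : qq τ x * f x ^ 2 ≤ 1 * f x ^ 2 := by gcongr
        have : qq τ x * f x ^ 2 * zeta x ≤ qq τ x * f x ^ 2 * (1 / 2) := by gcongr
        linarith
      · rw [indicator_of_notMem hk]
        have hz3 : zeta x ≤ 1 / 10 := by
          by_contra hcon
          push Not at hcon
          exact hk ⟨hcon.trans (zeta_lt_fa hx), hcon.trans (zeta_lt_fb hx)⟩
        have : qq τ x * f x ^ 2 * zeta x ≤ qq τ x * f x ^ 2 * (1 / 10) := by gcongr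
        linarith
    linarith
  · have hs : x ∉ tsupport (ch τ) := fun h => hx (slab_subset hτ (tsupport_ch τ h))
    have hk : x ∉ core := fun h => hx (core_subset h)
    have h0 : ch τ x = 0 := image_eq_zero_of_notMem_tsupport hs
    have h1 (k) : pd k (fun y => cent k y * ch τ y) x = 0 := by
      rw [pd_mul ((contDiff_cent k (n := 1)).differentiable one_ne_zero x)
        ((contDiff_ch hτ).differentiable one_ne_zero x), h0,
        pd_eq_zero_of_notMem_tsupport hs]
      simp
    simp [qq, om, hx, hk, h0, h1]

theorem measurable_qq (τ : ℝ) : Measurable (qq τ) := by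
  have ha : Measurable fa := (contDiff_fa (n := 0)).continuous.measurable
  have hb : Measurable fb := (contDiff_fb (n := 0)).continuous.measurable
  have hz : Measurable zeta := (ha.mul hb).div (ha.add hb)
  have hm : Measurable fun x => max (zeta x - τ) 0 := (hz.sub_const τ).max measurable_const
  exact (((((measurable_const.mul hm).mul hz).sub (hm.pow_const 2)).div
    (hz.pow_const 2))).indicator measurableSet_cylinder

theorem integrableOn_cylinder {f : E3 → ℝ} (hf : Continuous f) : IntegrableOn f cylinder :=
  (hf.continuousOn.integrableOn_compact (isCompact_closedBall (0 : E3) 2)).mono_set fun x hx => by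
    simpa using (norm_lt_two_of_mem_cylinder hx).le

theorem integrable_qq_mul {τ : ℝ} (hτ : 0 < τ) {f : E3 → ℝ} (hf : IntegrableOn f cylinder) :
    Integrable fun x => qq τ x * f x := by
  have : (fun x => qq τ x * f x) = cylinder.indicator fun x => qq τ x * f x := by
    ext x
    by_cases hx : x ∈ cylinder <;> simp [hx, qq]
  rw [this, integrable_indicator_iff measurableSet_cylinder]
  refine Integrable.bdd_mul (c := 1) hf (measurable_qq τ).aestronglyMeasurable
    (ae_of_all _ fun x => ?_)
  rw [Real.norm_eq_abs, abs_of_nonneg (qq_mem_Icc hτ x).1]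
  exact (qq_mem_Icc hτ x).2

theorem integrable_om_mul {τ : ℝ} (hτ : 0 < τ) {f : E3 → ℝ} (hf : Continuous f) :
    Integrable fun x => om τ x * f x :=
  ((contDiff_om hτ).continuous.mul hf).integrable_of_hasCompactSupport
    (hasCompactSupport_om hτ).mul_right

theorem hardy {τ : ℝ} (hτ : 0 < τ) {f : E3 → ℝ} (hf : ContDiff ℝ 1 f) :
    ∫ x, qq τ x * f x ^ 2 ≤ 8 * (∫ x in core, f x ^ 2) + 32 * ∫ x, om τ x * grad2 f x := by
  have hf2 : ContDiff ℝ 1 fun x => f x ^ 2 := hf.pow 2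
  have hg (k) : ContDiff ℝ 1 fun y => cent k y * ch τ y := (contDiff_cent k).mul (contDiff_ch hτ)
  have hgc (k) : HasCompactSupport fun y => cent k y * ch τ y :=
    (hasCompactSupport_ch hτ).mul_left
  have i1 (k) : Integrable fun x => f x ^ 2 * pd k (fun y => cent k y * ch τ y) x :=
    (hf2.continuous.mul (continuous_pd (hg k) k)).integrable_of_hasCompactSupport
      (hasCompactSupport_pd (hgc k) k).mul_left
  have i2 (k) : Integrable fun x => pd k (fun y => f y ^ 2) x * (cent k x * ch τ x) :=
    ((continuous_pd hf2 k).mul (hg k).continuous).integrable_of_hasCompactSupport (hgc k).mul_left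
  have i3 (k) : Integrable fun x => -(f x ^ 2 * pd k (fun y => cent k y * ch τ y) x +
        pd k (fun y => f y ^ 2) x * (cent k x * ch τ x)) := ((i1 k).add (i2 k)).neg
  have h0 : ∫ x, ∑ k, -(f x ^ 2 * pd k (fun y => cent k y * ch τ y) x +
        pd k (fun y => f y ^ 2) x * (cent k x * ch τ x)) = 0 := by
    rw [integral_finsetSum _ fun k _ => i3 k]
    refine Finset.sum_eq_zero fun k _ => ?_
    rw [integral_neg, integral_add (i1 k) (i2 k), pd_integral_by_parts hf2 (hg k) (hgc k)]
    simp
  have j1 : Integrable fun x => qq τ x * f x ^ 2 :=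
    integrable_qq_mul hτ (integrableOn_cylinder hf2.continuous)
  have j2 : Integrable (core.indicator fun x => f x ^ 2) :=
    (integrable_indicator_iff isOpen_core.measurableSet).2
      ((integrableOn_cylinder hf2.continuous).mono_set core_subset)
  have j3 : Integrable fun x => om τ x * grad2 f x := integrable_om_mul hτ (continuous_grad2 hf)
  have hle := integral_mono (((j1.const_mul (1 / 4)).sub (j2.const_mul 2)).sub (j3.const_mul 8))
    (integrable_finsetSum Finset.univ fun k _ => i3 k)
    (hardy_pointwise hτ hf)
  rw [h0] at hle
  rw [integral_sub' ((j1.const_mul (1 / 4)).sub (j2.const_mul 2)) (j3.const_mul 8),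
    integral_sub' (j1.const_mul (1 / 4)) (j2.const_mul 2), integral_const_mul, integral_const_mul,
    integral_const_mul, integral_indicator isOpen_core.measurableSet] at hle
  linarith

theorem poincare_core {h : E3 → ℝ} (hh : ContDiff ℝ 1 h) :
    ∫ x in core, (h x - ⨍ y in core, h y) ^ 2 ≤ 128 * ∫ x in core, grad2 h x := by
  have hi : IntegrableOn h core := (integrableOn_cylinder hh.continuous).mono_set core_subset
  -- The cylinder lies in the ball of radius `2`, so distances are at most `4`, and `128 = 8 · 4²`.
  have hP := poincare_convex isOpen_core.measurableSet convex_core volume_core_ne_zero (D := 4)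
    volume_core_ne_top (fun x hx y hy => by
      have h1 := norm_lt_two_of_mem_cylinder (core_subset hx)
      have h2 := norm_lt_two_of_mem_cylinder (core_subset hy)
      linarith [norm_sub_le y x]) hh hi
  simp only [enorm_sq_eq_ofReal] at hP
  have i1 : IntegrableOn (fun x => (h x - ⨍ y in core, h y) ^ 2) core :=
    (integrableOn_cylinder ((hh.continuous.sub continuous_const).pow 2)).mono_set core_subset
  have i2 : IntegrableOn (grad2 h) core :=
    (integrableOn_cylinder (continuous_grad2 hh)).mono_set core_subset
  rw [← ofReal_integral_eq_lintegral_ofReal i1 (ae_of_all _ fun x => sq_nonneg _),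
    ← ofReal_integral_eq_lintegral_ofReal i2 (ae_of_all _ fun x => grad2_nonneg h x),
    ← ENNReal.ofReal_mul (by norm_num), ENNReal.ofReal_le_ofReal_iff
      (mul_nonneg (by norm_num) (integral_nonneg fun x => grad2_nonneg h x))] at hP
  norm_num at hP ⊢
  exact hP

/-- The constant in the weighted Poincaré inequality. -/
def wpConst : ℝ := 8 * 128 * 1600 + 32

/-- The Poincaré inequality with a weight that degenerates at the boundary. -/
theorem weighted_poincare {τ : ℝ} (hτ : 0 < τ) (hτ' : τ ≤ 1 / 40) {h : E3 → ℝ}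
    (hh : ContDiff ℝ 1 h) :
    ∫ x, qq τ x * (h x - ⨍ y in core, h y) ^ 2 ≤ wpConst * ∫ x, om τ x * grad2 h x := by
  set c := ⨍ y in core, h y with hc
  have hg : grad2 (fun x => h x - c) = grad2 h := by
    ext x
    simp [grad2, pd, fderiv_sub_const]
  have h1 := hardy hτ (hh.sub (contDiff_const (c := c)))
  rw [hg] at h1
  have h2 := poincare_core hh
  rw [← hc] at h2
  have i3 : Integrable fun x => om τ x * grad2 h x := integrable_om_mul hτ (continuous_grad2 hh)
  -- For `τ ≤ 1/40` the degenerate weight is at least `1/1600` on the core. Thus `wpConst` combines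
  -- `8` and `32` from `hardy`, `128` from `poincare_core` and this `1600`.
  have h3 : ∫ x in core, grad2 h x ≤ 1600 * ∫ x, om τ x * grad2 h x := by
    rw [← integral_const_mul, ← integral_indicator isOpen_core.measurableSet]
    refine integral_mono ((integrable_indicator_iff isOpen_core.measurableSet).2
      ((integrableOn_cylinder (continuous_grad2 hh)).mono_set core_subset)) (i3.const_mul _)
      fun x => ?_
    have hn := grad2_nonneg h x
    by_cases hx : x ∈ core
    · rw [indicator_of_mem hx]
      have := om_ge_of_mem_core hτ' hx
      change grad2 h x ≤ 1600 * (om τ x * grad2 h x)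
      nlinarith
    · rw [indicator_of_notMem hx]
      have := om_nonneg τ x
      positivity
  rw [wpConst]
  linarith

/-- The Caccioppoli inequality. -/
theorem caccioppoli {τ : ℝ} (hτ : 0 < τ) {h : E3 → ℝ} (hh : ContDiff ℝ 2 h)
    (hharm : ∀ x ∈ slab τ, ∑ k, pd k (pd k h) x = 0) :
    ∫ x, om τ x * grad2 h x ≤ 64 * ∫ x in cylinder, h x ^ 2 := by
  have hh1 : ContDiff ℝ 1 h := hh.of_le (by norm_num)
  have hp (k) : ContDiff ℝ 1 (pd k h) :=
    (hh.fderiv_right (m := 1) (by norm_num)).clm_apply contDiff_const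
  have ho := contDiff_om hτ
  have hoc := hasCompactSupport_om hτ
  have hg (k) : ContDiff ℝ 1 fun y => om τ y * pd k h y := ho.mul (hp k)
  have hgc (k) : HasCompactSupport fun y => om τ y * pd k h y := hoc.mul_right
  have i1 (k) : Integrable fun x => h x * pd k (fun y => om τ y * pd k h y) x :=
    (hh.continuous.mul (continuous_pd (hg k) k)).integrable_of_hasCompactSupport
      (hasCompactSupport_pd (hgc k) k).mul_left
  have i2 (k) : Integrable fun x => pd k h x * (om τ x * pd k h x) :=
    ((hp k).continuous.mul (hg k).continuous).integrable_of_hasCompactSupport (hgc k).mul_left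
  have i3 (k) : Integrable fun x => h x * pd k (fun y => om τ y * pd k h y) x +
      pd k h x * (om τ x * pd k h x) := (i1 k).add (i2 k)
  -- The integrand is the divergence of `h · om · ∇h`. Harmonicity, needed only on the support of
  -- `om`, leaves `om |∇h|²` and a cross term containing `∇om`.
  have h0 : ∫ x, ∑ k, (h x * pd k (fun y => om τ y * pd k h y) x +
      pd k h x * (om τ x * pd k h x)) = 0 := by
    rw [integral_finsetSum _ fun k _ => i3 k]
    refine Finset.sum_eq_zero fun k _ => ?_
    rw [integral_add (i1 k) (i2 k), pd_integral_by_parts hh1 (hg k) (hgc k)]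
    simp
  have j1 : Integrable fun x => om τ x * grad2 h x := integrable_om_mul hτ (continuous_grad2 hh1)
  have j2 : Integrable (cylinder.indicator fun x => h x ^ 2) :=
    (integrable_indicator_iff measurableSet_cylinder).2
      (integrableOn_cylinder (hh1.continuous.pow 2))
  have hpt (x : E3) : 1 / 2 * (om τ x * grad2 h x) - 32 * cylinder.indicator (fun x => h x ^ 2) x ≤
      ∑ k, (h x * pd k (fun y => om τ y * pd k h y) x + pd k h x * (om τ x * pd k h x)) := by
    have hpc (k) : pd k (fun y => om τ y * pd k h y) x =
        pd k (om τ) x * pd k h x + om τ x * pd k (pd k h) x :=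
      pd_mul (ho.differentiable one_ne_zero x) ((hp k).differentiable one_ne_zero x) k
    have hlap : om τ x * ∑ k, pd k (pd k h) x = 0 := by
      by_cases hx : x ∈ slab τ
      · rw [hharm x hx, mul_zero]
      · rw [image_eq_zero_of_notMem_tsupport fun hs => hx (tsupport_om τ hs), zero_mul]
    have e : ∑ k, (h x * pd k (fun y => om τ y * pd k h y) x + pd k h x * (om τ x * pd k h x)) =
        h x * (∑ k, pd k (om τ) x * pd k h x) + om τ x * grad2 h x := by
      simp only [hpc, grad2, Fin.sum_univ_three] at hlap ⊢
      linear_combination h x * hlap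
    rw [e]
    by_cases hx : x ∈ cylinder
    · rw [indicator_of_mem hx]
      set t := ∑ k, pd k zeta x * pd k h x with ht
      have ht2 : t ^ 2 ≤ 16 * grad2 h x := by
        have hcs := Finset.sum_mul_sq_le_sq_mul_sq Finset.univ (fun k => pd k zeta x)
          fun k => pd k h x
        refine hcs.trans ?_
        have := grad2_zeta_le hx
        have g := grad2_nonneg h x
        rw [grad2] at this g ⊢
        gcongr
      have e2 : ∑ k, pd k (om τ) x * pd k h x = 2 * max (zeta x - τ) 0 * t := by
        rw [ht, Finset.mul_sum]
        refine Finset.sum_congr rfl fun k _ => ?_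
        rw [pd_om hx]; ring
      have e3 : om τ x = max (zeta x - τ) 0 ^ 2 := by rw [om, indicator_of_mem hx, posSq]
      rw [e2, e3]
      set m := max (zeta x - τ) 0
      -- Since `om = m²` and `∇om = 2m∇ζ` with `|∇ζ|² ≤ 16`, half of the weighted energy absorbs the
      -- cross term at the price of `32 h²`.
      have am : 2 * (-(h x) * (2 * m * t)) ≤ m ^ 2 * grad2 h x + 64 * h x ^ 2 := by
        refine two_mul_abs_le_of_sq_le (mul_nonneg (sq_nonneg m) (grad2_nonneg h x))
          (by positivity) ?_
        calc (-(h x) * (2 * m * t)) ^ 2 = 4 * m ^ 2 * h x ^ 2 * t ^ 2 := by ring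
          _ ≤ 4 * m ^ 2 * h x ^ 2 * (16 * grad2 h x) := by gcongr
          _ = _ := by ring
      linarith
    · have hs : x ∉ tsupport (om τ) := fun h => hx (slab_subset hτ (tsupport_om τ h))
      simp [hx, pd_eq_zero_of_notMem_tsupport hs, image_eq_zero_of_notMem_tsupport hs]
  have hle := integral_mono ((j1.const_mul (1 / 2)).sub (j2.const_mul 32))
    (integrable_finsetSum Finset.univ fun k _ => i3 k) hpt
  rw [h0, integral_sub' (j1.const_mul (1 / 2)) (j2.const_mul 32), integral_const_mul,
    integral_const_mul, integral_indicator measurableSet_cylinder] at hle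
  linarith

/-! ### Passing to the limit in the weighted Poincaré inequality -/

theorem average_core_eq (f : E3 → ℝ) :
    ⨍ y in core, f y = (volume.real core)⁻¹ * ∫ x, f x * core.indicator (fun _ => 1) x := by
  have h2 : (fun x => f x * core.indicator (fun _ => (1 : ℝ)) x) = core.indicator f := by
    ext x
    by_cases hx : x ∈ core <;> simp [hx]
  rw [setAverage_eq, smul_eq_mul, h2, integral_indicator isOpen_core.measurableSet]

theorem memLp_indicator_core : MemLp (core.indicator fun _ => (1 : ℝ)) 2 volume :=
  memLp_indicator_const _ isOpen_core.measurableSet _ (Or.inr volume_core_ne_top)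

theorem tendsto_average_mollify {f : E3 → ℝ} (hf : MemLp f 2 volume) :
    Tendsto (fun n => ⨍ y in core, mollify n f y) atTop (𝓝 (⨍ y in core, f y)) := by
  simp only [average_core_eq]
  exact (tendsto_integral_mollify_mul hf memLp_indicator_core).const_mul _

theorem memLp_qq {τ : ℝ} (hτ : 0 < τ) : MemLp (qq τ) 2 volume := by
  have h1 : MemLp (cylinder.indicator fun _ => (1 : ℝ)) 2 volume :=
    memLp_indicator_const _ measurableSet_cylinder _
      (Or.inr isBounded_cylinder.measure_lt_top.ne)
  refine h1.mono (measurable_qq τ).aestronglyMeasurable (ae_of_all _ fun x => ?_)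
  by_cases hx : x ∈ cylinder
  · simpa [hx, abs_of_nonneg (qq_mem_Icc hτ x).1] using (qq_mem_Icc hτ x).2
  · simp [qq, hx]

theorem norm_qq_mul_le {τ : ℝ} (hτ : 0 < τ) (x : E3) (r : ℝ) : ‖qq τ x * r‖ ≤ ‖r‖ := by
  rw [norm_mul, Real.norm_eq_abs, abs_of_nonneg (qq_mem_Icc hτ x).1]
  exact mul_le_of_le_one_left (norm_nonneg _) (qq_mem_Icc hτ x).2

theorem memLp_qq_mul {τ : ℝ} (hτ : 0 < τ) {f : E3 → ℝ} (hf : MemLp f 2 volume) :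
    MemLp (fun x => qq τ x * f x) 2 volume :=
  hf.mono ((measurable_qq τ).aestronglyMeasurable.mul hf.1)
    (ae_of_all _ fun x => norm_qq_mul_le hτ x _)

/-- Expanding the square turns the weighted deviation into `L²` pairings, which pass to the limit
under mollification. -/
theorem integral_qq_mul_sq_sub {τ : ℝ} (hτ : 0 < τ) {f : E3 → ℝ} (hf : MemLp f 2 volume) (c : ℝ) :
    ∫ x, qq τ x * (f x - c) ^ 2 =
      (∫ x, (qq τ x * f x) * f x) - 2 * c * (∫ x, f x * qq τ x) + c ^ 2 * ∫ x, qq τ x := by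
  have i1 : Integrable fun x => (qq τ x * f x) * f x := (memLp_qq_mul hτ hf).integrable_mul hf
  have i2 : Integrable fun x => f x * qq τ x := hf.integrable_mul (memLp_qq hτ)
  have i3 : Integrable (qq τ) := by
    simpa using integrable_qq_mul hτ (integrableOn_cylinder (continuous_const (y := (1 : ℝ))))
  have i4 : Integrable fun x => (qq τ x * f x) * f x - 2 * c * (f x * qq τ x) :=
    i1.sub (i2.const_mul _)
  rw [← integral_const_mul, ← integral_const_mul, ← integral_sub i1 (i2.const_mul _),
    ← integral_add i4 (i3.const_mul _)]
  congr 1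
  ext x
  ring

theorem tendsto_integral_qq_mollify {τ : ℝ} (hτ : 0 < τ) {f : E3 → ℝ} (hf : MemLp f 2 volume) :
    Tendsto (fun n => ∫ x, qq τ x * (mollify n f x - ⨍ y in core, mollify n f y) ^ 2) atTop
      (𝓝 (∫ x, qq τ x * (f x - ⨍ y in core, f y) ^ 2)) := by
  simp only [integral_qq_mul_sq_sub hτ hf, integral_qq_mul_sq_sub hτ (memLp_mollify _ hf)]
  have hc := tendsto_average_mollify hf
  refine ((tendsto_integral_mul (fun n => memLp_qq_mul hτ (memLp_mollify n hf))
    (fun n => memLp_mollify n hf) (memLp_qq_mul hτ hf) hf ?_ (tendsto_mollify hf)).sub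
    ((hc.const_mul 2).mul (tendsto_integral_mollify_mul hf (memLp_qq hτ)))).add
    ((hc.pow 2).mul_const _)
  refine tendsto_of_tendsto_of_tendsto_of_le_of_le tendsto_const_nhds (tendsto_mollify hf)
    (fun _ => zero_le) fun n => ?_
  refine eLpNorm_mono fun x => ?_
  rw [← mul_sub]
  exact norm_qq_mul_le hτ x _

theorem tendsto_qq {x : E3} (hx : x ∈ cylinder) :
    Tendsto (fun m : ℕ => qq (1 / 40 / ((m : ℝ) + 1)) x) atTop (𝓝 1) := by
  have hz := zeta_pos hx
  have h0 : Tendsto (fun m : ℕ => (1 / 40 : ℝ) / ((m : ℝ) + 1)) atTop (𝓝 0) := by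
    have := tendsto_one_div_add_atTop_nhds_zero_nat.const_mul (1 / 40 : ℝ)
    simpa [div_eq_mul_inv] using this
  have hm : Tendsto (fun m : ℕ => max (zeta x - (1 / 40 : ℝ) / ((m : ℝ) + 1)) 0) atTop
      (𝓝 (zeta x)) := by
    have := (h0.const_sub (zeta x)).max (tendsto_const_nhds (x := (0 : ℝ)))
    simpa [max_eq_left hz.le] using this
  have := (((hm.const_mul 2).mul_const (zeta x)).sub (hm.pow 2)).div_const (zeta x ^ 2)
  have e : (2 * zeta x * zeta x - zeta x ^ 2) / zeta x ^ 2 = 1 := by field_simp; ring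
  rw [e] at this
  simpa [qq, hx] using this

/-- Two limits in order: first `n → ∞` at fixed `τ`, where the truncated weight sees only interior
points, then `τ → 0`, where `qq` increases the control to the whole cylinder by dominated
convergence. The bound `M` must not depend on `τ`. -/
theorem integral_sq_sub_average_le {f : E3 → ℝ} (hf : MemLp f 2 volume) {M : ℝ}
    (hM : ∀ τ : ℝ, 0 < τ → τ ≤ 1 / 40 →
      ∀ᶠ n in atTop, ∫ x, om τ x * grad2 (mollify n f) x ≤ M) :
    ∫ x in cylinder, (f x - ⨍ y in core, f y) ^ 2 ≤ wpConst * M := by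
  have hw : 0 ≤ wpConst := by norm_num [wpConst]
  have hl : LocallyIntegrable f := hf.locallyIntegrable (by norm_num)
  set c := ⨍ y in core, f y
  have h1 (τ : ℝ) (hτ : 0 < τ) (hτ' : τ ≤ 1 / 40) :
      ∫ x in cylinder, qq τ x * (f x - c) ^ 2 ≤ wpConst * M := by
    have hqe : ∫ x in cylinder, qq τ x * (f x - c) ^ 2 = ∫ x, qq τ x * (f x - c) ^ 2 :=
      setIntegral_eq_integral_of_forall_compl_eq_zero fun x hx => by simp [qq, hx]
    rw [hqe]
    refine le_of_tendsto (tendsto_integral_qq_mollify hτ hf) ?_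
    filter_upwards [hM τ hτ hτ'] with n hn
    exact (weighted_poincare hτ hτ' (contDiff_mollify n hl (m := 1))).trans (by gcongr)
  have hi : IntegrableOn (fun x => (f x - c) ^ 2) cylinder :=
    ((hf.restrict cylinder).sub (memLp_const c)).integrable_sq
  have hpos (m : ℕ) : 0 < (1 / 40 : ℝ) / ((m : ℝ) + 1) := by positivity
  refine le_of_tendsto (tendsto_integral_of_dominated_convergence
    (F := fun (m : ℕ) x => qq (1 / 40 / ((m : ℝ) + 1)) x * (f x - c) ^ 2)
    (bound := fun x => (f x - c) ^ 2) (f := fun x => (f x - c) ^ 2) ?_ hi ?_ ?_)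
    (Eventually.of_forall fun m => h1 _ (hpos m) ?_)
  · exact fun m => (measurable_qq _).aestronglyMeasurable.mul hi.1
  · refine fun m => ae_of_all _ fun x => ?_
    refine (norm_qq_mul_le (hpos m) x _).trans_eq ?_
    rw [Real.norm_eq_abs, abs_of_nonneg (sq_nonneg _)]
  · filter_upwards [ae_restrict_mem measurableSet_cylinder] with x hx
    simpa using (tendsto_qq hx).mul_const ((f x - c) ^ 2)
  · exact div_le_self (by norm_num) (by linarith [(Nat.cast_nonneg m : (0 : ℝ) ≤ m)])

theorem om_le_one {τ : ℝ} (hτ : 0 < τ) (x : E3) : om τ x ≤ 1 := by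
  by_cases hx : x ∈ cylinder
  · rw [om, indicator_of_mem hx, posSq]
    obtain ⟨h1, h2⟩ := max_zeta_mem hτ hx
    have := zeta_le_half hx
    nlinarith
  · simp [om, hx]

theorem integral_sq_eq_toReal {f : E3 → ℝ} (hf : MemLp f 2 volume) :
    ∫ x, f x ^ 2 = (eLpNorm f 2 volume ^ 2).toReal := by
  rw [eLpNorm_two_sq, integral_eq_lintegral_of_nonneg_ae (ae_of_all _ fun x => sq_nonneg _)
    hf.integrable_sq.1]
  simp only [enorm_sq_eq_ofReal]

theorem integral_mollify_sq_le (n : ℕ) {f : E3 → ℝ} (hf : MemLp f 2 volume) :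
    ∫ x, mollify n f x ^ 2 ≤ ∫ x, f x ^ 2 := by
  rw [integral_sq_eq_toReal hf, integral_sq_eq_toReal (memLp_mollify n hf)]
  refine ENNReal.toReal_mono (ENNReal.pow_ne_top hf.2.ne) ?_
  gcongr
  exact eLpNorm_mollify_le n hf.1

/-- `G k = ∂ₖ u` in the sense of distributions on the cylinder. -/
def IsWeakPd (u : E3 → ℝ) (G : Fin 3 → E3 → ℝ) : Prop :=
  ∀ θ, IsTest θ → ∀ k, ∫ x, u x * pd k θ x = - ∫ x, G k x * θ x

/-- The Poincaré inequality on the cylinder. -/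
theorem IsWeakPd.poincare {u : E3 → ℝ} {G : Fin 3 → E3 → ℝ} (h : IsWeakPd u G)
    (hu : MemLp u 2 volume) (hG : ∀ k, MemLp (G k) 2 volume) :
    ∫ x in cylinder, (u x - ⨍ y in core, u y) ^ 2 ≤ wpConst * ∑ k, ∫ x, G k x ^ 2 := by
  refine integral_sq_sub_average_le hu fun τ hτ _ => ?_
  filter_upwards [eventually_closedBall_subset (isCompact_slab hτ) (slab_subset hτ)] with n hn
  have hul : LocallyIntegrable u := hu.locallyIntegrable (by norm_num)
  have hpd (x) (hx : x ∈ slab τ) (k) : pd k (mollify n u) x = mollify n (G k) x := by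
    obtain ⟨θ, hθ, h1, h2⟩ := exists_test_mollify n (hn x hx)
    rw [h1, h2 u hul, h θ hθ, neg_neg]
  have i1 : Integrable fun x => om τ x * grad2 (mollify n u) x :=
    integrable_om_mul hτ (continuous_grad2 (contDiff_mollify n hul (m := 1)))
  have i2 (k) : Integrable fun x => mollify n (G k) x ^ 2 := (memLp_mollify n (hG k)).integrable_sq
  calc ∫ x, om τ x * grad2 (mollify n u) x ≤ ∫ x, ∑ k, mollify n (G k) x ^ 2 := by
        refine integral_mono i1 (integrable_finsetSum _ fun k _ => i2 k) fun x => ?_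
        have hs : 0 ≤ ∑ k, mollify n (G k) x ^ 2 := Finset.sum_nonneg fun k _ => sq_nonneg _
        by_cases hx : x ∈ slab τ
        · simp only [grad2, hpd x hx]
          exact mul_le_of_le_one_left hs (om_le_one hτ x)
        · simpa [image_eq_zero_of_notMem_tsupport fun h => hx (tsupport_om τ h)] using hs
    _ = ∑ k, ∫ x, mollify n (G k) x ^ 2 := integral_finsetSum _ fun k _ => i2 k
    _ ≤ ∑ k, ∫ x, G k x ^ 2 := Finset.sum_le_sum fun k _ => integral_mollify_sq_le n (hG k)

/-! ### Curl-free and divergence-free fields -/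

theorem contDiff_pd {f : E3 → ℝ} {n : ℕ} (hf : ContDiff ℝ (n + 1) f) (k : Fin 3) :
    ContDiff ℝ n (pd k f) :=
  (hf.fderiv_right (m := n) le_rfl).clm_apply contDiff_const

theorem pd_comm {f : E3 → ℝ} (hf : ContDiff ℝ 2 f) (j k : Fin 3) (x : E3) :
    pd k (pd j f) x = pd j (pd k f) x := by
  have hd : DifferentiableAt ℝ (fderiv ℝ f) x :=
    (hf.fderiv_right (m := 1) (by norm_num)).differentiable one_ne_zero x
  have h (i l : Fin 3) : pd l (pd i f) x = fderiv ℝ (fderiv ℝ f) x (EuclideanSpace.single l 1)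
      (EuclideanSpace.single i 1) := by
    have h1 : HasFDerivAt (pd i f) _ x :=
      hd.hasFDerivAt.clm_apply (hasFDerivAt_const (EuclideanSpace.single i (1 : ℝ)) x)
    rw [pd, h1.fderiv]
    simp
  rw [h, h]
  exact (hf.contDiffAt.isSymmSndFDerivAt (by simp)).eq _ _

theorem pd_congr {f g : E3 → ℝ} {x : E3} (h : f =ᶠ[𝓝 x] g) (k : Fin 3) : pd k f x = pd k g x := by
  rw [pd, pd, h.fderiv_eq]

def IsCurlFree (g : Fin 3 → E3 → ℝ) : Prop :=
  ∀ θ, IsTest θ → ∀ j k, ∫ x, g j x * pd k θ x = ∫ x, g k x * pd j θ x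

def IsDivFree (g : Fin 3 → E3 → ℝ) : Prop :=
  ∀ θ, IsTest θ → ∑ k, ∫ x, g k x * pd k θ x = 0

theorem slab_half_mem_nhds {τ : ℝ} (hτ : 0 < τ) {x : E3} (hx : x ∈ slab τ) :
    slab (τ / 2) ∈ 𝓝 x := by
  have h1 : IsOpen {x : E3 | τ / 2 < fa x} :=
    isOpen_lt continuous_const (contDiff_fa (n := 0)).continuous
  have h2 : IsOpen {x : E3 | τ / 2 < fb x} :=
    isOpen_lt continuous_const (contDiff_fb (n := 0)).continuous
  refine mem_of_superset ((h1.inter h2).mem_nhds ⟨?_, ?_⟩) fun y hy => ⟨hy.1.le, hy.2.le⟩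
  · exact lt_of_lt_of_le (by linarith) hx.1
  · exact lt_of_lt_of_le (by linarith) hx.2

/-- `∂ₖ∂ₖgⱼ = ∂ₖ∂ⱼgₖ = ∂ⱼ div g = 0`. The first-order identities are differentiated once more, so
they are required on a neighbourhood of the point, whence the larger set `slab (τ / 2)`. -/
theorem harmonic_mollify {g : Fin 3 → E3 → ℝ} (hg : ∀ k, LocallyIntegrable (g k))
    (hc : IsCurlFree g) (hd : IsDivFree g) {τ : ℝ} (hτ : 0 < τ) {n : ℕ}
    (hn : ∀ x ∈ slab (τ / 2), Metric.closedBall x (1 / (n + 1)) ⊆ cylinder) {x : E3}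
    (hx : x ∈ slab τ) (j : Fin 3) : ∑ k, pd k (pd k (mollify n (g j))) x = 0 := by
  have hsm (k) : ContDiff ℝ 2 (mollify n (g k)) := contDiff_mollify n (hg k) (m := 2)
  have h1 (k) : pd k (mollify n (g j)) =ᶠ[𝓝 x] pd j (mollify n (g k)) := by
    filter_upwards [slab_half_mem_nhds hτ hx] with y hy
    obtain ⟨θ, hθ, -, h2⟩ := exists_test_mollify n (hn y hy)
    rw [h2 _ (hg j), h2 _ (hg k), hc θ hθ]
  have h2 : (fun y => ∑ k, pd k (mollify n (g k)) y) =ᶠ[𝓝 x] fun _ => 0 := by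
    filter_upwards [slab_half_mem_nhds hτ hx] with y hy
    obtain ⟨θ, hθ, -, h2⟩ := exists_test_mollify n (hn y hy)
    simp only [h2 _ (hg _), Finset.sum_neg_distrib, hd θ hθ, neg_zero]
  calc ∑ k, pd k (pd k (mollify n (g j))) x = ∑ k, pd j (pd k (mollify n (g k))) x := by
        refine Finset.sum_congr rfl fun k _ => ?_
        rw [pd_congr (h1 k), pd_comm (hsm k)]
    _ = pd j (fun y => ∑ k, pd k (mollify n (g k)) y) x := by
        rw [pd, fderiv_fun_sum fun k _ => ((contDiff_pd (n := 1) (hsm k) k).differentiable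
          one_ne_zero x)]
        simp [pd]
    _ = 0 := by
        rw [pd_congr h2]; simp [pd]

theorem mollify_half_add (n : ℕ) {f g : E3 → ℝ} (hf : LocallyIntegrable f)
    (hg : LocallyIntegrable g) :
    mollify n (fun x => 1 / 2 * (f x + g x)) =
      fun x => 1 / 2 * (mollify n f x + mollify n g x) := by
  ext x
  have hc : Continuous (fun y => kernel n (x - y)) :=
    (contDiff_kernel n (m := 0)).continuous.comp (by fun_prop)
  have hs : HasCompactSupport (fun y => kernel n (x - y)) :=
    (hasCompactSupport_kernel n).comp_homeomorph (Homeomorph.subLeft x)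
  simp only [mollify_apply]
  rw [← integral_add (integrable_mul_of_compactSupport hf hc hs)
    (integrable_mul_of_compactSupport hg hc hs), ← integral_const_mul]
  congr 1
  ext y
  ring

theorem pd_half_add {f g : E3 → ℝ} {x : E3} (hf : DifferentiableAt ℝ f x)
    (hg : DifferentiableAt ℝ g x) (k : Fin 3) :
    pd k (fun y => 1 / 2 * (f y + g y)) x = 1 / 2 * (pd k f x + pd k g x) := by
  have h : HasFDerivAt (fun y => 1 / 2 * (f y + g y)) _ x :=
    (hf.hasFDerivAt.fun_add hg.hasFDerivAt).const_mul (1 / 2)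
  rw [pd, h.fderiv]
  simp only [pd, smul_apply, add_apply, smul_eq_mul]

/-- Korn's inequality for fields whose rows are curl-free and divergence-free. -/
theorem korn_harmonic {g : Fin 3 → Fin 3 → E3 → ℝ} (hg : ∀ i j, MemLp (g i j) 2 volume)
    (hc : ∀ i, IsCurlFree (g i)) (hd : ∀ i, IsDivFree (g i)) (i j : Fin 3) :
    ∫ x in cylinder, (g i j x - ⨍ y in core, g i j y) ^ 2 ≤
      wpConst * (1728 * ∑ a, ∑ b, ∫ x, (1 / 2 * (g a b x + g b a x)) ^ 2) := by
  have hgl (a b) : LocallyIntegrable (g a b) := (hg a b).locallyIntegrable (by norm_num)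
  set e : Fin 3 → Fin 3 → E3 → ℝ := fun a b x => 1 / 2 * (g a b x + g b a x) with he
  have hem (a b) : MemLp (e a b) 2 volume := ((hg a b).add (hg b a)).const_mul (1 / 2)
  have hel (a b) : LocallyIntegrable (e a b) := (hem a b).locallyIntegrable (by norm_num)
  refine integral_sq_sub_average_le (hg i j) fun τ hτ _ => ?_
  have hτ2 : 0 < τ / 2 := by linarith
  filter_upwards [eventually_closedBall_subset (isCompact_slab hτ2) (slab_subset hτ2)] with n hn
  have hsm (a b) : ContDiff ℝ 2 (mollify n (g a b)) := contDiff_mollify n (hgl a b) (m := 2)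
  have hsme (a b) : ContDiff ℝ 2 (mollify n (e a b)) := contDiff_mollify n (hel a b) (m := 2)
  have hdiff (a b k x) : DifferentiableAt ℝ (pd k (mollify n (g a b))) x :=
    (contDiff_pd (n := 1) (hsm a b) k).differentiable one_ne_zero x
  have hpe (a b k) : pd k (mollify n (e a b)) =
      fun y => 1 / 2 * (pd k (mollify n (g a b)) y + pd k (mollify n (g b a)) y) := by
    ext y
    rw [he, mollify_half_add n (hgl a b) (hgl b a)]
    exact pd_half_add ((hsm a b).differentiable two_ne_zero y)
      ((hsm b a).differentiable two_ne_zero y) k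
  have hharm (a b) : ∀ x ∈ slab τ, ∑ k, pd k (pd k (mollify n (e a b))) x = 0 := by
    intro x hx
    have h1 := harmonic_mollify (hgl a) (hc a) (hd a) hτ hn hx b
    have h2 := harmonic_mollify (hgl b) (hc b) (hd b) hτ hn hx a
    simp only [hpe, pd_half_add (hdiff a b _ x) (hdiff b a _ x)]
    rw [← Finset.mul_sum, Finset.sum_add_distrib, h1, h2]
    norm_num
  have hcac (a b) : ∫ x, om τ x * grad2 (mollify n (e a b)) x ≤ 64 * ∫ x, e a b x ^ 2 := by
    refine (caccioppoli hτ (hsme a b) (hharm a b)).trans ?_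
    gcongr
    refine (setIntegral_le_integral (memLp_mollify n (hem a b)).integrable_sq
      (ae_of_all _ fun x => sq_nonneg _)).trans (integral_mollify_sq_le n (hem a b))
  have i1 (a b) : Integrable fun x => om τ x * grad2 (mollify n (e a b)) x :=
    integrable_om_mul hτ (continuous_grad2 ((hsme a b).of_le (by norm_num)))
  have i2 : Integrable fun x => om τ x * grad2 (mollify n (g i j)) x :=
    integrable_om_mul hτ (continuous_grad2 ((hsm i j).of_le (by norm_num)))
  have hpt (x) (hx : x ∈ slab τ) : grad2 (mollify n (g i j)) x ≤
      27 * ∑ a, ∑ b, grad2 (mollify n (e a b)) x := by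
    set s := ∑ a, ∑ b, grad2 (mollify n (e a b)) x with hs
    have hle (a b k) : pd k (mollify n (e a b)) x ^ 2 ≤ s := by
      calc pd k (mollify n (e a b)) x ^ 2 ≤ grad2 (mollify n (e a b)) x :=
            Finset.single_le_sum (f := fun k => pd k (mollify n (e a b)) x ^ 2)
              (fun _ _ => sq_nonneg _) (Finset.mem_univ k)
        _ ≤ ∑ b, grad2 (mollify n (e a b)) x :=
            Finset.single_le_sum (f := fun b => grad2 (mollify n (e a b)) x)
              (fun _ _ => grad2_nonneg _ _) (Finset.mem_univ b)
        _ ≤ s := Finset.single_le_sum (f := fun a => ∑ b, grad2 (mollify n (e a b)) x)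
              (fun _ _ => Finset.sum_nonneg fun _ _ => grad2_nonneg _ _) (Finset.mem_univ a)
    have hx2 : x ∈ slab (τ / 2) := mem_of_mem_nhds (slab_half_mem_nhds hτ hx)
    obtain ⟨θ, hθ, -, h2⟩ := exists_test_mollify n (hn x hx2)
    have hsymm (a b k) : pd k (mollify n (g a b)) x = pd b (mollify n (g a k)) x := by
      rw [h2 _ (hgl a b), h2 _ (hgl a k), hc a θ hθ]
    have hk (k) : pd k (mollify n (g i j)) x ^ 2 ≤ 9 * s := by
      -- The classical expression of second derivatives of a displacement by first derivatives of
      -- its strain; it uses only that each row of `g` is curl free. Three terms give `9 s`, three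
      -- values of `k` give `27`, and Caccioppoli's `64` makes `1728`.
      have e1 : pd k (mollify n (g i j)) x = pd k (mollify n (e i j)) x +
          pd j (mollify n (e i k)) x - pd i (mollify n (e j k)) x := by
        simp only [hpe]
        rw [hsymm i k j, hsymm j k i, hsymm k j i, hsymm j i k, hsymm k i j]
        ring
      rw [e1]
      have a1 := hle i j k
      have a2 := hle i k j
      have a3 := hle j k i
      set p := pd k (mollify n (e i j)) x
      set q := pd j (mollify n (e i k)) x
      set r := pd i (mollify n (e j k)) x
      nlinarith [sq_nonneg (p - q), sq_nonneg (p + r), sq_nonneg (q + r)]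
    calc grad2 (mollify n (g i j)) x ≤ ∑ _k : Fin 3, 9 * s := Finset.sum_le_sum fun k _ => hk k
      _ = 27 * s := by simp; ring
  calc ∫ x, om τ x * grad2 (mollify n (g i j)) x
      ≤ ∫ x, 27 * ∑ a, ∑ b, om τ x * grad2 (mollify n (e a b)) x := by
        refine integral_mono i2 ((integrable_finsetSum _ fun a _ =>
          integrable_finsetSum _ fun b _ => i1 a b).const_mul 27) fun x => ?_
        change om τ x * grad2 (mollify n (g i j)) x ≤ _
        simp only [← Finset.mul_sum]
        by_cases hx : x ∈ slab τ
        · rw [mul_left_comm]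
          exact mul_le_mul_of_nonneg_left (hpt x hx) (om_nonneg τ x)
        · simp [image_eq_zero_of_notMem_tsupport fun h => hx (tsupport_om τ h)]
    _ = 27 * ∑ a, ∑ b, ∫ x, om τ x * grad2 (mollify n (e a b)) x := by
        rw [integral_const_mul, integral_finsetSum _ fun a _ =>
          integrable_finsetSum _ fun b _ => i1 a b]
        congr 1
        refine Finset.sum_congr rfl fun a _ => ?_
        rw [integral_finsetSum _ fun b _ => i1 a b]
    _ ≤ 27 * ∑ a, ∑ b, 64 * ∫ x, e a b x ^ 2 := by
        gcongr with a _ b _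
        exact hcac a b
    _ = 1728 * ∑ a, ∑ b, ∫ x, e a b x ^ 2 := by
        simp only [← Finset.mul_sum]; ring

/-! ### Helmholtz projection -/

abbrev L2 : Type := Lp ℝ 2 (volume : Measure E3)

theorem inner_L2_toLp {μ : Measure E3} (f : Lp ℝ 2 μ) {v : E3 → ℝ} (hv : MemLp v 2 μ) :
    inner ℝ f (hv.toLp v) = ∫ x, f x * v x ∂μ := by
  rw [L2.inner_def]
  refine integral_congr_ae ?_
  filter_upwards [hv.coeFn_toLp] with x h2
  simp [h2, mul_comm]

theorem inner_toLp_toLp {μ : Measure E3} {u v : E3 → ℝ} (hu : MemLp u 2 μ) (hv : MemLp v 2 μ) :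
    inner ℝ (hu.toLp u) (hv.toLp v) = ∫ x, u x * v x ∂μ := by
  rw [inner_L2_toLp]
  refine integral_congr_ae ?_
  filter_upwards [hu.coeFn_toLp] with x h2
  simp [h2]

theorem norm_sq_L2 {μ : Measure E3} (f : Lp ℝ 2 μ) : ‖f‖ ^ 2 = ∫ x, f x ^ 2 ∂μ := by
  rw [← real_inner_self_eq_norm_sq, L2.inner_def]
  refine integral_congr_ae (ae_of_all _ fun x => ?_)
  simp [pow_two]

theorem norm_sq_toLp {μ : Measure E3} {u : E3 → ℝ} (hu : MemLp u 2 μ) :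
    ‖hu.toLp u‖ ^ 2 = ∫ x, u x ^ 2 ∂μ := by
  rw [norm_sq_L2]
  refine integral_congr_ae ?_
  filter_upwards [hu.coeFn_toLp] with x h2
  simp [h2]

abbrev VF : Type := PiLp 2 (fun _ : Fin 3 => L2)

def testGrad {η : E3 → ℝ} (h : IsTest η) : VF :=
  WithLp.toLp 2 fun k => (h.memLp_pd k).toLp (pd k η)

theorem integral_pd_mul_pd_comm {η θ : E3 → ℝ} (hη : IsTest η) (hθ : IsTest θ) (j k : Fin 3) :
    ∫ x, pd j η x * pd k θ x = ∫ x, pd k η x * pd j θ x := by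
  have hθ2 : ContDiff ℝ 2 θ := hθ.smooth.of_le (by norm_cast)
  have h (i l : Fin 3) : ∫ x, pd i η x * pd l θ x = - ∫ x, η x * pd i (pd l θ) x := by
    have := pd_integral_by_parts hη.contDiff_one (contDiff_pd (n := 1) hθ2 l)
      (hasCompactSupport_pd hθ.compact l) i
    linarith
  rw [h, h]
  simp only [pd_comm hθ2 j k]

/-- `T` is the orthogonal projection of `S` onto the closure of the gradients of test functions,
taken as the double orthogonal complement `Aᗮᗮ`. The remainder is orthogonal to gradients, which is
equality of weak divergences, and projections do not increase the norm. -/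
theorem exists_helmholtz {S : Fin 3 → E3 → ℝ} (hS : ∀ k, MemLp (S k) 2 volume) :
    ∃ T : Fin 3 → E3 → ℝ, (∀ k, MemLp (T k) 2 volume) ∧ IsCurlFree T ∧
      (∀ θ, IsTest θ → ∑ k, ∫ x, T k x * pd k θ x = ∑ k, ∫ x, S k x * pd k θ x) ∧
      ∑ k, ∫ x, T k x ^ 2 ≤ ∑ k, ∫ x, S k x ^ 2 := by
  set A : Submodule ℝ VF := Submodule.span ℝ {v | ∃ η, ∃ h : IsTest η, v = testGrad h} with hA
  have hAo (w : VF) (hw : ∀ η, ∀ h : IsTest η, inner ℝ (testGrad h) w = 0) : w ∈ Aᗮ := by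
    rw [Submodule.mem_orthogonal]
    intro v hv
    induction hv using Submodule.span_induction with
    | mem v hv => obtain ⟨η, h, rfl⟩ := hv; exact hw η h
    | zero => simp
    | add u v _ _ hu hv => rw [inner_add_left, hu, hv, add_zero]
    | smul a v _ hv => rw [inner_smul_left, hv, mul_zero]
  set s : VF := WithLp.toLp 2 fun k => (hS k).toLp (S k)
  have hcl : IsClosed ((Aᗮᗮ : Submodule ℝ VF) : Set VF) := Submodule.isClosed_orthogonal _
  have hcs : CompleteSpace (Aᗮᗮ : Submodule ℝ VF) := hcl.completeSpace_coe
  have hproj : (Aᗮᗮ : Submodule ℝ VF).HasOrthogonalProjection :=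
    Submodule.HasOrthogonalProjection.ofCompleteSpace _
  set t : VF := (Aᗮᗮ : Submodule ℝ VF).starProjection s
  have ht : t ∈ Aᗮᗮ := Submodule.starProjection_apply_mem _ _
  have hst : s - t ∈ Aᗮᗮᗮ := Submodule.sub_starProjection_mem_orthogonal s
  refine ⟨fun k => t k, fun k => Lp.memLp _, ?_, ?_, ?_⟩
  · intro θ hθ j k
    set a : VF := WithLp.toLp 2 (Pi.single j ((hθ.memLp_pd k).toLp (pd k θ)))
    set b : VF := WithLp.toLp 2 (Pi.single k ((hθ.memLp_pd j).toLp (pd j θ)))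
    have ha (v : VF) : inner ℝ v a = inner ℝ (v j) ((hθ.memLp_pd k).toLp (pd k θ)) := by
      rw [PiLp.inner_apply, Finset.sum_eq_single j] <;> simp +contextual [a]
    have hb (v : VF) : inner ℝ v b = inner ℝ (v k) ((hθ.memLp_pd j).toLp (pd j θ)) := by
      rw [PiLp.inner_apply, Finset.sum_eq_single k] <;> simp +contextual [b]
    -- A curl of a test function is orthogonal to every gradient, so it is orthogonal to `T`, and
    -- this says that `T` is weakly curl free.
    have hw : a - b ∈ Aᗮ := by
      refine hAo _ fun η hη => ?_
      rw [inner_sub_right, ha, hb]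
      simp only [testGrad]
      rw [inner_toLp_toLp, inner_toLp_toLp, integral_pd_mul_pd_comm hη hθ, sub_self]
    have h0 := (Submodule.mem_orthogonal' _ _).1 ht _ hw
    rw [inner_sub_right, ha, hb, inner_L2_toLp, inner_L2_toLp] at h0
    linarith
  · intro θ hθ
    have hθA : testGrad hθ ∈ Aᗮᗮ :=
      Submodule.le_orthogonal_orthogonal A (Submodule.subset_span ⟨θ, hθ, rfl⟩)
    have h0 := (Submodule.mem_orthogonal' _ _).1 hst _ hθA
    rw [inner_sub_left, PiLp.inner_apply, PiLp.inner_apply] at h0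
    have hs (k) : inner ℝ (s k) (testGrad hθ k) = ∫ x, S k x * pd k θ x :=
      inner_toLp_toLp (hS k) (hθ.memLp_pd k)
    have ht' (k) : inner ℝ (t k) (testGrad hθ k) = ∫ x, t k x * pd k θ x :=
      inner_L2_toLp (t k) (hθ.memLp_pd k)
    simp only [hs, ht'] at h0
    linarith
  · have h1 : ‖t‖ ^ 2 ≤ ‖s‖ ^ 2 := by
      gcongr
      exact Submodule.norm_starProjection_apply_le _ s
    rw [PiLp.norm_sq_eq_of_L2, PiLp.norm_sq_eq_of_L2] at h1
    have hs (k) : ‖s k‖ ^ 2 = ∫ x, S k x ^ 2 := norm_sq_toLp (hS k)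
    simpa only [hs, norm_sq_L2] using h1

/-! ### Korn's inequality -/

theorem IsWeakPd.isCurlFree {u : E3 → ℝ} {G : Fin 3 → E3 → ℝ} (h : IsWeakPd u G) :
    IsCurlFree G := by
  intro θ hθ j k
  have ht (l : Fin 3) : IsTest (pd l θ) :=
    ⟨(hθ.smooth.fderiv_right (m := ∞) (by simp)).clm_apply contDiff_const,
      hasCompactSupport_pd hθ.compact l,
      (closure_minimal (fun x hx => by
        by_contra hc
        exact hx (pd_eq_zero_of_notMem_tsupport hc l)) (isClosed_tsupport θ)).trans hθ.subset⟩
  have h1 := h _ (ht k) j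
  have h2 := h _ (ht j) k
  simp only [pd_comm (hθ.smooth.of_le (by norm_cast)) k j] at h1
  linarith

theorem sq_average_core_le {f : E3 → ℝ} (hf : MemLp f 2 volume) :
    (⨍ y in core, f y) ^ 2 ≤ (volume.real core)⁻¹ * ∫ x, f x ^ 2 := by
  have hK : 0 < volume.real core := ENNReal.toReal_pos volume_core_ne_zero volume_core_ne_top
  set c := ⨍ y in core, f y with hc
  have hfin : IsFiniteMeasure (volume.restrict core) := isFiniteMeasure_restrict.2 volume_core_ne_top
  have hfc := hf.restrict core
  have hi : IntegrableOn f core := hfc.integrable (by norm_num)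
  have hcint : ∫ x in core, f x = volume.real core * c := by
    rw [hc, setAverage_eq, smul_eq_mul, mul_inv_cancel_left₀ hK.ne']
  have h0 : 0 ≤ ∫ x in core, (f x - c) ^ 2 := integral_nonneg fun x => sq_nonneg _
  have e : ∫ x in core, (f x - c) ^ 2 = (∫ x in core, f x ^ 2) - volume.real core * c ^ 2 := by
    have i1 : IntegrableOn (fun x => f x ^ 2 - 2 * c * f x) core :=
      hfc.integrable_sq.sub (hi.const_mul _)
    have : ∀ x, (f x - c) ^ 2 = f x ^ 2 - 2 * c * f x + c ^ 2 := fun x => by ring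
    simp only [this]
    rw [integral_add i1 (integrable_const _), integral_sub hfc.integrable_sq (hi.const_mul _),
      integral_const_mul, hcint, integral_const, measureReal_restrict_apply_univ, smul_eq_mul]
    ring
  have h1 : ∫ x in core, f x ^ 2 ≤ ∫ x, f x ^ 2 :=
    setIntegral_le_integral hf.integrable_sq (ae_of_all _ fun x => sq_nonneg _)
  rw [inv_mul_eq_div, le_div_iff₀ hK]
  linarith

theorem integrable_mul_indicator_core {f : E3 → ℝ} (hf : MemLp f 2 volume) :
    Integrable fun x => f x * core.indicator (fun _ => (1 : ℝ)) x :=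
  hf.integrable_mul memLp_indicator_core

theorem average_core_sub {f g : E3 → ℝ} (hf : MemLp f 2 volume) (hg : MemLp g 2 volume) :
    ⨍ y in core, (f y - g y) = (⨍ y in core, f y) - ⨍ y in core, g y := by
  simp only [average_core_eq, sub_mul]
  rw [integral_sub (integrable_mul_indicator_core hf)
    (integrable_mul_indicator_core hg), mul_sub]

theorem average_core_half_add {f g : E3 → ℝ} (hf : MemLp f 2 volume) (hg : MemLp g 2 volume) :
    ⨍ y in core, (1 / 2 * (f y + g y)) = 1 / 2 * ((⨍ y in core, f y) + ⨍ y in core, g y) := by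
  simp only [average_core_eq, mul_assoc, add_mul]
  rw [integral_const_mul, integral_add (integrable_mul_indicator_core hf)
    (integrable_mul_indicator_core hg)]
  ring

/-- **Korn's inequality** on the cylinder. -/
theorem korn : ∃ C : ℝ, 0 ≤ C ∧ ∀ (u : Fin 3 → E3 → ℝ) (G : Fin 3 → Fin 3 → E3 → ℝ),
    (∀ i j, MemLp (G i j) 2 volume) → (∀ i j x, x ∉ cylinder → G i j x = 0) →
    (∀ i, IsWeakPd (u i) (G i)) →
    (∀ i j, ∫ x in core, G i j x = ∫ x in core, G j i x) →
    ∀ i j, ∫ x, G i j x ^ 2 ≤ C * ∑ a, ∑ b, ∫ x, (1 / 2 * (G a b x + G b a x)) ^ 2 := by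
  have hw : 0 ≤ wpConst := by norm_num [wpConst]
  refine ⟨3 * (78 + wpConst * (1728 * 1431) +
    945 * (volume.real core)⁻¹ * volume.real cylinder), by positivity, ?_⟩
  intro u G hG hG0 hu hcore i j
  have hGl (a b) : LocallyIntegrable (G a b) := (hG a b).locallyIntegrable (by norm_num)
  set e : Fin 3 → Fin 3 → E3 → ℝ := fun a b x => 1 / 2 * (G a b x + G b a x) with he
  have hem (a b) : MemLp (e a b) 2 volume := ((hG a b).add (hG b a)).const_mul (1 / 2)
  set N := ∑ a, ∑ b, ∫ x, e a b x ^ 2 with hN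
  have heN (a b) : ∫ x, e a b x ^ 2 ≤ N :=
    (Finset.single_le_sum (f := fun b => ∫ x, e a b x ^ 2)
      (fun _ _ => integral_nonneg fun _ => sq_nonneg _) (Finset.mem_univ b)).trans
    (Finset.single_le_sum (f := fun a => ∑ b, ∫ x, e a b x ^ 2)
      (fun _ _ => Finset.sum_nonneg fun _ _ => integral_nonneg fun _ => sq_nonneg _)
      (Finset.mem_univ a))
  -- Since `∂ₖGₖₐ = ∂ₐGₖₖ`, the two added terms have cancelling divergences: row `a` of `S` has the
  -- divergence of row `a` of `G`, yet `S` is linear in the strain alone.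
  set S : Fin 3 → Fin 3 → E3 → ℝ := fun a k x =>
    G a k x + G k a x - (if a = k then ∑ l, G l l x else 0) with hS
  have htr : MemLp (fun x => ∑ l, G l l x) 2 volume :=
    memLp_finsetSum _ fun l _ => hG l l
  have hSm (a k) : MemLp (S a k) 2 volume := by
    refine ((hG a k).add (hG k a)).sub ?_
    by_cases h : a = k
    · simpa only [h, if_true] using htr
    · simp [h]
  -- An entry is twice a strain entry minus at most a sum of three, and `2·4 + 2·3·3 = 26`.
  have hSN (a k) : ∫ x, S a k x ^ 2 ≤ 26 * N := by
    have : ∀ x, S a k x ^ 2 ≤ 26 * ∑ a, ∑ b, e a b x ^ 2 := by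
      intro x
      set s := ∑ a, ∑ b, e a b x ^ 2
      have hs (a b) : e a b x ^ 2 ≤ s :=
        (Finset.single_le_sum (f := fun b => e a b x ^ 2)
          (fun _ _ => sq_nonneg _) (Finset.mem_univ b)).trans
        (Finset.single_le_sum (f := fun a => ∑ b, e a b x ^ 2)
          (fun _ _ => Finset.sum_nonneg fun _ _ => sq_nonneg _) (Finset.mem_univ a))
      have e1 : G a k x + G k a x = 2 * e a k x := by simp only [he]; ring
      have e2 : ∑ l, G l l x = e 0 0 x + e 1 1 x + e 2 2 x := by
        simp only [he, Fin.sum_univ_three]; ring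
      simp only [hS, e1, e2]
      have h1 := hs a k
      have h2 := hs 0 0
      have h3 := hs 1 1
      have h4 := hs 2 2
      set p := e a k x
      set q := e 0 0 x
      set r := e 1 1 x
      set t := e 2 2 x
      split_ifs
      · nlinarith [sq_nonneg (2 * p + (q + r + t)), sq_nonneg (q - r), sq_nonneg (q - t),
          sq_nonneg (r - t)]
      · nlinarith
    refine (integral_mono (hSm a k).integrable_sq ((integrable_finsetSum _ fun a _ =>
      integrable_finsetSum _ fun b _ => (hem a b).integrable_sq).const_mul 26) this).trans_eq ?_
    rw [integral_const_mul, integral_finsetSum _ fun a _ =>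
      integrable_finsetSum _ fun b _ => (hem a b).integrable_sq]
    congr 1
    refine Finset.sum_congr rfl fun a _ => ?_
    rw [integral_finsetSum _ fun b _ => (hem a b).integrable_sq]
  choose T hT hTc hTd hTn using fun a => exists_helmholtz (hSm a)
  have hTl (a b) : LocallyIntegrable (T a b) := (hT a b).locallyIntegrable (by norm_num)
  have hTN (a k) : ∫ x, T a k x ^ 2 ≤ 78 * N := by
    calc ∫ x, T a k x ^ 2 ≤ ∑ k, ∫ x, T a k x ^ 2 :=
          Finset.single_le_sum (f := fun k => ∫ x, T a k x ^ 2)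
            (fun _ _ => integral_nonneg fun _ => sq_nonneg _) (Finset.mem_univ k)
      _ ≤ ∑ k, ∫ x, S a k x ^ 2 := hTn a
      _ ≤ ∑ _k : Fin 3, 26 * N := Finset.sum_le_sum fun k _ => hSN a k
      _ = 78 * N := by simp; ring
  -- The corrected matrix has curl-free and divergence-free rows, so `korn_harmonic` applies, while
  -- `T` is already bounded by the strain.
  set g : Fin 3 → Fin 3 → E3 → ℝ := fun a b x => G a b x - T a b x with hg
  have hgm (a b) : MemLp (g a b) 2 volume := (hG a b).sub (hT a b)
  have hgint {θ : E3 → ℝ} (hθ : IsTest θ) (a b k : Fin 3) :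
      ∫ x, g a b x * pd k θ x = (∫ x, G a b x * pd k θ x) - ∫ x, T a b x * pd k θ x := by
    simp only [hg, sub_mul]
    exact integral_sub (hθ.integrable_mul_pd (hGl a b) k) (hθ.integrable_mul_pd (hTl a b) k)
  have hgc (a) : IsCurlFree (g a) := by
    intro θ hθ b k
    rw [hgint hθ, hgint hθ, (hu a).isCurlFree θ hθ, hTc a θ hθ]
  have hgd (a) : IsDivFree (g a) := by
    intro θ hθ
    have hSint (k) : ∫ x, S a k x * pd k θ x = (∫ x, G a k x * pd k θ x) +
        (∫ x, G k k x * pd a θ x) - (if a = k then ∑ l, ∫ x, G l l x * pd k θ x else 0) := by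
      have i1 := hθ.integrable_mul_pd (hGl a k) k
      have i2 := hθ.integrable_mul_pd (hGl k a) k
      have i3 (l) := hθ.integrable_mul_pd (hGl l l) k
      have i12 : Integrable fun x => G a k x * pd k θ x + G k a x * pd k θ x := i1.add i2
      rw [← (hu k).isCurlFree θ hθ a k]
      simp only [hS, sub_mul, add_mul]
      by_cases hak : a = k
      · simp only [hak, if_true, Finset.sum_mul] at i12 ⊢
        rw [integral_sub i12 (integrable_finsetSum _ fun l _ => i3 l),
          integral_finsetSum _ fun l _ => i3 l]
        rw [hak] at i1 i2
        rw [integral_add i1 i2]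
      · simp only [hak, if_false, zero_mul, sub_zero]
        rw [integral_add i1 i2]
    have h1 := hTd a θ hθ
    simp only [hgint hθ, Finset.sum_sub_distrib, h1, hSint, Finset.sum_add_distrib,
      Finset.sum_ite_eq, Finset.mem_univ, if_true]
    ring
  set f : Fin 3 → Fin 3 → E3 → ℝ := fun a b x => 1 / 2 * (g a b x + g b a x) with hf
  have hfm (a b) : MemLp (f a b) 2 volume := ((hgm a b).add (hgm b a)).const_mul (1 / 2)
  have hfN (a b) : ∫ x, f a b x ^ 2 ≤ 159 * N := by
    have : ∀ x, f a b x ^ 2 ≤ 3 * e a b x ^ 2 + T a b x ^ 2 + T b a x ^ 2 := by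
      intro x
      have : f a b x = e a b x - 1 / 2 * T a b x - 1 / 2 * T b a x := by
        simp only [hf, hg, he]; ring
      rw [this]
      nlinarith [sq_nonneg (e a b x + 1 / 2 * T a b x), sq_nonneg (e a b x + 1 / 2 * T b a x),
        sq_nonneg (T a b x - T b a x), sq_nonneg (T a b x), sq_nonneg (T b a x)]
    have i1 : Integrable fun x => 3 * e a b x ^ 2 + T a b x ^ 2 :=
      ((hem a b).integrable_sq.const_mul 3).add (hT a b).integrable_sq
    refine (integral_mono (hfm a b).integrable_sq (i1.add (hT b a).integrable_sq) this).trans ?_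
    rw [integral_add' i1 (hT b a).integrable_sq,
      integral_add ((hem a b).integrable_sq.const_mul 3) (hT a b).integrable_sq,
      integral_const_mul]
    linarith [heN a b, hTN a b, hTN b a]
  have hgN : ∫ x in cylinder, (g i j x - ⨍ y in core, g i j y) ^ 2 ≤
      wpConst * (1728 * 1431) * N := by
    refine (korn_harmonic hgm hgc hgd i j).trans ?_
    have : ∑ a, ∑ b, ∫ x, f a b x ^ 2 ≤ 1431 * N := by
      calc ∑ a, ∑ b, ∫ x, f a b x ^ 2 ≤ ∑ _a : Fin 3, ∑ _b : Fin 3, 159 * N :=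
            Finset.sum_le_sum fun a _ => Finset.sum_le_sum fun b _ => hfN a b
        _ = 1431 * N := by simp; ring
    calc wpConst * (1728 * ∑ a, ∑ b, ∫ x, f a b x ^ 2) ≤ wpConst * (1728 * (1431 * N)) := by gcongr
      _ = _ := by ring
  set c := ⨍ y in core, g i j y with hc
  -- The skew part of the mean of `G` over the core vanishes by normalization, so the mean of `g` is
  -- a combination of means of its symmetric part and of `T`; `945 = 3(159 + 78 + 78)`.
  have hcN : c ^ 2 ≤ 945 * (volume.real core)⁻¹ * N := by
    have hav : ⨍ y in core, G i j y = ⨍ y in core, G j i y := by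
      rw [setAverage_eq, setAverage_eq, hcore]
    have e1 : c = (⨍ y in core, G i j y) - ⨍ y in core, T i j y := average_core_sub (hG i j) (hT i j)
    have e2 : ⨍ y in core, g j i y = (⨍ y in core, G j i y) - ⨍ y in core, T j i y :=
      average_core_sub (hG j i) (hT j i)
    have e3 : ⨍ y in core, f i j y = 1 / 2 * (c + ⨍ y in core, g j i y) :=
      average_core_half_add (hgm i j) (hgm j i)
    have a1 := sq_average_core_le (hfm i j)
    have a2 := sq_average_core_le (hT i j)
    have a3 := sq_average_core_le (hT j i)
    set p := ⨍ y in core, f i j y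
    set q := ⨍ y in core, T i j y
    set r := ⨍ y in core, T j i y
    have e4 : c = p - 1 / 2 * q + 1 / 2 * r := by rw [e3, e2, ← hav, e1]; ring
    have hκ : 0 ≤ (volume.real core)⁻¹ := by positivity
    have b1 := a1.trans (mul_le_mul_of_nonneg_left (hfN i j) hκ)
    have b2 := a2.trans (mul_le_mul_of_nonneg_left (hTN i j) hκ)
    have b3 := a3.trans (mul_le_mul_of_nonneg_left (hTN j i) hκ)
    have b4 : c ^ 2 ≤ 3 * (p ^ 2 + q ^ 2 + r ^ 2) := by
      rw [e4]
      nlinarith [sq_nonneg (p + 1 / 2 * q), sq_nonneg (p - 1 / 2 * r), sq_nonneg (q + r),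
        sq_nonneg q, sq_nonneg r]
    refine b4.trans ?_
    linarith
  have i1 : IntegrableOn (fun x => T i j x ^ 2) cylinder := (hT i j).integrable_sq.integrableOn
  have i2 : IntegrableOn (fun x => (g i j x - c) ^ 2) cylinder :=
    (((hgm i j).restrict cylinder).sub (memLp_const c)).integrable_sq
  have i12 : IntegrableOn (fun x => T i j x ^ 2 + (g i j x - c) ^ 2) cylinder := i1.add i2
  have hT1 : ∫ x in cylinder, T i j x ^ 2 ≤ 78 * N :=
    (setIntegral_le_integral (hT i j).integrable_sq (ae_of_all _ fun x => sq_nonneg _)).trans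
      (hTN i j)
  calc ∫ x, G i j x ^ 2 = ∫ x in cylinder, G i j x ^ 2 :=
        (setIntegral_eq_integral_of_forall_compl_eq_zero fun x hx => by simp [hG0 i j x hx]).symm
    _ ≤ ∫ x in cylinder, 3 * (T i j x ^ 2 + (g i j x - c) ^ 2 + c ^ 2) := by
        refine integral_mono (hG i j).integrable_sq.integrableOn
          ((i12.add (integrable_const (c ^ 2))).const_mul 3) fun x => ?_
        have : G i j x = T i j x + (g i j x - c) + c := by simp only [hg]; ring
        change G i j x ^ 2 ≤ 3 * (T i j x ^ 2 + (g i j x - c) ^ 2 + c ^ 2)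
        rw [this]
        set p := g i j x - c
        nlinarith [sq_nonneg (T i j x - p), sq_nonneg (T i j x - c), sq_nonneg (p - c)]
    _ = 3 * ((∫ x in cylinder, T i j x ^ 2) + (∫ x in cylinder, (g i j x - c) ^ 2) +
          volume.real cylinder * c ^ 2) := by
        rw [integral_const_mul, integral_add i12 (integrable_const _), integral_add i1 i2,
          integral_const, measureReal_restrict_apply_univ, smul_eq_mul]
    _ ≤ 3 * (78 * N + wpConst * (1728 * 1431) * N +
          volume.real cylinder * (945 * (volume.real core)⁻¹ * N)) := by
        gcongr
    _ = _ := by ring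

/-! ### Existence of minimizers -/

/-- A quadratic functional minus a linear term from a compact family attains its minimum. -/
theorem exists_min_of_coercive {H K ι T : Type*} [NormedAddCommGroup H] [InnerProductSpace ℝ H]
    [CompleteSpace H] [NormedAddCommGroup K] [InnerProductSpace ℝ K] [Fintype ι]
    [TopologicalSpace T] (e : ι → H →L[ℝ] K) {c : ℝ} (hc : 0 < c)
    (he : ∀ x, c * ‖x‖ ^ 2 ≤ ∑ a, ‖e a x‖ ^ 2) {S : Set T} (hS : IsCompact S) (hne : S.Nonempty)
    {l : T → H →L[ℝ] ℝ} (hl : Continuous l) :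
    ∃ t ∈ S, ∃ x, ∀ t' ∈ S, ∀ y,
      4 * ∑ a, ‖e a x‖ ^ 2 - l t x ≤ 4 * ∑ a, ‖e a y‖ ^ 2 - l t' y := by
  set B : H →L[ℝ] H →L[ℝ] ℝ := ∑ a, (innerSL ℝ).bilinearComp (e a) (e a) with hB
  have hBa (x y : H) : B x y = ∑ a, inner ℝ (e a x) (e a y) := by
    simp [hB]
  have hco : IsCoercive B := ⟨c, hc, fun x => by
    rw [hBa]
    simp only [real_inner_self_eq_norm_sq]
    have := he x
    nlinarith⟩
  set Z := hco.continuousLinearEquivOfBilin with hZ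
  -- The Lax–Milgram solution of the Euler equation `8 B(s, ·) = l t` of `4 B(y, y) - l t y`.
  -- Completing the square shows that the minimum for fixed `t` is `-4 B(s, s)`, a continuous
  -- function of `t`.
  set s : T → H := fun t => (1 / 8 : ℝ) • Z.symm ((InnerProductSpace.toDual ℝ H).symm (l t))
    with hs
  have hsc : Continuous s := by
    refine Continuous.const_smul (Z.symm.continuous.comp ?_) _
    exact (InnerProductSpace.toDual ℝ H).symm.continuous.comp hl
  have hsB (t : T) (y : H) : 8 * B (s t) y = l t y := by
    have h1 := hco.continuousLinearEquivOfBilin_apply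
      (Z.symm ((InnerProductSpace.toDual ℝ H).symm (l t))) y
    rw [← hZ, Z.apply_symm_apply, InnerProductSpace.toDual_symm_apply] at h1
    rw [h1, hs]
    simp
  have key (t : T) (y : H) : 4 * ∑ a, ‖e a y‖ ^ 2 - l t y =
      4 * (∑ a, ‖e a (y - s t)‖ ^ 2) - 4 * ∑ a, ‖e a (s t)‖ ^ 2 := by
    have : ∑ a, ‖e a (y - s t)‖ ^ 2 =
        ∑ a, ‖e a y‖ ^ 2 - 2 * B (s t) y + ∑ a, ‖e a (s t)‖ ^ 2 := by
      rw [hBa, Finset.mul_sum, ← Finset.sum_sub_distrib, ← Finset.sum_add_distrib]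
      refine Finset.sum_congr rfl fun a _ => ?_
      rw [map_sub, norm_sub_sq_real, real_inner_comm]
    rw [this, ← hsB]
    ring
  have hcont : Continuous fun t => -(4 * ∑ a, ‖e a (s t)‖ ^ 2) := by fun_prop
  obtain ⟨t, ht, hmin⟩ := hS.exists_isMinOn hne hcont.continuousOn
  refine ⟨t, ht, s t, fun t' ht' y => ?_⟩
  rw [key, key]
  have h1 : -(4 * ∑ a, ‖e a (s t)‖ ^ 2) ≤ -(4 * ∑ a, ‖e a (s t')‖ ^ 2) := hmin ht'
  have h2 : 0 ≤ ∑ a, ‖e a (y - s t')‖ ^ 2 := Finset.sum_nonneg fun a _ => sq_nonneg _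
  have h3 : ∑ a, ‖e a (s t - s t)‖ ^ 2 = 0 := by simp
  rw [h3]
  linarith

/-- `u` is in `H¹` of the cylinder, with gradient `G i j = ∂ⱼ uᵢ`. -/
structure IsSobolev (u : Fin 3 → E3 → ℝ) (G : Fin 3 → Fin 3 → E3 → ℝ) : Prop where
  memLp : ∀ i, MemLp (u i) 2 (volume.restrict cylinder)
  memLp_grad : ∀ i j, MemLp (G i j) 2 (volume.restrict cylinder)
  weak : ∀ i j θ, IsTest θ →
    ∫ x in cylinder, u i x * pd j θ x = -∫ x in cylinder, G i j x * θ x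

theorem memLp_indicator_cylinder {f : E3 → ℝ} (hf : MemLp f 2 (volume.restrict cylinder)) :
    MemLp (cylinder.indicator f) 2 volume :=
  (memLp_indicator_iff_restrict measurableSet_cylinder).2 hf

theorem setIntegral_core_indicator (f : E3 → ℝ) :
    ∫ x in core, cylinder.indicator f x = ∫ x in core, f x :=
  setIntegral_congr_fun isOpen_core.measurableSet fun _ hx =>
    indicator_of_mem (core_subset hx) f

theorem integral_indicator_mul (f g : E3 → ℝ) :
    ∫ x, cylinder.indicator f x * g x = ∫ x in cylinder, f x * g x := by
  rw [← integral_indicator measurableSet_cylinder]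
  simp only [indicator_mul_left]

theorem IsSobolev.isWeakPd {u : Fin 3 → E3 → ℝ} {G : Fin 3 → Fin 3 → E3 → ℝ}
    (h : IsSobolev u G) (i : Fin 3) :
    IsWeakPd (cylinder.indicator (u i)) fun j => cylinder.indicator (G i j) := by
  intro θ hθ k
  rw [integral_indicator_mul, integral_indicator_mul, h.weak i k θ hθ]

theorem integral_sq_indicator (f : E3 → ℝ) :
    ∫ x, cylinder.indicator f x ^ 2 = ∫ x in cylinder, f x ^ 2 := by
  rw [← integral_indicator measurableSet_cylinder]
  refine integral_congr_ae (ae_of_all _ fun x => ?_)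
  by_cases hx : x ∈ cylinder <;> simp [hx]

/-- The coercivity of the elastic energy on normalized displacements. -/
theorem exists_korn_const : ∃ C : ℝ, 0 < C ∧ ∀ u G, IsSobolev u G →
    (∀ i, ∫ x in core, u i x = 0) →
    (∀ i j, ∫ x in core, G i j x = ∫ x in core, G j i x) →
    (∑ i, ∫ x in cylinder, u i x ^ 2) + (∑ i, ∑ j, ∫ x in cylinder, G i j x ^ 2) ≤
      C * ∑ a, ∑ b, ∫ x in cylinder, (1 / 2 * (G a b x + G b a x)) ^ 2 := by
  obtain ⟨C, hC, hk⟩ := korn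
  have hw : 0 ≤ wpConst := by norm_num [wpConst]
  refine ⟨9 * wpConst * C + 9 * C + 1, by positivity, fun u G h hu hG => ?_⟩
  have hK := hk (fun i => cylinder.indicator (u i)) (fun i j => cylinder.indicator (G i j))
    (fun i j => memLp_indicator_cylinder (h.memLp_grad i j))
    (fun i j _ hx => indicator_of_notMem hx _) h.isWeakPd
    (fun i j => by rw [setIntegral_core_indicator, setIntegral_core_indicator, hG])
  set A := ∑ a, ∑ b, ∫ x in cylinder, (1 / 2 * (G a b x + G b a x)) ^ 2 with hA
  have hAe : ∑ a, ∑ b, ∫ x, (1 / 2 * (cylinder.indicator (G a b) x +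
      cylinder.indicator (G b a) x)) ^ 2 = A := by
    refine Finset.sum_congr rfl fun a _ => Finset.sum_congr rfl fun b _ => ?_
    rw [← integral_sq_indicator]
    refine integral_congr_ae (ae_of_all _ fun x => ?_)
    by_cases hx : x ∈ cylinder <;> simp [hx]
  rw [hAe] at hK
  simp only [integral_sq_indicator] at hK
  have hA0 : 0 ≤ A := Finset.sum_nonneg fun a _ => Finset.sum_nonneg fun b _ =>
    integral_nonneg fun x => sq_nonneg _
  have hP (i : Fin 3) : ∫ x in cylinder, u i x ^ 2 ≤ wpConst * (3 * (C * A)) := by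
    have := (h.isWeakPd i).poincare (memLp_indicator_cylinder (h.memLp i))
      (fun j => memLp_indicator_cylinder (h.memLp_grad i j))
    have h0 : ⨍ y in core, cylinder.indicator (u i) y = 0 := by
      rw [setAverage_eq, setIntegral_core_indicator, hu, smul_zero]
    rw [h0] at this
    simp only [sub_zero, integral_sq_indicator] at this
    have e : ∫ x in cylinder, cylinder.indicator (u i) x ^ 2 = ∫ x in cylinder, u i x ^ 2 :=
      setIntegral_congr_fun measurableSet_cylinder fun x hx => by simp [hx]
    rw [e] at this
    refine this.trans (mul_le_mul_of_nonneg_left ?_ hw)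
    calc ∑ k, ∫ x in cylinder, G i k x ^ 2 ≤ ∑ k : Fin 3, C * A :=
          Finset.sum_le_sum fun k _ => hK i k
      _ = 3 * (C * A) := by simp
  calc _ ≤ (∑ i : Fin 3, wpConst * (3 * (C * A))) + ∑ i : Fin 3, ∑ j : Fin 3, C * A :=
        add_le_add (Finset.sum_le_sum fun i _ => hP i)
          (Finset.sum_le_sum fun i _ => Finset.sum_le_sum fun j _ => hK i j)
    _ = (9 * wpConst * C + 9 * C) * A := by simp; ring
    _ ≤ _ := by nlinarith

/-- Square integrable functions on the cylinder. -/
abbrev LC : Type := Lp ℝ 2 (volume.restrict cylinder)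

/-- Pairs of a displacement and a gradient. -/
abbrev PairSpace : Type := PiLp 2 fun _ : Fin 3 ⊕ (Fin 3 × Fin 3) => LC

/-- Pairing one component with a fixed function. -/
def pair (g : LC) (a : Fin 3 ⊕ (Fin 3 × Fin 3)) : PairSpace →L[ℝ] ℝ :=
  (innerSL ℝ g).comp (PiLp.proj (𝕜 := ℝ) 2 (fun _ => LC) a)

theorem pair_apply (g : LC) (a : Fin 3 ⊕ (Fin 3 × Fin 3)) (x : PairSpace) :
    pair g a x = inner ℝ (x a) g := by
  rw [real_inner_comm]
  rfl

theorem pair_toLp {g : E3 → ℝ} (hg : MemLp g 2 (volume.restrict cylinder))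
    (a : Fin 3 ⊕ (Fin 3 × Fin 3)) (x : PairSpace) :
    pair (hg.toLp g) a x = ∫ y in cylinder, x a y * g y := by
  rw [pair_apply, inner_L2_toLp]

theorem memLp_core : MemLp (core.indicator fun _ => (1 : ℝ)) 2 (volume.restrict cylinder) :=
  memLp_indicator_core.restrict _

theorem integral_mul_indicator_core (f : E3 → ℝ) :
    ∫ x in cylinder, f x * core.indicator (fun _ => (1 : ℝ)) x = ∫ x in core, f x := by
  have h2 : (fun x => f x * core.indicator (fun _ => (1 : ℝ)) x) = core.indicator f := by
    ext x
    by_cases hx : x ∈ core <;> simp [hx]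
  rw [h2, setIntegral_indicator isOpen_core.measurableSet, inter_eq_right.2 core_subset]

/-- The constraints on normalized displacement-gradient pairs; `inc` adds incompressibility. -/
def constraints (inc : Prop) : Set (PairSpace →L[ℝ] ℝ) :=
  {f | (∃ i j, ∃ θ, ∃ h : IsTest θ, f =
      pair (((h.memLp_pd j).restrict cylinder).toLp (pd j θ)) (.inl i) +
        pair ((h.memLp.restrict cylinder).toLp θ) (.inr (i, j))) ∨
    (∃ i, f = pair (memLp_core.toLp _) (.inl i)) ∨
    (∃ i j, f = pair (memLp_core.toLp _) (.inr (i, j)) - pair (memLp_core.toLp _) (.inr (j, i))) ∨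
    (inc ∧ ∃ g, f = ∑ i, pair g (.inr (i, i)))}

/-- The space of normalized displacement-gradient pairs. -/
def normalized (inc : Prop) : Submodule ℝ PairSpace where
  carrier := {x | ∀ f ∈ constraints inc, f x = 0}
  add_mem' ha hb f hf := by rw [map_add, ha f hf, hb f hf, add_zero]
  zero_mem' f _ := map_zero f
  smul_mem' c x hx f hf := by rw [map_smul, hx f hf, smul_zero]

theorem isClosed_normalized (inc : Prop) : IsClosed (normalized inc : Set PairSpace) := by
  have : (normalized inc : Set PairSpace) = ⋂ f ∈ constraints inc, {y | f y = 0} := by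
    ext x
    simp [normalized]
  rw [this]
  exact isClosed_biInter fun f _ => isClosed_eq f.continuous continuous_const

/-- The vanishing of the trace of a gradient. -/
def TraceFree (G : Fin 3 → Fin 3 → E3 → ℝ) : Prop :=
  ∀ᵐ x ∂(volume.restrict cylinder), ∑ i, G i i x = 0

theorem mem_normalized_iff (inc : Prop) (x : PairSpace) : x ∈ normalized inc ↔
    IsSobolev (fun i => x (.inl i)) (fun i j => x (.inr (i, j))) ∧
      (∀ i, ∫ y in core, x (.inl i) y = 0) ∧
      (∀ i j, ∫ y in core, x (.inr (i, j)) y = ∫ y in core, x (.inr (j, i)) y) ∧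
      (inc → TraceFree fun i j => x (.inr (i, j))) := by
  have htr (g : LC) : (∑ i, pair g (.inr (i, i))) x = inner ℝ (∑ i, x (.inr (i, i))) g := by
    simp [pair_apply, sum_inner]
  have hco : ((∑ i, x (.inr (i, i)) : LC) : E3 → ℝ) =ᵐ[volume.restrict cylinder]
      fun y => ∑ i, x (.inr (i, i)) y := by
    have := Lp.coeFn_add (x (.inr (0, 0))) (x (.inr (1, 1)))
    have h2 := Lp.coeFn_add (x (.inr (0, 0)) + x (.inr (1, 1))) (x (.inr (2, 2)))
    simp only [Fin.sum_univ_three]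
    filter_upwards [this, h2] with y h1 h2
    rw [h2, Pi.add_apply, h1, Pi.add_apply]
  constructor
  · intro h
    refine ⟨⟨fun i => Lp.memLp _, fun i j => Lp.memLp _, fun i j θ hθ => ?_⟩, fun i => ?_,
      fun i j => ?_, fun hi => ?_⟩
    · have := h _ (Or.inl ⟨i, j, θ, hθ, rfl⟩)
      rw [add_apply, pair_toLp, pair_toLp] at this
      linarith
    · have := h _ (Or.inr (Or.inl ⟨i, rfl⟩))
      rwa [pair_toLp, integral_mul_indicator_core] at this
    · have := h _ (Or.inr (Or.inr (Or.inl ⟨i, j, rfl⟩)))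
      rw [sub_apply, pair_toLp, pair_toLp, integral_mul_indicator_core,
        integral_mul_indicator_core] at this
      linarith
    · have := h _ (Or.inr (Or.inr (Or.inr ⟨hi, ∑ i, x (.inr (i, i)), rfl⟩)))
      rw [htr, inner_self_eq_zero] at this
      rw [this] at hco
      filter_upwards [hco, Lp.coeFn_zero ℝ 2 (volume.restrict cylinder)] with y h1 h2
      rw [← h1, h2, Pi.zero_apply]
  · rintro ⟨h1, h2, h3, h4⟩ f (⟨i, j, θ, hθ, rfl⟩ | ⟨i, rfl⟩ | ⟨i, j, rfl⟩ | ⟨hi, g, rfl⟩)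
    · rw [add_apply, pair_toLp, pair_toLp, h1.weak i j θ hθ]
      ring
    · rw [pair_toLp, integral_mul_indicator_core, h2]
    · rw [sub_apply, pair_toLp, pair_toLp, integral_mul_indicator_core,
        integral_mul_indicator_core, h3, sub_self]
    · rw [htr]
      have : ∑ i, x (.inr (i, i)) = 0 := by
        refine Lp.ext ?_
        filter_upwards [hco, Lp.coeFn_zero ℝ 2 (volume.restrict cylinder), h4 hi] with y h1 h2 h3
        rw [h1, h2, h3, Pi.zero_apply]
      rw [this, inner_zero_left]

/-- The elastic energy of a displacement gradient. -/
def elasticEnergy (G : Fin 3 → Fin 3 → E3 → ℝ) : ℝ :=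
  4 * ∑ i, ∑ j, ∫ x in cylinder, (1 / 2 * (G i j x + G j i x)) ^ 2

/-- The work of the force `f` on the rotated displacement `R u`. -/
def work (f : Fin 3 → E3 → ℝ) (R : Mat3) (u : Fin 3 → E3 → ℝ) : ℝ :=
  ∑ i, ∑ j, R i j * ∫ x in cylinder, u j x * f i x

/-- The symmetrized gradient. -/
def symPart (a : Fin 3 × Fin 3) : PairSpace →L[ℝ] LC :=
  (1 / 2 : ℝ) • (PiLp.proj (𝕜 := ℝ) 2 (fun _ => LC) (.inr (a.1, a.2)) +
    PiLp.proj (𝕜 := ℝ) 2 (fun _ => LC) (.inr (a.2, a.1)))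

theorem norm_sq_symPart (a : Fin 3 × Fin 3) (x : PairSpace) :
    ‖symPart a x‖ ^ 2 =
      ∫ y in cylinder, (1 / 2 * (x (.inr (a.1, a.2)) y + x (.inr (a.2, a.1)) y)) ^ 2 := by
  have : symPart a x = (1 / 2 : ℝ) • (x (.inr (a.1, a.2)) + x (.inr (a.2, a.1))) := rfl
  rw [this, norm_sq_L2]
  refine integral_congr_ae ?_
  filter_upwards [Lp.coeFn_smul (1 / 2 : ℝ) (x (.inr (a.1, a.2)) + x (.inr (a.2, a.1))),
    Lp.coeFn_add (x (.inr (a.1, a.2))) (x (.inr (a.2, a.1)))] with y h1 h2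
  rw [h1, Pi.smul_apply, h2, Pi.add_apply, smul_eq_mul]

theorem sum_norm_sq_symPart (x : PairSpace) :
    4 * ∑ a, ‖symPart a x‖ ^ 2 = elasticEnergy fun i j => x (.inr (i, j)) := by
  simp only [norm_sq_symPart, elasticEnergy, Fintype.sum_prod_type]

/-- Minimizers among normalized displacements. -/
theorem exists_min_normalized {f : Fin 3 → E3 → ℝ}
    (hf : ∀ i, MemLp (f i) 2 (volume.restrict cylinder)) (inc : Prop) {S : Set Mat3}
    (hS : IsCompact S) (hne : S.Nonempty) :
    ∃ R ∈ S, ∃ x ∈ normalized inc, ∀ R' ∈ S, ∀ y ∈ normalized inc,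
      elasticEnergy (fun i j => x (.inr (i, j))) - work f R (fun i => x (.inl i)) ≤
        elasticEnergy (fun i j => y (.inr (i, j))) - work f R' (fun i => y (.inl i)) := by
  obtain ⟨C, hC, hK⟩ := exists_korn_const
  have : CompleteSpace (normalized inc) :=
    (isClosed_normalized inc).isComplete.completeSpace_coe
  set l : Mat3 → normalized inc →L[ℝ] ℝ := fun R =>
    (∑ i, ∑ j, R i j • pair ((hf i).toLp (f i)) (.inl j)).comp (normalized inc).subtypeL with hl
  have hla (R : Mat3) (x : normalized inc) :
      l R x = work f R (fun i => (x : PairSpace) (.inl i)) := by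
    simp [hl, work, pair_toLp]
  have hlc : Continuous l := by
    have : Continuous fun R : Mat3 =>
        ∑ i, ∑ j, R i j • pair ((hf i).toLp (f i)) (.inl j) :=
      continuous_finsetSum _ fun i _ => continuous_finsetSum _ fun j _ =>
        (continuous_id.matrix_elem i j).smul continuous_const
    exact this.clm_comp continuous_const
  obtain ⟨R, hR, x, hx⟩ := exists_min_of_coercive
    (fun a : Fin 3 × Fin 3 => (symPart a).comp (normalized inc).subtypeL)
    (c := C⁻¹) (inv_pos.2 hC) (fun x => by
      obtain ⟨h1, h2, h3, _⟩ := (mem_normalized_iff inc x).1 x.2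
      have := hK _ _ h1 h2 h3
      have hn : ‖x‖ ^ 2 = (∑ i, ∫ y in cylinder, (x : PairSpace) (.inl i) y ^ 2) +
          ∑ i, ∑ j, ∫ y in cylinder, (x : PairSpace) (.inr (i, j)) y ^ 2 := by
        rw [← Submodule.norm_coe, PiLp.norm_sq_eq_of_L2, Fintype.sum_sum_type,
          Fintype.sum_prod_type]
        simp only [norm_sq_L2]
      have hs := sum_norm_sq_symPart x
      rw [elasticEnergy] at hs
      rw [inv_mul_le_iff₀ hC, hn]
      have hs2 : ∑ a, ‖((symPart a).comp (normalized inc).subtypeL) x‖ ^ 2 =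
          ∑ a, ‖symPart a x‖ ^ 2 := rfl
      rw [hs2, mul_left_cancel₀ (by norm_num : (4 : ℝ) ≠ 0) hs]
      exact this) hS hne hlc
  refine ⟨R, hR, x, x.2, fun R' hR' y hy => ?_⟩
  have := hx R' hR' ⟨y, hy⟩
  rw [hla, hla] at this
  rw [← sum_norm_sq_symPart, ← sum_norm_sq_symPart]
  exact this

/-! ### Classical fields and rigid motions -/

theorem memLp_cylinder_of_bound {f : E3 → ℝ} (hf : ContinuousOn f cylinder) {C : ℝ}
    (hC : ∀ x ∈ cylinder, |f x| ≤ C) {p : ℝ≥0∞} : MemLp f p (volume.restrict cylinder) :=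
  MemLp.of_bound (hf.aestronglyMeasurable measurableSet_cylinder) C
    ((ae_restrict_iff' measurableSet_cylinder).2 (ae_of_all _ hC))

theorem contDiff_mul_of_tsupport {w θ : E3 → ℝ} (hw : ContDiffOn ℝ 1 w cylinder)
    (hθ : ContDiff ℝ 1 θ) (hs : tsupport θ ⊆ cylinder) : ContDiff ℝ 1 fun x => w x * θ x := by
  rw [contDiff_iff_contDiffAt]
  intro x
  by_cases hx : x ∈ cylinder
  · exact (hw.contDiffAt (isOpen_cylinder.mem_nhds hx)).mul hθ.contDiffAt
  · have h0 : θ =ᶠ[𝓝 x] 0 := notMem_tsupport_iff_eventuallyEq.1 fun h => hx (hs h)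
    refine (contDiffAt_const (c := (0 : ℝ))).congr_of_eventuallyEq ?_
    filter_upwards [h0] with y hy
    simp [hy]

theorem differentiableAt_of_contDiffOn {w : E3 → ℝ} (hw : ContDiffOn ℝ 1 w cylinder) {x : E3}
    (hx : x ∈ cylinder) : DifferentiableAt ℝ w x :=
  (hw.contDiffAt (isOpen_cylinder.mem_nhds hx)).differentiableAt (by norm_num)

theorem continuousOn_pd {w : E3 → ℝ} (hw : ContDiffOn ℝ 1 w cylinder) (k : Fin 3) :
    ContinuousOn (pd k w) cylinder :=
  (hw.continuousOn_fderiv_of_isOpen isOpen_cylinder le_rfl).clm_apply continuousOn_const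

/-- Bounded continuously differentiable fields with bounded gradient are in `H¹`. -/
theorem IsSobolev.of_contDiffOn {u : Fin 3 → E3 → ℝ} {G : Fin 3 → Fin 3 → E3 → ℝ}
    (hu : ∀ i, ContDiffOn ℝ 1 (u i) cylinder) (hG : ∀ i j, ∀ x ∈ cylinder, pd j (u i) x = G i j x)
    {C : ℝ} (hC : ∀ i, ∀ x ∈ cylinder, |u i x| ≤ C)
    (hCG : ∀ i j, ∀ x ∈ cylinder, |G i j x| ≤ C) : IsSobolev u G := by
  have hGc (i j) : ContinuousOn (G i j) cylinder :=
    (continuousOn_pd (hu i) j).congr fun x hx => (hG i j x hx).symm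
  have m1 (i) : MemLp (u i) 2 (volume.restrict cylinder) :=
    memLp_cylinder_of_bound (hu i).continuousOn (hC i)
  have m2 (i j) : MemLp (G i j) 2 (volume.restrict cylinder) :=
    memLp_cylinder_of_bound (hGc i j) (hCG i j)
  refine ⟨m1, m2, fun i j θ hθ => ?_⟩
  have hc := contDiff_mul_of_tsupport (hu i) hθ.contDiff_one hθ.subset
  -- The integral of `∂ⱼ(uᵢθ)` is zero because the product is `C¹` with compact support.
  have h0 := pd_integral_by_parts (contDiff_const (c := (1 : ℝ))) hc hθ.compact.mul_left j
  have hp1 : ∀ x, pd j (fun _ => (1 : ℝ)) x = 0 := fun x => by simp [pd]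
  simp only [one_mul, hp1, zero_mul, integral_zero, neg_zero] at h0
  have hsupp : ∀ x, x ∉ cylinder → pd j (fun x => u i x * θ x) x = 0 := fun x hx =>
    pd_eq_zero_of_notMem_tsupport (fun h => hx (hθ.subset (tsupport_mul_subset_right h))) j
  rw [← setIntegral_eq_integral_of_forall_compl_eq_zero hsupp] at h0
  have e : ∫ x in cylinder, pd j (fun x => u i x * θ x) x =
      ∫ x in cylinder, (G i j x * θ x + u i x * pd j θ x) :=
    setIntegral_congr_fun measurableSet_cylinder fun x hx => by
      rw [pd_mul (differentiableAt_of_contDiffOn (hu i) hx)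
        (hθ.contDiff_one.differentiable (by norm_num) x), hG i j x hx]
  have j1 : IntegrableOn (fun x => G i j x * θ x) cylinder :=
    (m2 i j).integrable_mul (hθ.memLp.restrict _)
  have j2 : IntegrableOn (fun x => u i x * pd j θ x) cylinder :=
    (m1 i).integrable_mul ((hθ.memLp_pd j).restrict _)
  rw [e, integral_add j1 j2] at h0
  linarith

theorem IsSobolev.sub {u v : Fin 3 → E3 → ℝ} {G H : Fin 3 → Fin 3 → E3 → ℝ}
    (hu : IsSobolev u G) (hv : IsSobolev v H) :
    IsSobolev (fun i x => u i x - v i x) (fun i j x => G i j x - H i j x) := by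
  refine ⟨fun i => (hu.memLp i).sub (hv.memLp i),
    fun i j => (hu.memLp_grad i j).sub (hv.memLp_grad i j), fun i j θ hθ => ?_⟩
  have i1 : IntegrableOn (fun x => u i x * pd j θ x) cylinder :=
    (hu.memLp i).integrable_mul ((hθ.memLp_pd j).restrict _)
  have i2 : IntegrableOn (fun x => v i x * pd j θ x) cylinder :=
    (hv.memLp i).integrable_mul ((hθ.memLp_pd j).restrict _)
  have i3 : IntegrableOn (fun x => G i j x * θ x) cylinder :=
    (hu.memLp_grad i j).integrable_mul (hθ.memLp.restrict _)
  have i4 : IntegrableOn (fun x => H i j x * θ x) cylinder :=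
    (hv.memLp_grad i j).integrable_mul (hθ.memLp.restrict _)
  simp only [sub_mul]
  rw [integral_sub i1 i2, integral_sub i3 i4, hu.weak i j θ hθ, hv.weak i j θ hθ]
  ring

theorem abs_coord_lt_two {x : E3} (hx : x ∈ cylinder) (j : Fin 3) : |x j| < 2 := by
  have h1 := norm_lt_two_of_mem_cylinder hx
  have h2 := PiLp.norm_apply_le x j
  rw [Real.norm_eq_abs] at h2
  linarith

/-- The components of the affine map `x ↦ A x + b`. -/
def affine (A : Mat3) (b : Fin 3 → ℝ) (i : Fin 3) (x : E3) : ℝ := ∑ j, A i j * x j + b i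

theorem pd_affine (A : Mat3) (b : Fin 3 → ℝ) (i j : Fin 3) (x : E3) :
    pd j (affine A b i) x = A i j := by
  have h : HasFDerivAt (affine A b i)
      (∑ k, A i k • (EuclideanSpace.proj k : E3 →L[ℝ] ℝ)) x :=
    (HasFDerivAt.fun_sum fun k _ => (hasFDerivAt_coord k x).const_mul (A i k)).add_const _
  rw [pd, h.fderiv]
  simp

theorem isSobolev_affine (A : Mat3) (b : Fin 3 → ℝ) :
    IsSobolev (affine A b) (fun i j _ => A i j) := by
  have hb (i : Fin 3) (x : E3) (hx : x ∈ cylinder) :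
      |affine A b i x| ≤ ∑ j, |A i j| * 2 + |b i| := by
    refine (abs_add_le _ _).trans (add_le_add ((Finset.abs_sum_le_sum_abs _ _).trans
      (Finset.sum_le_sum fun j _ => ?_)) le_rfl)
    rw [abs_mul]
    exact mul_le_mul_of_nonneg_left (abs_coord_lt_two hx j).le (abs_nonneg _)
  refine IsSobolev.of_contDiffOn
    (C := ∑ i, (∑ j, |A i j| * 2 + |b i|)) (fun i => ?_) (fun i j x _ => pd_affine A b i j x)
    (fun i x hx => (hb i x hx).trans ?_) (fun i j x _ => ?_)
  · unfold affine
    fun_prop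
  · exact Finset.single_le_sum (f := fun i => ∑ j, |A i j| * 2 + |b i|)
      (fun i _ => by positivity) (Finset.mem_univ i)
  · refine le_trans ?_ (Finset.single_le_sum (f := fun i => ∑ j, |A i j| * 2 + |b i|)
      (fun i _ => by positivity) (Finset.mem_univ i))
    have h1 := Finset.single_le_sum (f := fun j => |A i j| * 2)
      (fun i _ => by positivity) (Finset.mem_univ j)
    have h2 := abs_nonneg (A i j)
    have h3 := abs_nonneg (b i)
    linarith

theorem work_sub {f : Fin 3 → E3 → ℝ} (hf : ∀ i, MemLp (f i) 2 (volume.restrict cylinder))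
    {u v : Fin 3 → E3 → ℝ} (hu : ∀ i, MemLp (u i) 2 (volume.restrict cylinder))
    (hv : ∀ i, MemLp (v i) 2 (volume.restrict cylinder)) (R : Mat3) :
    work f R (fun i x => u i x - v i x) = work f R u - work f R v := by
  simp only [work, ← Finset.sum_sub_distrib, ← mul_sub]
  refine Finset.sum_congr rfl fun i _ => Finset.sum_congr rfl fun j _ => ?_
  have i1 : IntegrableOn (fun x => u j x * f i x) cylinder := (hu j).integrable_mul (hf i)
  have i2 : IntegrableOn (fun x => v j x * f i x) cylinder := (hv j).integrable_mul (hf i)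
  simp only [sub_mul]
  rw [integral_sub i1 i2]

theorem work_congr {f : Fin 3 → E3 → ℝ} {u v : Fin 3 → E3 → ℝ}
    (h : ∀ i, u i =ᵐ[volume.restrict cylinder] v i) (R : Mat3) : work f R u = work f R v := by
  refine Finset.sum_congr rfl fun i _ => Finset.sum_congr rfl fun j _ => ?_
  congr 1
  refine integral_congr_ae ?_
  filter_upwards [h j] with x hx
  rw [hx]

theorem elasticEnergy_congr {G H : Fin 3 → Fin 3 → E3 → ℝ}
    (h : ∀ i j, ∀ᵐ x ∂(volume.restrict cylinder), G i j x + G j i x = H i j x + H j i x) :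
    elasticEnergy G = elasticEnergy H := by
  rw [elasticEnergy, elasticEnergy]
  congr 1
  refine Finset.sum_congr rfl fun i _ => Finset.sum_congr rfl fun j _ => integral_congr_ae ?_
  filter_upwards [h i j] with x hx
  rw [hx]

theorem IsSobolev.congr {u v : Fin 3 → E3 → ℝ} {G H : Fin 3 → Fin 3 → E3 → ℝ}
    (hu : IsSobolev u G) (h1 : ∀ i, v i =ᵐ[volume.restrict cylinder] u i)
    (h2 : ∀ i j, H i j =ᵐ[volume.restrict cylinder] G i j) : IsSobolev v H := by
  refine ⟨fun i => (hu.memLp i).ae_eq (h1 i).symm, fun i j => (hu.memLp_grad i j).ae_eq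
    (h2 i j).symm, fun i j θ hθ => ?_⟩
  have e1 : ∫ x in cylinder, v i x * pd j θ x = ∫ x in cylinder, u i x * pd j θ x :=
    integral_congr_ae (by filter_upwards [h1 i] with x hx; rw [hx])
  have e2 : ∫ x in cylinder, H i j x * θ x = ∫ x in cylinder, G i j x * θ x :=
    integral_congr_ae (by filter_upwards [h2 i j] with x hx; rw [hx])
  rw [e1, e2, hu.weak i j θ hθ]

theorem integrableOn_core {f : E3 → ℝ} (hf : MemLp f 2 (volume.restrict cylinder)) :
    IntegrableOn f core :=
  IntegrableOn.mono_set (hf.integrable (by norm_num)) core_subset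

theorem setIntegral_core_congr {f g : E3 → ℝ} (h : f =ᵐ[volume.restrict cylinder] g) :
    ∫ x in core, f x = ∫ x in core, g x :=
  integral_congr_ae (ae_restrict_of_ae_restrict_of_subset core_subset h)

/-- Every `H¹` field is a normalized one plus a rigid motion. -/
theorem IsSobolev.exists_normalized {u : Fin 3 → E3 → ℝ} {G : Fin 3 → Fin 3 → E3 → ℝ}
    (h : IsSobolev u G) (inc : Prop) (hinc : inc → TraceFree G) :
    ∃ (A : Mat3) (b : Fin 3 → ℝ), A.transpose = -A ∧ ∃ y ∈ normalized inc,
      (∀ i, y (.inl i) =ᵐ[volume.restrict cylinder] fun x => u i x - affine A b i x) ∧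
      (∀ i j, y (.inr (i, j)) =ᵐ[volume.restrict cylinder] fun x => G i j x - A i j) := by
  have hK : 0 < volume.real core := ENNReal.toReal_pos volume_core_ne_zero volume_core_ne_top
  have hfin : IsFiniteMeasure (volume.restrict core) := isFiniteMeasure_restrict.2 volume_core_ne_top
  -- The skew part of the mean of `G` over the core; subtracting it makes the mean symmetric and
  -- leaves strain and trace unchanged. The translation `b` then removes the mean displacement.
  set A : Mat3 := Matrix.of fun i j => (2 * volume.real core)⁻¹ *
    ((∫ x in core, G i j x) - ∫ x in core, G j i x) with hA
  set b : Fin 3 → ℝ := fun i => (volume.real core)⁻¹ *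
    ∫ x in core, (u i x - affine A 0 i x) with hb
  have haff (i : Fin 3) (x : E3) : affine A b i x = affine A 0 i x + b i := by simp [affine]
  have hs := h.sub (isSobolev_affine A b)
  have hs0 := h.sub (isSobolev_affine A 0)
  set y : PairSpace := WithLp.toLp 2 (Sum.elim (fun i => (hs.memLp i).toLp _)
    fun p => (hs.memLp_grad p.1 p.2).toLp _) with hy
  have e1 (i) : y (.inl i) =ᵐ[volume.restrict cylinder] fun x => u i x - affine A b i x :=
    (hs.memLp i).coeFn_toLp
  have e2 (i j) : y (.inr (i, j)) =ᵐ[volume.restrict cylinder] fun x => G i j x - A i j :=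
    (hs.memLp_grad i j).coeFn_toLp
  refine ⟨A, b, ?_, y, (mem_normalized_iff inc y).2 ⟨hs.congr e1 e2, fun i => ?_, fun i j => ?_,
    fun hi => ?_⟩, e1, e2⟩
  · ext i j
    simp [hA]
    ring
  · rw [setIntegral_core_congr (e1 i)]
    have : ∀ x, u i x - affine A b i x = (u i x - affine A 0 i x) - b i := fun x => by
      rw [haff]; ring
    simp only [this]
    rw [integral_sub (integrableOn_core (hs0.memLp i)) (integrable_const _), integral_const,
      measureReal_restrict_apply_univ, smul_eq_mul, hb]
    field_simp
    ring
  · rw [setIntegral_core_congr (e2 i j), setIntegral_core_congr (e2 j i),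
      integral_sub (integrableOn_core (h.memLp_grad i j)) (integrable_const _),
      integral_sub (integrableOn_core (h.memLp_grad j i)) (integrable_const _), integral_const,
      integral_const, measureReal_restrict_apply_univ, smul_eq_mul, smul_eq_mul, hA]
    simp only [Matrix.of_apply]
    field_simp
    ring
  · filter_upwards [hinc hi, e2 0 0, e2 1 1, e2 2 2] with x h0 h1 h2 h3
    simp only [Fin.sum_univ_three] at h0 ⊢
    rw [h1, h2, h3]
    simp [hA]
    linarith

/-- Existence of minimizers among all `H¹` fields, when rigid motions do not work. -/
theorem exists_min {f : Fin 3 → E3 → ℝ}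
    (hf : ∀ i, MemLp (f i) 2 (volume.restrict cylinder)) (inc : Prop) {S : Set Mat3}
    (hS : IsCompact S) (hne : S.Nonempty)
    (hrig : ∀ R ∈ S, ∀ A : Mat3, A.transpose = -A → ∀ b, work f R (affine A b) = 0) :
    ∃ R ∈ S, ∃ u G, IsSobolev u G ∧ (inc → TraceFree G) ∧
      ∀ R' ∈ S, ∀ u' G', IsSobolev u' G' → (inc → TraceFree G') →
        elasticEnergy G - work f R u ≤ elasticEnergy G' - work f R' u' := by
  obtain ⟨R, hR, x, hx, hmin⟩ := exists_min_normalized hf inc hS hne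
  obtain ⟨h1, -, -, h4⟩ := (mem_normalized_iff inc x).1 hx
  refine ⟨R, hR, _, _, h1, h4, fun R' hR' u' G' hu' ht => ?_⟩
  obtain ⟨A, b, hA, y, hy, e1, e2⟩ := hu'.exists_normalized inc ht
  have := hmin R' hR' y hy
  rw [work_congr e1, work_sub hf hu'.memLp (isSobolev_affine A b).memLp, hrig R' hR' A hA b,
    sub_zero] at this
  refine this.trans (le_of_eq ?_)
  congr 1
  refine elasticEnergy_congr fun i j => ?_
  filter_upwards [e2 i j, e2 j i] with z h1 h2
  have : A j i = - A i j := by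
    have := congrFun (congrFun hA i) j
    simpa using this
  rw [h1, h2, this]
  ring

/-! ### The energy functionals in terms of displacement-gradient pairs -/

theorem IsWeakGradient.ae_eq {u : E3 → E3} {G H : E3 → Mat3}
    (hG : IsWeakGradient cylinder u G) (hH : IsWeakGradient cylinder u H) (i j : Fin 3) :
    (fun x => G x i j) =ᵐ[volume.restrict cylinder] fun x => H x i j := by
  have h := isOpen_cylinder.ae_eq_zero_of_integral_contDiff_smul_eq_zero
    (f := fun x => G x i j - H x i j) (μ := volume)
    ((hG.locallyIntegrable_grad i j).sub (hH.locallyIntegrable_grad i j)) ?_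
  · rw [EventuallyEq, ae_restrict_iff' measurableSet_cylinder]
    filter_upwards [h] with x hx hxc
    exact sub_eq_zero.1 (hx hxc)
  intro θ h1 h2 h3
  have e1 := hG.integral_eq i j θ h1 h2 h3
  have e2 := hH.integral_eq i j θ h1 h2 h3
  have h0 : ∀ x, x ∉ cylinder → θ x • (G x i j - H x i j) = 0 := fun x hx => by
    rw [image_eq_zero_of_notMem_tsupport fun h => hx (h3 h), zero_smul]
  rw [← setIntegral_eq_integral_of_forall_compl_eq_zero h0]
  have hint (f : E3 → ℝ) (hf : LocallyIntegrableOn f cylinder) :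
      IntegrableOn (fun x => f x * θ x) cylinder := by
    have hk : IntegrableOn (fun x => f x * θ x) (tsupport θ) :=
      (hf.integrableOn_compact_subset h3 h2).mul_continuousOn h1.continuous.continuousOn h2
    refine hk.of_forall_sdiff_eq_zero measurableSet_cylinder fun x hx => ?_
    rw [image_eq_zero_of_notMem_tsupport hx.2, mul_zero]
  have e3 : ∫ x in cylinder, θ x • (G x i j - H x i j) =
      ∫ x in cylinder, (G x i j * θ x - H x i j * θ x) :=
    integral_congr_ae (ae_of_all _ fun x => by simp only [smul_eq_mul]; ring)
  rw [e3, integral_sub (hint _ (hG.locallyIntegrable_grad i j))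
    (hint _ (hH.locallyIntegrable_grad i j))]
  linarith

theorem IsSobolev.isWeakGradient {u : E3 → E3} {G : Fin 3 → Fin 3 → E3 → ℝ}
    (h : IsSobolev (fun i x => u x i) G) :
    IsWeakGradient cylinder u fun x => Matrix.of fun i j => G i j x := by
  refine ⟨?_, fun i j => ?_, fun i j θ h1 h2 h3 => h.weak i j θ ⟨h1, h2, h3⟩⟩
  · have : MemLp u 2 (volume.restrict cylinder) := MemLp.of_eval_piLp h.memLp
    exact IntegrableOn.locallyIntegrableOn (this.integrable (by norm_num))
  · exact IntegrableOn.locallyIntegrableOn ((h.memLp_grad i j).integrable (by norm_num))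

theorem IsSobolev.memW1 {u : E3 → E3} {G : Fin 3 → Fin 3 → E3 → ℝ}
    (h : IsSobolev (fun i x => u x i) G) {p : ℝ≥0∞} (hp : p ≤ 2) : MemW1 cylinder p u :=
  ⟨MemLp.of_eval_piLp fun i => (h.memLp i).mono_exponent hp, _, h.isWeakGradient,
    fun i j => (h.memLp_grad i j).mono_exponent hp⟩

theorem MemW1.exists_isSobolev {u : E3 → E3} (h : MemW1 cylinder 2 u) :
    ∃ G, IsSobolev (fun i x => u x i) G := by
  obtain ⟨h1, G, h2, h3⟩ := h
  exact ⟨fun i j x => G x i j, fun i => h1.eval_piLp i, h3,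
    fun i j θ hθ => h2.integral_eq i j θ hθ.smooth hθ.compact hθ.subset⟩

/-- The chosen weak gradient agrees with `G` almost everywhere by uniqueness of weak gradients. -/
theorem IsSobolev.strain_ae {u : E3 → E3} {G : Fin 3 → Fin 3 → E3 → ℝ}
    (h : IsSobolev (fun i x => u x i) G) :
    ∀ᵐ x ∂(volume.restrict cylinder),
      strain cylinder u x = Matrix.of fun i j => 1 / 2 * (G i j x + G j i x) := by
  have hex : ∃ G, IsWeakGradient cylinder u G := ⟨_, h.isWeakGradient⟩
  have hw : IsWeakGradient cylinder u (weakGrad cylinder u) := by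
    rw [weakGrad, dif_pos hex]
    exact hex.choose_spec
  have := fun i j => hw.ae_eq h.isWeakGradient i j
  have h2 : ∀ᵐ x ∂(volume.restrict cylinder), ∀ i j, weakGrad cylinder u x i j = G i j x :=
    ae_all_iff.2 fun i => ae_all_iff.2 fun j => this i j
  filter_upwards [h2] with x hx
  ext i j
  simp [strain, hx]
  ring

/-- The strain energy density is `4 |F|²`, restricted to trace-free strains if `inc` holds. -/
def IsModelDensity (inc : Prop) (q : Mat3 → ℝ≥0∞) : Prop :=
  ∀ F : Mat3, F.IsSymm →
    ((inc → F.trace = 0) → q F = ENNReal.ofReal (4 * ∑ i, ∑ j, F i j ^ 2)) ∧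
      (¬ (inc → F.trace = 0) → q F = ⊤)

section Frobenius

open scoped Matrix.Norms.Frobenius

theorem frobenius_norm_sq (F : Mat3) : ‖F‖ ^ 2 = ∑ i, ∑ j, F i j ^ 2 := by
  have h0 : 0 ≤ ∑ i, ∑ j, F i j ^ 2 :=
    Finset.sum_nonneg fun i _ => Finset.sum_nonneg fun j _ => sq_nonneg _
  rw [Matrix.frobenius_norm_def, ← Real.sqrt_eq_rpow]
  simp only [Real.rpow_two, Real.norm_eq_abs, sq_abs]
  exact Real.sq_sqrt h0

theorem isModelDensity_Q {W : Mat3 → ℝ≥0∞} (hW : HasModelLinearization W) :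
    IsModelDensity False (Q W) := by
  intro F hF
  refine ⟨fun _ => ?_, fun h => absurd (fun h => h.elim) h⟩
  rw [Q, hW F hF, frobenius_norm_sq]

theorem isModelDensity_QI {W : Mat3 → ℝ≥0∞} (hW : HasModelLinearization W) :
    IsModelDensity True (QI W) := by
  intro F hF
  refine ⟨fun h => ?_, fun h => ?_⟩
  · rw [QI, if_pos (h trivial), Q, hW F hF, frobenius_norm_sq]
  · rw [QI, if_neg fun h' => h fun _ => h']

end Frobenius

theorem IsSobolev.memLp_sym {u : Fin 3 → E3 → ℝ} {G : Fin 3 → Fin 3 → E3 → ℝ}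
    (h : IsSobolev u G) (i j : Fin 3) :
    MemLp (fun x => 1 / 2 * (G i j x + G j i x)) 2 (volume.restrict cylinder) :=
  ((h.memLp_grad i j).add (h.memLp_grad j i)).const_mul _

theorem elasticEnergy_nonneg (G : Fin 3 → Fin 3 → E3 → ℝ) : 0 ≤ elasticEnergy G :=
  mul_nonneg (by norm_num) (Finset.sum_nonneg fun _ _ => Finset.sum_nonneg fun _ _ =>
    integral_nonneg fun _ => sq_nonneg _)

theorem trace_sym (G : Fin 3 → Fin 3 → E3 → ℝ) (x : E3) :
    (Matrix.of fun i j => 1 / 2 * (G i j x + G j i x) : Mat3).trace = ∑ i, G i i x := by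
  simp only [Matrix.trace, Matrix.diag, Matrix.of_apply]
  exact Finset.sum_congr rfl fun i _ => by ring

theorem isSymm_sym (G : Fin 3 → Fin 3 → E3 → ℝ) (x : E3) :
    (Matrix.of fun i j => 1 / 2 * (G i j x + G j i x) : Mat3).IsSymm := by
  ext i j
  simp [add_comm]

theorem elasticEnergy_eq_integral {u : Fin 3 → E3 → ℝ} {G : Fin 3 → Fin 3 → E3 → ℝ}
    (h : IsSobolev u G) : elasticEnergy G =
      ∫ x in cylinder, 4 * ∑ i, ∑ j, (1 / 2 * (G i j x + G j i x)) ^ 2 := by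
  have hi (i j : Fin 3) : Integrable (fun x => (1 / 2 * (G i j x + G j i x)) ^ 2)
      (volume.restrict cylinder) := (h.memLp_sym i j).integrable_sq
  rw [integral_const_mul, integral_finsetSum _ fun i _ => integrable_finsetSum _ fun j _ => hi i j,
    elasticEnergy]
  congr 1
  exact Finset.sum_congr rfl fun i _ => (integral_finsetSum _ fun j _ => hi i j).symm

theorem integrableOn_elastic {u : Fin 3 → E3 → ℝ} {G : Fin 3 → Fin 3 → E3 → ℝ}
    (h : IsSobolev u G) :
    IntegrableOn (fun x => 4 * ∑ i, ∑ j, (1 / 2 * (G i j x + G j i x)) ^ 2) cylinder :=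
  (integrable_finsetSum _ fun i _ => integrable_finsetSum _ fun j _ =>
    (h.memLp_sym i j).integrable_sq).const_mul _

theorem lintegral_density {inc : Prop} {q : Mat3 → ℝ≥0∞} (hq : IsModelDensity inc q)
    {u : E3 → E3} {G : Fin 3 → Fin 3 → E3 → ℝ} (h : IsSobolev (fun i x => u x i) G)
    (ht : inc → TraceFree G) :
    ∫⁻ x in cylinder, q (strain cylinder u x) = ENNReal.ofReal (elasticEnergy G) := by
  rw [elasticEnergy_eq_integral h,
    ofReal_integral_eq_lintegral_ofReal (integrableOn_elastic h) (ae_of_all _ fun x => by positivity)]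
  refine lintegral_congr_ae ?_
  have ht' : ∀ᵐ x ∂(volume.restrict cylinder), inc → ∑ i, G i i x = 0 := by
    by_cases hinc : inc
    · filter_upwards [ht hinc] with x hx _ using hx
    · exact ae_of_all _ fun x hx => absurd hx hinc
  filter_upwards [h.strain_ae, ht'] with x hx hx2
  rw [hx, (hq _ (isSymm_sym G x)).1 (fun hc => by rw [trace_sym]; exact hx2 hc)]
  rfl

/-- The trace differs from zero on a set of positive measure, and there the density is infinite. -/
theorem lintegral_density_eq_top {inc : Prop} {q : Mat3 → ℝ≥0∞} (hq : IsModelDensity inc q)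
    {u : E3 → E3} {G : Fin 3 → Fin 3 → E3 → ℝ} (h : IsSobolev (fun i x => u x i) G)
    (ht : ¬ (inc → TraceFree G)) :
    ∫⁻ x in cylinder, q (strain cylinder u x) = ⊤ := by
  have hinc : inc := by
    by_contra hc
    exact ht fun h => absurd h hc
  have htr : ¬ TraceFree G := fun hc => ht fun _ => hc
  set N : Set E3 := {x | ∑ i, G i i x ≠ 0} with hN
  have hm : AEMeasurable (fun x => ∑ i, G i i x) (volume.restrict cylinder) :=
    (memLp_finsetSum _ fun i _ => h.memLp_grad i i).1.aemeasurable
  have hNm : NullMeasurableSet N (volume.restrict cylinder) :=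
    hm.nullMeasurable (measurableSet_singleton (0 : ℝ)).compl
  have hN0 : volume.restrict cylinder N ≠ 0 := fun h0 => htr (ae_iff.2 h0)
  rw [eq_top_iff]
  calc (⊤ : ℝ≥0∞) = ⊤ * volume.restrict cylinder N := (ENNReal.top_mul hN0).symm
    _ = ∫⁻ x in cylinder, N.indicator (fun _ => ⊤) x := (lintegral_indicator_const₀ hNm _).symm
    _ ≤ _ := by
      refine lintegral_mono_ae ?_
      filter_upwards [h.strain_ae] with x hx
      by_cases hxN : x ∈ N
      · rw [hx, (hq _ (isSymm_sym G x)).2 (fun hc => hxN (by rw [← trace_sym]; exact hc hinc))]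
        exact le_top
      · simp [hxN]

/-! ### Loads as work integrals, and compactness of the rotation kernel. -/

theorem act_apply (R : Mat3) (v : E3) (i : Fin 3) : act R v i = ∑ j, R i j * v j := by
  simp [act, Matrix.toLpLin_apply, Matrix.mulVec, dotProduct]

theorem load_act {f u : E3 → E3} (hf : ∀ i, MemLp (fun x => f x i) 2 (volume.restrict cylinder))
    (hu : ∀ i, MemLp (fun x => u x i) 2 (volume.restrict cylinder)) (R : Mat3) :
    load cylinder f (fun x => act R (u x)) = work (fun i x => f x i) R (fun i x => u x i) := by
  have hi (i j : Fin 3) : IntegrableOn (fun x => R i j * (u x j * f x i)) cylinder :=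
    ((hu j).integrable_mul (hf i)).const_mul _
  have e : ∀ x, inner ℝ (f x) (act R (u x)) = ∑ i, ∑ j, R i j * (u x j * f x i) := fun x => by
    rw [PiLp.inner_apply]
    refine Finset.sum_congr rfl fun i _ => ?_
    rw [act_apply, real_inner_eq_re_inner, RCLike.inner_apply]
    simp only [conj_trivial, RCLike.re_to_real, Finset.sum_mul]
    exact Finset.sum_congr rfl fun j _ => by ring
  simp only [load, e, work]
  rw [integral_finsetSum _ fun i _ => integrable_finsetSum _ fun j _ => hi i j]
  refine Finset.sum_congr rfl fun i _ => ?_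
  rw [integral_finsetSum _ fun j _ => hi i j]
  exact Finset.sum_congr rfl fun j _ => integral_const_mul _ _

theorem act_one (v : E3) : act 1 v = v := by
  ext i
  simp [act_apply, Matrix.one_apply]

theorem load_eq_work {f u : E3 → E3}
    (hf : ∀ i, MemLp (fun x => f x i) 2 (volume.restrict cylinder))
    (hu : ∀ i, MemLp (fun x => u x i) 2 (volume.restrict cylinder)) :
    load cylinder f u = work (fun i x => f x i) 1 (fun i x => u x i) := by
  rw [← load_act hf hu]
  simp only [act_one]

theorem work_matrix_sub (f u : Fin 3 → E3 → ℝ) (R S : Mat3) :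
    work f (R - S) u = work f R u - work f S u := by
  simp only [work, ← Finset.sum_sub_distrib, Matrix.sub_apply, sub_mul]

theorem continuous_work (f u : Fin 3 → E3 → ℝ) : Continuous fun R => work f R u :=
  continuous_finsetSum _ fun i _ => continuous_finsetSum _ fun j _ =>
    (continuous_id.matrix_elem i j).mul continuous_const

theorem isCompact_SO3 : IsCompact SO3 := by
  have hcl : IsClosed SO3 := by
    have : SO3 = {R : Mat3 | R * star R = 1} ∩ {R : Mat3 | R.det = 1} := by
      ext R
      simp [SO3, Matrix.mem_specialOrthogonalGroup_iff, Matrix.mem_orthogonalGroup_iff,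
        Matrix.star_eq_conjTranspose]
    rw [this]
    refine (isClosed_eq ?_ continuous_const).inter (isClosed_eq ?_ continuous_const)
    · exact continuous_id.mul continuous_star
    · exact continuous_id.matrix_det
  have hK : IsCompact (Set.pi univ fun _ : Fin 3 => Set.pi univ fun _ : Fin 3 => Icc (-1 : ℝ) 1) :=
    isCompact_univ_pi fun _ => isCompact_univ_pi fun _ => isCompact_Icc
  refine hK.of_isClosed_subset hcl fun R hR i _ j _ => ?_
  have h1 : R ∈ Matrix.unitaryGroup (Fin 3) ℝ := (Matrix.mem_specialOrthogonalGroup_iff.1 hR).1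
  have := entry_norm_bound_of_unitary h1 i j
  exact abs_le.1 (by rwa [Real.norm_eq_abs] at this)

theorem memLp_coord (i : Fin 3) : MemLp (fun x : E3 => x i) 2 (volume.restrict cylinder) :=
  memLp_cylinder_of_bound (by fun_prop) fun x hx => (abs_coord_lt_two hx i).le

theorem one_mem_SO3 : (1 : Mat3) ∈ SO3 := one_mem (Matrix.specialOrthogonalGroup (Fin 3) ℝ)

theorem load_act_sub_one {f u : E3 → E3}
    (hf : ∀ i, MemLp (fun x => f x i) 2 (volume.restrict cylinder))
    (hu : ∀ i, MemLp (fun x => u x i) 2 (volume.restrict cylinder)) (R : Mat3) :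
    load cylinder f (fun x => act (R - 1) (u x)) =
      work (fun i x => f x i) R (fun i x => u x i) - load cylinder f u := by
  rw [load_act hf hu, work_matrix_sub, load_eq_work hf hu]

theorem isCompact_rotationKernel {f : E3 → E3}
    (hf : ∀ i, MemLp (fun x => f x i) 2 (volume.restrict cylinder)) :
    IsCompact (rotationKernel (load cylinder f)) := by
  have : rotationKernel (load cylinder f) = SO3 ∩ {R | work (fun i x => f x i) R (fun i x => x i) -
      load cylinder f (fun x => x) = 0} := by
    ext R
    simp only [rotationKernel, load_act_sub_one hf memLp_coord, mem_inter_iff, mem_ofPred_eq]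
  rw [this]
  exact isCompact_SO3.inter_right
    (isClosed_eq ((continuous_work _ _).sub continuous_const) continuous_const)

theorem one_mem_rotationKernel (f : E3 → E3) : (1 : Mat3) ∈ rotationKernel (load cylinder f) := by
  refine ⟨one_mem_SO3, ?_⟩
  have : ∀ x, act 0 x = 0 := fun x => by ext i; simp [act_apply]
  simp [load, this]

theorem ofReal_sub_coe {a b : ℝ} (ha : 0 ≤ a) :
    ((ENNReal.ofReal a : ℝ≥0∞) : EReal) - (b : ℝ) = ((a - b : ℝ) : EReal) := by
  rw [EReal.coe_ennreal_ofReal, max_eq_left ha, EReal.coe_sub]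

section Energies

variable {inc : Prop} {q : Mat3 → ℝ≥0∞} {f u : E3 → E3} {G : Fin 3 → Fin 3 → E3 → ℝ}

theorem linearEnergy_eq (hq : IsModelDensity inc q)
    (hf : ∀ i, MemLp (fun x => f x i) 2 (volume.restrict cylinder))
    (h : IsSobolev (fun i x => u x i) G) (ht : inc → TraceFree G) :
    linearEnergy cylinder q (load cylinder f) u =
      ((elasticEnergy G - work (fun i x => f x i) 1 (fun i x => u x i) : ℝ) : EReal) := by
  rw [linearEnergy, if_pos (h.memW1 le_rfl), lintegral_density hq h ht,
    ofReal_sub_coe (elasticEnergy_nonneg G), load_eq_work hf h.memLp]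

theorem linearEnergy_eq_top (hq : IsModelDensity inc q)
    (h : IsSobolev (fun i x => u x i) G) (ht : ¬ (inc → TraceFree G)) :
    linearEnergy cylinder q (load cylinder f) u = ⊤ := by
  rw [linearEnergy, if_pos (h.memW1 le_rfl), lintegral_density_eq_top hq h ht,
    EReal.coe_ennreal_top, EReal.top_sub_coe]

theorem limitEnergy_eq_top (hq : IsModelDensity inc q)
    (h : IsSobolev (fun i x => u x i) G) (ht : ¬ (inc → TraceFree G)) :
    limitEnergy cylinder q (load cylinder f) u = ⊤ := by
  rw [limitEnergy, if_pos (h.memW1 le_rfl), lintegral_density_eq_top hq h ht,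
    EReal.coe_ennreal_top, EReal.top_sub_coe, EReal.top_sub_coe]

/-- The limit energy is the minimum over the rotation kernel of energies with rotated loads. -/
theorem exists_limitEnergy_eq (hq : IsModelDensity inc q)
    (hf : ∀ i, MemLp (fun x => f x i) 2 (volume.restrict cylinder))
    (h : IsSobolev (fun i x => u x i) G) (ht : inc → TraceFree G) :
    ∃ R ∈ rotationKernel (load cylinder f),
      limitEnergy cylinder q (load cylinder f) u =
        ((elasticEnergy G - work (fun i x => f x i) R (fun i x => u x i) : ℝ) : EReal) ∧
      ∀ R' ∈ rotationKernel (load cylinder f),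
        work (fun i x => f x i) R' (fun i x => u x i) ≤
          work (fun i x => f x i) R (fun i x => u x i) := by
  have hc : Continuous fun R : Mat3 => load cylinder f (fun x => act (R - 1) (u x)) := by
    simp only [load_act_sub_one hf h.memLp]
    exact (continuous_work _ _).sub continuous_const
  obtain ⟨R, hR, hsup, hmax⟩ := (isCompact_rotationKernel hf).exists_sSup_image_eq_and_ge
    ⟨1, one_mem_rotationKernel f⟩ hc.continuousOn
  refine ⟨R, hR, ?_, fun R' hR' => ?_⟩
  · rw [limitEnergy, if_pos (h.memW1 le_rfl), lintegral_density hq h ht,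
      ofReal_sub_coe (elasticEnergy_nonneg G), hsup, ← EReal.coe_sub,
      load_act_sub_one hf h.memLp]
    congr 1
    ring
  · have := hmax R' hR'
    rw [load_act_sub_one hf h.memLp, load_act_sub_one hf h.memLp] at this
    linarith

/-- The energy gap follows from a trial displacement with a rotated load. -/
theorem hasEnergyGap_of_trial {p : ℝ} (hp2 : p ≤ 2) (hq : IsModelDensity inc q)
    (hf : ∀ i, MemLp (fun x => f x i) 2 (volume.restrict cylinder))
    (hrig : ∀ R ∈ rotationKernel (load cylinder f), ∀ A : Mat3, A.transpose = -A → ∀ b,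
      work (fun i x => f x i) R (affine A b) = 0)
    (htrial : ∃ R ∈ rotationKernel (load cylinder f), ∃ u G, IsSobolev u G ∧
      (inc → TraceFree G) ∧ ∀ u' G', IsSobolev u' G' → (inc → TraceFree G') →
        elasticEnergy G - work (fun i x => f x i) R u <
          elasticEnergy G' - work (fun i x => f x i) 1 u') :
    HasEnergyGap cylinder p q (load cylinder f) := by
  have hp : ENNReal.ofReal p ≤ 2 := by
    have := ENNReal.ofReal_le_ofReal hp2
    simpa using this
  -- Maximizing over rotations inside the energy makes the minimum of the limit energy a joint
  -- minimum over rotation and displacement; the linear energy is the same problem with the single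
  -- rotation `1`.
  obtain ⟨R, hR, v, Gv, hv, htv, hmin⟩ := exists_min hf inc (isCompact_rotationKernel hf)
    ⟨1, one_mem_rotationKernel f⟩ hrig
  obtain ⟨R₁, hR₁, w, Gw, hw, htw, hminw⟩ := exists_min hf inc (isCompact_singleton (x := 1))
    (singleton_nonempty _) (fun R hR => hrig R (hR ▸ one_mem_rotationKernel f))
  rw [mem_singleton_iff] at hR₁
  subst hR₁
  have hv' : IsSobolev (fun i x => (WithLp.toLp 2 fun i => v i x : E3) i) Gv := hv
  have hw' : IsSobolev (fun i x => (WithLp.toLp 2 fun i => w i x : E3) i) Gw := hw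
  refine ⟨elasticEnergy Gv - work (fun i x => f x i) R v,
    elasticEnergy Gw - work (fun i x => f x i) 1 w, ⟨?_, ?_⟩, ⟨?_, ?_⟩, ?_⟩
  · refine ⟨fun x => WithLp.toLp 2 fun i => v i x, hv'.memW1 hp, ?_⟩
    obtain ⟨R', hR', he, hmax⟩ := exists_limitEnergy_eq hq hf hv' htv
    rw [he]
    congr 1
    exact le_antisymm (sub_le_sub_left (hmax R hR) _) (hmin R' hR' _ _ hv htv)
  · rintro _ ⟨u, hu, rfl⟩
    by_cases h2 : MemW1 cylinder 2 u
    · obtain ⟨G, hG⟩ := h2.exists_isSobolev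
      by_cases ht : inc → TraceFree G
      · obtain ⟨R', hR', he, -⟩ := exists_limitEnergy_eq hq hf hG ht
        rw [he, EReal.coe_le_coe_iff]
        exact hmin R' hR' _ _ hG ht
      · rw [limitEnergy_eq_top hq hG ht]
        exact le_top
    · rw [limitEnergy, if_neg h2]
      exact le_top
  · exact ⟨fun x => WithLp.toLp 2 fun i => w i x, hw'.memW1 hp, linearEnergy_eq hq hf hw' htw⟩
  · rintro _ ⟨u, hu, rfl⟩
    by_cases h2 : MemW1 cylinder 2 u
    · obtain ⟨G, hG⟩ := h2.exists_isSobolev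
      by_cases ht : inc → TraceFree G
      · rw [linearEnergy_eq hq hf hG ht, EReal.coe_le_coe_iff]
        exact hminw 1 rfl _ _ hG ht
      · rw [linearEnergy_eq_top hq hG ht]
        exact le_top
    · rw [linearEnergy, if_neg h2]
      exact le_top
  · obtain ⟨R', hR', u, G, hu, ht, hlt⟩ := htrial
    exact (hmin R' hR' u G hu ht).trans_lt (hlt w Gw hw htw)

end Energies

/-! ### Integration by parts for functions vanishing on part of the boundary -/

/-- A smooth transition from `0` to `1` on `[1, 2]`. -/
def step (t : ℝ) : ℝ := Real.smoothTransition (t - 1)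

theorem contDiff_step : ContDiff ℝ 1 step :=
  (Real.smoothTransition.contDiff (n := 1)).comp (contDiff_id.sub contDiff_const)

theorem abs_step_le_one (t : ℝ) : |step t| ≤ 1 := by
  rw [step, abs_of_nonneg (Real.smoothTransition.nonneg _)]
  exact Real.smoothTransition.le_one _

theorem step_of_le_one {t : ℝ} (h : t ≤ 1) : step t = 0 :=
  Real.smoothTransition.zero_of_nonpos (by linarith)

theorem step_of_two_le {t : ℝ} (h : 2 ≤ t) : step t = 1 :=
  Real.smoothTransition.one_of_one_le (by linarith)

theorem deriv_step_of_two_lt {t : ℝ} (h : 2 < t) : deriv step t = 0 := by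
  have : step =ᶠ[𝓝 t] fun _ => 1 := by
    filter_upwards [lt_mem_nhds h] with s hs using step_of_two_le hs.le
  rw [this.deriv_eq, deriv_const]

theorem deriv_step_of_lt_one {t : ℝ} (h : t < 1) : deriv step t = 0 := by
  have : step =ᶠ[𝓝 t] fun _ => 0 := by
    filter_upwards [gt_mem_nhds h] with s hs using step_of_le_one (le_of_lt hs)
  rw [this.deriv_eq, deriv_const]

/-- The scale-invariant form of the bound: with `t = n s` it controls `n s · step'(n s)` uniformly
in `n`, so a function of size `s` compensates the gradient of the cutoff. -/
theorem exists_bound_deriv_step : ∃ K : ℝ, 0 ≤ K ∧ ∀ t, |t * deriv step t| ≤ K := by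
  have hc : Continuous (deriv step) := contDiff_step.continuous_deriv le_rfl
  have hs : HasCompactSupport fun t => t * deriv step t := by
    refine HasCompactSupport.intro (isCompact_Icc (a := (1 : ℝ)) (b := 2)) fun t ht => ?_
    rcases lt_or_ge t 1 with h1 | h1
    · rw [deriv_step_of_lt_one h1, mul_zero]
    · rcases lt_or_ge 2 t with h2 | h2
      · rw [deriv_step_of_two_lt h2, mul_zero]
      · exact absurd ⟨h1, h2⟩ ht
  obtain ⟨K, hK⟩ := hs.exists_bound_of_continuous (continuous_id.mul hc)
  exact ⟨K, (norm_nonneg _).trans (hK 0), hK⟩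

/-- Cutoff functions exhausting the cylinder. -/
def cutoff (n : ℕ) (x : E3) : ℝ := step (n * fa x) * step (n * fb x)

theorem contDiff_cutoff (n : ℕ) : ContDiff ℝ 1 (cutoff n) :=
  (contDiff_step.comp (contDiff_const.mul contDiff_fa)).mul
    (contDiff_step.comp (contDiff_const.mul contDiff_fb))

theorem tsupport_cutoff_subset {n : ℕ} (hn : 0 < n) :
    tsupport (cutoff n) ⊆ slab (1 / (n : ℝ)) := by
  have hn' : (0 : ℝ) < n := Nat.cast_pos.2 hn
  refine closure_minimal (fun x hx => ?_) (isClosed_slab _)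
  by_contra hxs
  refine hx ?_
  rw [cutoff]
  by_cases h1 : 1 / (n : ℝ) ≤ fa x
  · have h2 : fb x < 1 / (n : ℝ) := not_le.1 fun h2 => hxs ⟨h1, h2⟩
    rw [step_of_le_one (t := n * fb x), mul_zero]
    rw [lt_div_iff₀ hn'] at h2
    linarith
  · rw [step_of_le_one (t := n * fa x), zero_mul]
    rw [not_le, lt_div_iff₀ hn'] at h1
    linarith

theorem pd_step_comp {g : E3 → ℝ} (hg : ContDiff ℝ 1 g) (n : ℕ) (k : Fin 3) (x : E3) :
    pd k (fun y => step (n * g y)) x = n * deriv step (n * g x) * pd k g x := by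
  have h1 : HasFDerivAt (fun y => (n : ℝ) * g y) ((n : ℝ) • fderiv ℝ g x) x :=
    (hg.differentiable (by norm_num) x).hasFDerivAt.const_mul _
  have h2 : HasDerivAt step (deriv step (n * g x)) (n * g x) :=
    (contDiff_step.differentiable (by norm_num) _).hasDerivAt
  have h3 := h2.comp_hasFDerivAt x h1
  have h4 : HasFDerivAt (fun y => step (n * g y)) _ x := h3
  rw [pd, h4.fderiv]
  simp [pd]
  ring

theorem pd_cutoff (n : ℕ) (k : Fin 3) (x : E3) : pd k (cutoff n) x =
    n * deriv step (n * fa x) * pd k fa x * step (n * fb x) +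
      step (n * fa x) * (n * deriv step (n * fb x) * pd k fb x) := by
  have ha : ContDiff ℝ 1 fun y => step (n * fa y) :=
    contDiff_step.comp (contDiff_const.mul contDiff_fa)
  have hb : ContDiff ℝ 1 fun y => step (n * fb y) :=
    contDiff_step.comp (contDiff_const.mul contDiff_fb)
  have := pd_mul (ha.differentiable (by norm_num) x) (hb.differentiable (by norm_num) x) k
  rw [pd_step_comp contDiff_fa, pd_step_comp contDiff_fb] at this
  exact this

theorem eventually_two_lt_mul {s : ℝ} (hs : 0 < s) : ∀ᶠ n : ℕ in atTop, 2 < (n : ℝ) * s := by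
  filter_upwards [(tendsto_natCast_atTop_atTop (R := ℝ)).eventually_gt_atTop (2 / s)] with n hn
  rwa [div_lt_iff₀ hs] at hn

theorem eventually_cutoff {x : E3} (hx : x ∈ cylinder) (k : Fin 3) :
    ∀ᶠ n in atTop, cutoff n x = 1 ∧ pd k (cutoff n) x = 0 := by
  obtain ⟨h1, h2⟩ := (mem_cylinder_iff x).1 hx
  filter_upwards [eventually_two_lt_mul h1, eventually_two_lt_mul h2] with n ha hb
  rw [cutoff, pd_cutoff, step_of_two_le ha.le, step_of_two_le hb.le, deriv_step_of_two_lt ha,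
    deriv_step_of_two_lt hb]
  simp

/-- `w` vanishes linearly on the part of the boundary whose normal has a `k`-th component. -/
def VanishesAlong (w : E3 → ℝ) (k : Fin 3) : Prop :=
  ∃ C : ℝ, 0 ≤ C ∧ ∀ x ∈ cylinder, |w x * pd k fa x| ≤ C * fa x ∧ |w x * pd k fb x| ≤ C * fb x

theorem VanishesAlong.exists_bound {w : E3 → ℝ} {k : Fin 3} (h : VanishesAlong w k) :
    ∃ C : ℝ, ∀ n, ∀ x ∈ cylinder, |w x * pd k (cutoff n) x| ≤ C := by
  obtain ⟨K, hK, hd⟩ := exists_bound_deriv_step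
  obtain ⟨C, hC, hw⟩ := h
  refine ⟨C * K + C * K, fun n x hx => ?_⟩
  obtain ⟨h1, h2⟩ := hw x hx
  obtain ⟨p1, p2⟩ := (mem_cylinder_iff x).1 hx
  have hn : (0 : ℝ) ≤ n := Nat.cast_nonneg n
  have key {s d v q : ℝ} (hs : 0 < s) (hq : |q| ≤ 1) (hv : |w x * v| ≤ C * s)
      (hd : |n * s * d| ≤ K) : |w x * v * (n * d) * q| ≤ C * K := by
    rw [abs_mul]
    calc |w x * v * (n * d)| * |q| ≤ |w x * v * (n * d)| * 1 := by gcongr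
      _ = |w x * v| * |n * d| := by rw [mul_one, abs_mul]
      _ ≤ C * s * |n * d| := by gcongr
      _ = C * |n * s * d| := by rw [abs_mul, abs_mul, abs_mul, abs_of_pos hs]; ring
      _ ≤ C * K := by gcongr
  have e : w x * pd k (cutoff n) x =
      w x * pd k fa x * (n * deriv step (n * fa x)) * step (n * fb x) +
        w x * pd k fb x * (n * deriv step (n * fb x)) * step (n * fa x) := by
    rw [pd_cutoff]; ring
  rw [e]
  exact (abs_add_le _ _).trans (add_le_add (key p1 (abs_step_le_one _) h1 (hd _))
    (key p2 (abs_step_le_one _) h2 (hd _)))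

/-- Bounded `C¹` functions on the cylinder with bounded gradient. -/
structure IsBoundedC1 (w : E3 → ℝ) : Prop where
  contDiffOn : ContDiffOn ℝ 1 w cylinder
  bound : ∃ C : ℝ, ∀ x ∈ cylinder, |w x| ≤ C
  bound_pd : ∃ C : ℝ, ∀ k, ∀ x ∈ cylinder, |pd k w x| ≤ C

theorem IsBoundedC1.memLp {w : E3 → ℝ} (hw : IsBoundedC1 w) :
    MemLp w 2 (volume.restrict cylinder) := by
  obtain ⟨C, hC⟩ := hw.bound
  exact memLp_cylinder_of_bound hw.contDiffOn.continuousOn hC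

theorem IsBoundedC1.memLp_pd {w : E3 → ℝ} (hw : IsBoundedC1 w) (k : Fin 3) {p : ℝ≥0∞} :
    MemLp (pd k w) p (volume.restrict cylinder) := by
  obtain ⟨C, hC⟩ := hw.bound_pd
  exact memLp_cylinder_of_bound (continuousOn_pd hw.contDiffOn k) (hC k)

theorem tendsto_integral_mul_eventually {b : E3 → ℝ} (hb : MemLp b 2 (volume.restrict cylinder))
    {g : ℕ → E3 → ℝ} {g₀ : E3 → ℝ} (hg : ∀ n, ContinuousOn (g n) cylinder) {C : ℝ}
    (hC : ∀ᶠ n in atTop, ∀ x ∈ cylinder, |g n x| ≤ C)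
    (hlim : ∀ x ∈ cylinder, ∀ᶠ n in atTop, g n x = g₀ x) :
    Tendsto (fun n => ∫ x in cylinder, b x * g n x) atTop (𝓝 (∫ x in cylinder, b x * g₀ x)) := by
  have hbi : IntegrableOn b cylinder := hb.integrable (by norm_num)
  refine tendsto_integral_filter_of_dominated_convergence (fun x => ‖b x‖ * C)
    (Eventually.of_forall fun n =>
      hb.1.mul ((hg n).aestronglyMeasurable measurableSet_cylinder)) ?_
    (hbi.norm.mul_const C) ?_
  · filter_upwards [hC] with n hn
    rw [ae_restrict_iff' measurableSet_cylinder]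
    refine ae_of_all _ fun x hx => ?_
    rw [norm_mul]
    exact mul_le_mul_of_nonneg_left (hn x hx) (norm_nonneg _)
  · rw [ae_restrict_iff' measurableSet_cylinder]
    refine ae_of_all _ fun x hx => tendsto_const_nhds.congr' ?_
    filter_upwards [hlim x hx] with n hn
    rw [hn]

/-- Testing with `w` times a cutoff: the terms `w ∂ₖ(cutoff)` are bounded uniformly in `n` and
vanish eventually at each point, so they disappear by dominated convergence. Vanishing of `w` is
needed only in the directions in which `b` has a component. -/
theorem IsWeakDiv.integral_eq_of_vanishesAlong {b : Fin 3 → E3 → ℝ} {c : E3 → ℝ}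
    (h : IsWeakDiv (fun k => cylinder.indicator (b k)) (cylinder.indicator c))
    (hb : ∀ k, MemLp (b k) 2 (volume.restrict cylinder))
    (hc : MemLp c 2 (volume.restrict cylinder)) {w : E3 → ℝ} (hw : IsBoundedC1 w)
    (hv : ∀ k, b k = 0 ∨ VanishesAlong w k) :
    (∑ k, ∫ x in cylinder, b k x * pd k w x) + ∫ x in cylinder, c x * w x = 0 := by
  have hzero : ∀ᶠ n in atTop,
      (∑ k, ∫ x in cylinder, b k x * (pd k w x * cutoff n x + w x * pd k (cutoff n) x)) +
        ∫ x in cylinder, c x * (w x * cutoff n x) = 0 := by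
    filter_upwards [eventually_gt_atTop 0] with n hn
    have hs := (tsupport_cutoff_subset hn).trans
      (slab_subset (by positivity : (0 : ℝ) < 1 / (n : ℝ)))
    have hcs : HasCompactSupport (cutoff n) :=
      (isCompact_slab (by positivity : (0 : ℝ) < 1 / (n : ℝ))).of_isClosed_subset
        (isClosed_tsupport _) (tsupport_cutoff_subset hn)
    have := h.integral_eq (fun k => memLp_indicator_cylinder (hb k)) (memLp_indicator_cylinder hc)
      (contDiff_mul_of_tsupport hw.contDiffOn (contDiff_cutoff n) hs) hcs.mul_left
      (tsupport_mul_subset_right.trans hs)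
    simp only [integral_indicator_mul] at this
    rw [← this]
    congr 1
    refine Finset.sum_congr rfl fun k _ =>
      setIntegral_congr_fun measurableSet_cylinder fun x hx => ?_
    rw [pd_mul (differentiableAt_of_contDiffOn hw.contDiffOn hx)
      ((contDiff_cutoff n).differentiable (by norm_num) x)]
  have hcut (n : ℕ) (x : E3) : |cutoff n x| ≤ 1 := by
    rw [cutoff, abs_mul]
    exact mul_le_one₀ (abs_step_le_one _) (abs_nonneg _) (abs_step_le_one _)
  refine tendsto_nhds_unique_of_eventuallyEq (Tendsto.add (tendsto_finsetSum _ fun k _ => ?_) ?_)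
    (tendsto_const_nhds (x := (0 : ℝ)) (f := atTop)) hzero
  · rcases hv k with h0 | hk
    · simp [h0]
    · obtain ⟨C₁, h1⟩ := hk.exists_bound
      obtain ⟨C₂, h2⟩ := hw.bound_pd
      refine tendsto_integral_mul_eventually (hb k) (C := C₂ + C₁) (fun n => ?_)
        (Eventually.of_forall fun n x hx => ?_) fun x hx => ?_
      · exact ((continuousOn_pd hw.contDiffOn k).mul (contDiff_cutoff n).continuous.continuousOn).add
          (hw.contDiffOn.continuousOn.mul (continuous_pd (contDiff_cutoff n) k).continuousOn)
      · refine (abs_add_le _ _).trans (add_le_add ?_ (h1 n x hx))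
        rw [abs_mul]
        exact (mul_le_of_le_one_right (abs_nonneg _) (hcut n x)).trans (h2 k x hx)
      · filter_upwards [eventually_cutoff hx k] with n hn
        rw [hn.1, hn.2]
        ring
  · obtain ⟨C, hC⟩ := hw.bound
    refine tendsto_integral_mul_eventually hc (C := C) (fun n => ?_)
      (Eventually.of_forall fun n x hx => ?_) fun x hx => ?_
    · exact hw.contDiffOn.continuousOn.mul (contDiff_cutoff n).continuous.continuousOn
    · rw [abs_mul]
      exact (mul_le_of_le_one_right (abs_nonneg _) (hcut n x)).trans (hC x hx)
    · filter_upwards [eventually_cutoff hx 0] with n hn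
      rw [hn.1, mul_one]

/-- The Gauss-Green formula for an `H¹` field and a function vanishing on the boundary. -/
theorem IsSobolev.integral_mul_pd {u : Fin 3 → E3 → ℝ} {G : Fin 3 → Fin 3 → E3 → ℝ}
    (h : IsSobolev u G) {w : E3 → ℝ} (hw : IsBoundedC1 w) (i : Fin 3) {j : Fin 3}
    (hj : VanishesAlong w j) :
    ∫ x in cylinder, u i x * pd j w x = -∫ x in cylinder, G i j x * w x := by
  have hd : IsWeakDiv (fun k => cylinder.indicator (if k = j then u i else 0))
      (cylinder.indicator (G i j)) := by
    intro θ hθ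
    have := h.isWeakPd i θ hθ j
    rw [Finset.sum_eq_single j (fun k _ hk => by simp [hk]) (by simp)]
    beta_reduce at this ⊢
    rw [if_pos rfl, this]
    ring
  have := hd.integral_eq_of_vanishesAlong (fun k => by
    split_ifs
    · exact h.memLp i
    · exact MemLp.zero) (h.memLp_grad i j) hw (fun k => by
      by_cases hk : k = j
      · exact Or.inr (hk ▸ hj)
      · exact Or.inl (if_neg hk))
  rw [Finset.sum_eq_single j (fun k _ hk => by simp [hk]) (by simp), if_pos rfl] at this
  linarith

/-- Symmetry of second derivatives, in integrated form. -/
theorem IsSobolev.integral_grad_mul_pd {u : Fin 3 → E3 → ℝ} {G : Fin 3 → Fin 3 → E3 → ℝ}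
    (h : IsSobolev u G) {w : E3 → ℝ} (hw : IsBoundedC1 w) (i : Fin 3) {j k : Fin 3} (hjk : j ≠ k)
    (hj : VanishesAlong w j) (hk : VanishesAlong w k) :
    ∫ x in cylinder, G i j x * pd k w x = ∫ x in cylinder, G i k x * pd j w x := by
  have hsum (F : Fin 3 → (E3 → ℝ) → ℝ) (hF : ∀ l, F l 0 = 0) :
      ∑ l, F l (if l = k then G i j else if l = j then fun x => - G i k x else 0) =
        F k (G i j) + F j (fun x => - G i k x) := by
    rw [← Finset.sum_subset (Finset.subset_univ {k, j}) (fun l _ hl => ?_),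
      Finset.sum_pair hjk.symm, if_pos rfl, if_neg hjk, if_pos rfl]
    simp only [Finset.mem_insert, Finset.mem_singleton, not_or] at hl
    rw [if_neg hl.1, if_neg hl.2, hF]
  -- The field with `G i j` in slot `k` and `-G i k` in slot `j` is divergence free because row `i`
  -- of `G` is curl free.
  have hd : IsWeakDiv (fun l => cylinder.indicator
      (if l = k then G i j else if l = j then fun x => - G i k x else 0))
      (cylinder.indicator 0) := by
    intro θ hθ
    have := (h.isWeakPd i).isCurlFree θ hθ j k
    rw [hsum (fun l g => ∫ x, cylinder.indicator g x * pd l θ x) (by simp), this]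
    simp only [integral_indicator_mul, neg_mul, integral_neg]
    simp
  have := hd.integral_eq_of_vanishesAlong (fun l => by
    split_ifs
    · exact h.memLp_grad i j
    · exact (h.memLp_grad i k).neg
    · exact MemLp.zero) MemLp.zero hw (fun l => by
      by_cases h1 : l = k
      · exact Or.inr (h1 ▸ hk)
      · by_cases h2 : l = j
        · exact Or.inr (h2 ▸ hj)
        · exact Or.inl (by rw [if_neg h1, if_neg h2]))
  rw [hsum (fun l g => ∫ x in cylinder, g x * pd l w x) (by simp)] at this
  simp only [neg_mul, integral_neg, Pi.zero_apply, zero_mul, integral_zero] at this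
  linarith

/-! ### Radial potentials on the disc -/

/-- The open unit disc. -/
abbrev disc : Set E2 := Metric.ball 0 1

theorem smul_mem_disc {y : E2} (hy : y ∈ disc) {t : ℝ} (ht : t ∈ Icc (0 : ℝ) 1) : t • y ∈ disc := by
  rw [mem_ball_zero_iff] at hy ⊢
  rw [norm_smul, Real.norm_eq_abs, abs_of_nonneg ht.1]
  exact (mul_le_of_le_one_left (norm_nonneg _) ht.2).trans_lt hy

theorem smul_mem_closedDisc {y : E2} (hy : y ∈ Metric.closedBall (0 : E2) 1) {t : ℝ}
    (ht : t ∈ Icc (0 : ℝ) 1) : t • y ∈ Metric.closedBall (0 : E2) 1 := by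
  rw [mem_closedBall_zero_iff] at hy ⊢
  rw [norm_smul, Real.norm_eq_abs, abs_of_nonneg ht.1]
  exact (mul_le_of_le_one_left (norm_nonneg _) ht.2).trans hy

/-- Partial derivatives in the plane. -/
def pd2 (k : Fin 2) (f : E2 → ℝ) (y : E2) : ℝ := fderiv ℝ f y (EuclideanSpace.single k 1)

theorem fderiv_apply_eq_pd2 (f : E2 → ℝ) (y v : E2) :
    fderiv ℝ f y v = v 0 * pd2 0 f y + v 1 * pd2 1 f y := by
  have : v = v 0 • EuclideanSpace.single 0 1 + v 1 • EuclideanSpace.single 1 1 := by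
    ext i
    fin_cases i <;> simp
  conv_lhs => rw [this]
  rw [map_add, map_smul, map_smul, pd2, pd2, smul_eq_mul, smul_eq_mul]

/-- The gradient of a radial function is radial. -/
theorem mul_pd2_eq_of_radial {f : E2 → ℝ} {y : E2} (hf : DifferentiableAt ℝ f y)
    (hr : ∀ z, ‖z‖ = ‖y‖ → f z = f y) : y 0 * pd2 1 f y = y 1 * pd2 0 f y := by
  -- The circle through `y`: the function is constant along it, so its tangential derivative at `y`
  -- vanishes.
  set γ : ℝ → E2 := fun t => Real.cos t • y + Real.sin t • !₂[-y 1, y 0] with hγ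
  have hγ0 : γ 0 = y := by simp [hγ]
  have hn (t : ℝ) : ‖γ t‖ = ‖y‖ := by
    have h2 : ‖γ t‖ ^ 2 = ‖y‖ ^ 2 := by
      rw [norm_sq_E2, norm_sq_E2]
      simp only [hγ, PiLp.add_apply, PiLp.smul_apply, smul_eq_mul]
      change (Real.cos t * y 0 + Real.sin t * (-y 1)) ^ 2 +
        (Real.cos t * y 1 + Real.sin t * y 0) ^ 2 = _
      have := Real.sin_sq_add_cos_sq t
      linear_combination (y 0 ^ 2 + y 1 ^ 2) * this
    exact (pow_left_inj₀ (norm_nonneg _) (norm_nonneg _) two_ne_zero).1 h2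
  have hd : HasDerivAt γ !₂[-y 1, y 0] 0 := by
    have := ((Real.hasDerivAt_cos 0).smul_const y).fun_add
      ((Real.hasDerivAt_sin 0).smul_const (!₂[-y 1, y 0] : E2))
    refine this.congr_deriv ?_
    simp
  have h1 : HasDerivAt (f ∘ γ) (fderiv ℝ f y !₂[-y 1, y 0]) 0 := by
    have hf' : HasFDerivAt f (fderiv ℝ f y) (γ 0) := by rw [hγ0]; exact hf.hasFDerivAt
    exact hf'.comp_hasDerivAt 0 hd
  have h2 : f ∘ γ = fun _ => f y := funext fun t => hr _ (hn t)
  rw [h2] at h1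
  have h3 := h1.unique (hasDerivAt_const 0 (f y))
  rw [fderiv_apply_eq_pd2] at h3
  change -y 1 * pd2 0 f y + y 0 * pd2 1 f y = 0 at h3
  linarith

section Potential

variable {φ : E2 → ℝ} {Φ : ℝ → ℝ}

theorem IsHorizontalPotential.exists_lipschitz (h : IsHorizontalPotential φ Φ) :
    ∃ M : ℝ, 0 ≤ M ∧ (∀ y ∈ Metric.closedBall (0 : E2) 1, ∀ z ∈ Metric.closedBall (0 : E2) 1,
      |φ y - φ z| ≤ M * ‖y - z‖) ∧ ∀ y ∈ disc, ‖fderiv ℝ φ y‖ ≤ M := by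
  have hu : UniqueDiffOn ℝ (Metric.closedBall (0 : E2) 1) :=
    uniqueDiffOn_convex (convex_closedBall _ _)
      ⟨0, Metric.ball_subset_interior_closedBall (Metric.mem_ball_self one_pos)⟩
  have hc := h.contDiffOn.continuousOn_fderivWithin hu (by norm_num)
  obtain ⟨M, hM⟩ := (isCompact_closedBall (0 : E2) 1).exists_bound_of_continuousOn hc
  refine ⟨M, (norm_nonneg _).trans (hM 0 (Metric.mem_closedBall_self zero_le_one)),
    fun y hy z hz => ?_, fun y hy => ?_⟩
  · exact (convex_closedBall (0 : E2) 1).norm_image_sub_le_of_norm_fderivWithin_le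
      (h.contDiffOn.differentiableOn (by norm_num)) hM hz hy
  · have := hM y (Metric.ball_subset_closedBall hy)
    rwa [fderivWithin_of_mem_nhds (Metric.closedBall_mem_nhds_of_mem hy)] at this

theorem IsHorizontalPotential.contDiffOn_disc (h : IsHorizontalPotential φ Φ) :
    ContDiffOn ℝ 1 φ disc :=
  (h.contDiffOn.of_le (by norm_num)).mono Metric.ball_subset_closedBall

theorem IsHorizontalPotential.hasFDerivAt (h : IsHorizontalPotential φ Φ) {y : E2}
    (hy : y ∈ disc) : HasFDerivAt φ (fderiv ℝ φ y) y :=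
  ((h.contDiffOn_disc.contDiffAt (Metric.isOpen_ball.mem_nhds hy)).differentiableAt
    (by norm_num)).hasFDerivAt

theorem IsHorizontalPotential.continuousOn_fderiv (h : IsHorizontalPotential φ Φ) :
    ContinuousOn (fderiv ℝ φ) disc :=
  h.contDiffOn_disc.continuousOn_fderiv_of_isOpen Metric.isOpen_ball le_rfl

theorem exists_unit_near {y : E2} (hy : y ∈ disc) : ∃ e : E2, ‖e‖ = 1 ∧ ‖y - e‖ = 1 - ‖y‖ := by
  rw [mem_ball_zero_iff] at hy
  by_cases h0 : y = 0
  · exact ⟨EuclideanSpace.single 0 1, by simp, by simp [h0]⟩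
  · have hn : 0 < ‖y‖ := norm_pos_iff.2 h0
    refine ⟨‖y‖⁻¹ • y, ?_, ?_⟩
    · rw [norm_smul, norm_inv, norm_norm, inv_mul_cancel₀ hn.ne']
    · have : y - ‖y‖⁻¹ • y = (1 - ‖y‖⁻¹) • y := by rw [sub_smul, one_smul]
      rw [this, norm_smul, Real.norm_eq_abs, abs_of_nonpos (by
        rw [sub_nonpos]
        exact (one_le_inv₀ hn).2 hy.le)]
      field_simp
      ring

/-- By `Φ 1 = 0` the function vanishes on the unit circle, and it is Lipschitz up to the boundary.
-/
theorem IsHorizontalPotential.abs_le (h : IsHorizontalPotential φ Φ) :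
    ∃ M : ℝ, 0 ≤ M ∧ ∀ y ∈ disc, |φ y| ≤ M * (1 - ‖y‖) := by
  obtain ⟨M, hM, hl, -⟩ := h.exists_lipschitz
  refine ⟨M, hM, fun y hy => ?_⟩
  obtain ⟨e, he, hye⟩ := exists_unit_near hy
  have he' : e ∈ Metric.closedBall (0 : E2) 1 := by simp [he]
  have h0 : φ e = 0 := by rw [h.radial e he', he, h.profile_one]
  have := hl y (Metric.ball_subset_closedBall hy) e he'
  rwa [h0, sub_zero, hye] at this

/-- The radial profile has vanishing first moment. -/
theorem IsHorizontalPotential.integral_profile (h : IsHorizontalPotential φ Φ) :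
    ∫ t in (0 : ℝ)..1, t * Φ t = 0 := by
  set e : E2 := EuclideanSpace.single 0 1 with he
  have hne : ‖e‖ = 1 := by simp [he]
  have hmem : ∀ t ∈ Icc (0 : ℝ) 1, t • e ∈ Metric.closedBall (0 : E2) 1 := fun t ht =>
    smul_mem_closedDisc (by simp [hne]) ht
  have hΦ : ContDiffOn ℝ 1 Φ (Icc 0 1) := by
    have h1 : ContDiffOn ℝ 1 (fun t : ℝ => φ (t • e)) (Icc 0 1) :=
      (h.contDiffOn.of_le (by norm_num)).comp (contDiff_id.smul contDiff_const).contDiffOn hmem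
    refine h1.congr fun t ht => ?_
    rw [h.radial _ (hmem t ht), norm_smul, hne, mul_one, Real.norm_eq_abs, abs_of_nonneg ht.1]
  have hd : ContinuousOn (derivWithin Φ (Icc 0 1)) (Icc 0 1) :=
    hΦ.continuousOn_derivWithin (uniqueDiffOn_Icc one_pos) le_rfl
  have c1 : ContinuousOn (fun t => t * Φ t) (Icc 0 1) := continuousOn_id.mul hΦ.continuousOn
  have c2 : ContinuousOn (fun t => t ^ 2 * derivWithin Φ (Icc 0 1) t) (Icc 0 1) :=
    (continuousOn_id.pow 2).mul hd
  have i1 : IntervalIntegrable (fun t => 2 * (t * Φ t)) volume 0 1 :=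
    (ContinuousOn.intervalIntegrable_of_Icc zero_le_one c1).const_mul 2
  have i2 := ContinuousOn.intervalIntegrable_of_Icc zero_le_one c2 (μ := volume)
  -- Integrating the derivative of `t² Φ(t)`: the endpoint values vanish by `Φ 1 = 0`, and the term
  -- with `Φ'` by the moment condition.
  have := intervalIntegral.integral_eq_sub_of_hasDerivAt_of_le (f := fun t => t ^ 2 * Φ t)
    (f' := fun t => 2 * (t * Φ t) + t ^ 2 * derivWithin Φ (Icc 0 1) t) zero_le_one
    ((continuousOn_id.pow 2).mul hΦ.continuousOn) (fun t ht => ?_) (i1.add i2)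
  · rw [intervalIntegral.integral_add i1 i2, h.moment, intervalIntegral.integral_const_mul,
      h.profile_one] at this
    norm_num at this
    exact this
  · have h1 : HasDerivAt Φ (derivWithin Φ (Icc 0 1) t) t :=
      ((hΦ.differentiableOn (by norm_num) t (Ioo_subset_Icc_self ht)).hasDerivWithinAt).hasDerivAt
        (Icc_mem_nhds ht.1 ht.2)
    have h2 := (hasDerivAt_pow 2 t).mul h1
    refine h2.congr_deriv ?_
    simp
    ring

/-- The radial function `a` with `2 a + y · ∇a = -φ / 8`. -/
def radialPot (φ : E2 → ℝ) (y : E2) : ℝ := -(1 / 8) * ∫ t in (0 : ℝ)..1, t * φ (t • y)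

theorem IsHorizontalPotential.intervalIntegrable (h : IsHorizontalPotential φ Φ) {y : E2}
    (hy : y ∈ Metric.closedBall (0 : E2) 1) :
    IntervalIntegrable (fun t => t * φ (t • y)) volume 0 1 := by
  refine ContinuousOn.intervalIntegrable_of_Icc zero_le_one (continuousOn_id.mul ?_)
  exact h.contDiffOn.continuousOn.comp (by fun_prop) fun t ht => smul_mem_closedDisc hy ht

/-- On the unit circle the integral defining the potential is the first moment of `Φ`, which is
zero; the Lipschitz bound for `φ` does the rest. This is where the moment condition gives zero
lateral boundary values. -/
theorem IsHorizontalPotential.abs_radialPot_le (h : IsHorizontalPotential φ Φ) :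
    ∃ M : ℝ, 0 ≤ M ∧ ∀ y ∈ disc, |radialPot φ y| ≤ M * (1 - ‖y‖) := by
  obtain ⟨M, hM, hl, -⟩ := h.exists_lipschitz
  refine ⟨M, hM, fun y hy => ?_⟩
  obtain ⟨e, he, hye⟩ := exists_unit_near hy
  have hy' := Metric.ball_subset_closedBall hy
  have he' : e ∈ Metric.closedBall (0 : E2) 1 := by simp [he]
  have h0 : ∫ t in (0 : ℝ)..1, t * φ (t • e) = 0 := by
    refine Eq.trans ?_ h.integral_profile
    refine intervalIntegral.integral_congr fun t ht => ?_
    rw [uIcc_of_le zero_le_one] at ht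
    beta_reduce
    rw [h.radial _ (smul_mem_closedDisc he' ht), norm_smul, he, mul_one, Real.norm_eq_abs,
      abs_of_nonneg ht.1]
  have e1 : radialPot φ y = -(1 / 8) * ∫ t in (0 : ℝ)..1, (t * φ (t • y) - t * φ (t • e)) := by
    rw [intervalIntegral.integral_sub (h.intervalIntegrable hy') (h.intervalIntegrable he'), h0,
      sub_zero, radialPot]
  have hb : ‖∫ t in (0 : ℝ)..1, (t * φ (t • y) - t * φ (t • e))‖ ≤ M * (1 - ‖y‖) * |1 - 0| := by
    refine intervalIntegral.norm_integral_le_of_norm_le_const fun t ht => ?_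
    rw [uIoc_of_le zero_le_one] at ht
    have ht' : t ∈ Icc (0 : ℝ) 1 := ⟨ht.1.le, ht.2⟩
    have := hl _ (smul_mem_closedDisc hy' ht') _ (smul_mem_closedDisc he' ht')
    rw [← smul_sub, norm_smul, hye, Real.norm_eq_abs, abs_of_pos ht.1] at this
    have hy1 : 0 ≤ 1 - ‖y‖ := by rw [← hye]; exact norm_nonneg _
    rw [← mul_sub, norm_mul, Real.norm_eq_abs, Real.norm_eq_abs, abs_of_pos ht.1]
    calc t * |φ (t • y) - φ (t • e)| ≤ 1 * (M * (1 * (1 - ‖y‖))) := by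
          refine mul_le_mul ht.2 (this.trans ?_) (abs_nonneg _) zero_le_one
          gcongr
          exact ht.2
      _ = M * (1 - ‖y‖) := by ring
  rw [e1, abs_mul]
  rw [Real.norm_eq_abs, sub_zero, abs_one, mul_one] at hb
  have : |(-(1 / 8) : ℝ)| = 1 / 8 := by norm_num [abs_of_neg]
  rw [this]
  have := abs_nonneg (∫ t in (0 : ℝ)..1, (t * φ (t • y) - t * φ (t • e)))
  linarith

theorem IsHorizontalPotential.continuousOn_sq_smul_fderiv (h : IsHorizontalPotential φ Φ) {y : E2}
    (hy : y ∈ disc) : ContinuousOn (fun t : ℝ => t ^ 2 • fderiv ℝ φ (t • y)) (Icc 0 1) :=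
  (continuousOn_id.pow 2).smul (h.continuousOn_fderiv.comp (by fun_prop)
    fun t ht => smul_mem_disc hy ht)

theorem aestronglyMeasurable_uIoc_of_continuousOn {F : Type*} [NormedAddCommGroup F] {g : ℝ → F}
    (hg : ContinuousOn g (Icc 0 1)) :
    AEStronglyMeasurable g (volume.restrict (uIoc (0 : ℝ) 1)) := by
  rw [uIoc_of_le zero_le_one]
  exact (hg.mono Ioc_subset_Icc_self).aestronglyMeasurable measurableSet_Ioc

theorem IsHorizontalPotential.norm_sq_smul_fderiv_le {M : ℝ} (hM : ∀ y ∈ disc, ‖fderiv ℝ φ y‖ ≤ M)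
    {y : E2} (hy : y ∈ disc) {t : ℝ} (ht : t ∈ uIoc (0 : ℝ) 1) :
    ‖t ^ 2 • fderiv ℝ φ (t • y)‖ ≤ M := by
  rw [uIoc_of_le zero_le_one] at ht
  rw [norm_smul, norm_pow, Real.norm_eq_abs, abs_of_pos ht.1]
  calc t ^ 2 * ‖fderiv ℝ φ (t • y)‖ ≤ 1 * M :=
        mul_le_mul (pow_le_one₀ ht.1.le ht.2) (hM _ (smul_mem_disc hy ⟨ht.1.le, ht.2⟩))
          (norm_nonneg _) zero_le_one
    _ = M := one_mul M

theorem IsHorizontalPotential.hasFDerivAt_radialPot (h : IsHorizontalPotential φ Φ) {y : E2}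
    (hy : y ∈ disc) : HasFDerivAt (radialPot φ)
      ((-(1 / 8) : ℝ) • ∫ t in (0 : ℝ)..1, t ^ 2 • fderiv ℝ φ (t • y)) y := by
  obtain ⟨M, -, -, hd⟩ := h.exists_lipschitz
  have := intervalIntegral.hasFDerivAt_integral_of_dominated_of_fderiv_le
    (F := fun (y : E2) (t : ℝ) => t * φ (t • y)) (F' := fun y t => t ^ 2 • fderiv ℝ φ (t • y))
    (μ := volume) (a := 0) (b := 1) (bound := fun _ => M) (Metric.isOpen_ball.mem_nhds hy) ?_
    (h.intervalIntegrable (Metric.ball_subset_closedBall hy))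
    (aestronglyMeasurable_uIoc_of_continuousOn (h.continuousOn_sq_smul_fderiv hy))
    (ae_of_all _ fun t ht z hz => IsHorizontalPotential.norm_sq_smul_fderiv_le hd hz ht)
    intervalIntegrable_const (ae_of_all _ fun t ht z hz => ?_)
  · exact this.const_mul _
  · filter_upwards [Metric.isOpen_ball.mem_nhds hy] with z hz
    refine aestronglyMeasurable_uIoc_of_continuousOn (continuousOn_id.mul ?_)
    exact h.contDiffOn.continuousOn.comp (by fun_prop) fun t ht =>
      smul_mem_closedDisc (Metric.ball_subset_closedBall hz) ht
  · rw [uIoc_of_le zero_le_one] at ht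
    have h1 : HasFDerivAt (fun z : E2 => t • z) (t • ContinuousLinearMap.id ℝ E2) z :=
      (hasFDerivAt_id z).const_smul t
    have h2 := ((h.hasFDerivAt (smul_mem_disc hz ⟨ht.1.le, ht.2⟩)).comp z h1).const_mul t
    refine h2.congr_fderiv ?_
    ext v
    simp
    ring

theorem IsHorizontalPotential.contDiffOn_radialPot (h : IsHorizontalPotential φ Φ) :
    ContDiffOn ℝ 1 (radialPot φ) disc := by
  obtain ⟨M, -, -, hd⟩ := h.exists_lipschitz
  rw [show (1 : WithTop ℕ∞) = 0 + 1 from rfl,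
    contDiffOn_succ_iff_fderiv_of_isOpen Metric.isOpen_ball, contDiffOn_zero]
  refine ⟨fun y hy => (h.hasFDerivAt_radialPot hy).differentiableAt.differentiableWithinAt,
    by simp, ContinuousOn.congr (f := fun y => (-(1 / 8) : ℝ) •
      ∫ t in (0 : ℝ)..1, t ^ 2 • fderiv ℝ φ (t • y)) ?_
      fun y hy => (h.hasFDerivAt_radialPot hy).fderiv⟩
  suffices hs : ContinuousOn (fun y => ∫ t in (0 : ℝ)..1, t ^ 2 • fderiv ℝ φ (t • y)) disc from
    hs.fun_const_smul _
  intro y hy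
  refine ContinuousAt.continuousWithinAt ?_
  refine intervalIntegral.continuousAt_of_dominated_interval (bound := fun _ => M) ?_ ?_
    intervalIntegrable_const (ae_of_all _ fun t ht => ?_)
  · filter_upwards [Metric.isOpen_ball.mem_nhds hy] with z hz
    exact aestronglyMeasurable_uIoc_of_continuousOn (h.continuousOn_sq_smul_fderiv hz)
  · filter_upwards [Metric.isOpen_ball.mem_nhds hy] with z hz
    exact ae_of_all _ fun t ht => IsHorizontalPotential.norm_sq_smul_fderiv_le hd hz ht
  · rw [uIoc_of_le zero_le_one] at ht
    have h1 := h.continuousOn_fderiv.continuousAt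
      (Metric.isOpen_ball.mem_nhds (smul_mem_disc hy ⟨ht.1.le, ht.2⟩))
    exact (ContinuousAt.comp (f := fun z : E2 => t • z) h1 (by fun_prop)).const_smul (t ^ 2)

theorem IsHorizontalPotential.norm_fderiv_radialPot_le (h : IsHorizontalPotential φ Φ) :
    ∃ M : ℝ, ∀ y ∈ disc, ‖fderiv ℝ (radialPot φ) y‖ ≤ M := by
  obtain ⟨M, -, -, hd⟩ := h.exists_lipschitz
  refine ⟨M, fun y hy => ?_⟩
  rw [(h.hasFDerivAt_radialPot hy).fderiv, norm_smul]
  have := intervalIntegral.norm_integral_le_of_norm_le_const fun t ht =>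
    IsHorizontalPotential.norm_sq_smul_fderiv_le hd hy ht
  rw [sub_zero, abs_one, mul_one] at this
  have h8 : ‖(-(1 / 8) : ℝ)‖ = 1 / 8 := by norm_num
  rw [h8]
  have := norm_nonneg (∫ t in (0 : ℝ)..1, t ^ 2 • fderiv ℝ φ (t • y))
  linarith

theorem IsHorizontalPotential.radialPot_eq (h : IsHorizontalPotential φ Φ) {y z : E2}
    (hy : y ∈ disc) (hz : ‖z‖ = ‖y‖) : radialPot φ z = radialPot φ y := by
  have hz' : z ∈ disc := by rw [mem_ball_zero_iff, hz]; exact mem_ball_zero_iff.1 hy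
  rw [radialPot, radialPot]
  congr 1
  refine intervalIntegral.integral_congr fun t ht => ?_
  rw [uIcc_of_le zero_le_one] at ht
  beta_reduce
  rw [h.radial _ (smul_mem_closedDisc (Metric.ball_subset_closedBall hy) ht),
    h.radial _ (smul_mem_closedDisc (Metric.ball_subset_closedBall hz') ht), norm_smul, norm_smul,
    hz]

/-- The integral over `[0, 1]` of the derivative of `t² φ(t y)`. The left side is the divergence of
the field `a(y) y`. -/
theorem IsHorizontalPotential.euler_radialPot (h : IsHorizontalPotential φ Φ) {y : E2}
    (hy : y ∈ disc) :
    2 * radialPot φ y + (y 0 * pd2 0 (radialPot φ) y + y 1 * pd2 1 (radialPot φ) y) =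
      -φ y / 8 := by
  have hc := h.continuousOn_sq_smul_fderiv hy
  have i0 : IntervalIntegrable (fun t : ℝ => t ^ 2 • fderiv ℝ φ (t • y)) volume 0 1 :=
    ContinuousOn.intervalIntegrable_of_Icc zero_le_one hc
  have i1 : IntervalIntegrable (fun t => 2 * (t * φ (t • y))) volume 0 1 :=
    (h.intervalIntegrable (Metric.ball_subset_closedBall hy)).const_mul 2
  have i2 : IntervalIntegrable (fun t : ℝ => (t ^ 2 • fderiv ℝ φ (t • y)) y) volume 0 1 :=
    ContinuousOn.intervalIntegrable_of_Icc zero_le_one (hc.clm_apply continuousOn_const)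
  have hF := intervalIntegral.integral_eq_sub_of_hasDerivAt (f := fun t : ℝ => t ^ 2 * φ (t • y))
    (f' := fun t => 2 * (t * φ (t • y)) + (t ^ 2 • fderiv ℝ φ (t • y)) y) (a := 0) (b := 1)
    (fun t ht => ?_) (i1.add i2)
  · rw [intervalIntegral.integral_add i1 i2, intervalIntegral.integral_const_mul] at hF
    rw [← fderiv_apply_eq_pd2, (h.hasFDerivAt_radialPot hy).fderiv, smul_apply,
      ContinuousLinearMap.intervalIntegral_apply i0, radialPot, smul_eq_mul]
    norm_num at hF ⊢
    linarith
  · rw [uIcc_of_le zero_le_one] at ht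
    have h1 : HasDerivAt (fun t : ℝ => t • y) y t := by
      simpa using (hasDerivAt_id t).smul_const y
    have h2 := (h.hasFDerivAt (smul_mem_disc hy ht)).comp_hasDerivAt t h1
    refine ((hasDerivAt_pow 2 t).mul h2).congr_deriv ?_
    simp
    ring

theorem IsHorizontalPotential.mul_pd2_radialPot (h : IsHorizontalPotential φ Φ) {y : E2}
    (hy : y ∈ disc) : y 0 * pd2 1 (radialPot φ) y = y 1 * pd2 0 (radialPot φ) y :=
  mul_pd2_eq_of_radial (h.hasFDerivAt_radialPot hy).differentiableAt
    fun _ hz => h.radialPot_eq hy hz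

end Potential

/-! ### The potentials of the loads on the cylinder -/

theorem pd_coord (j k : Fin 3) (x : E3) : pd k (fun x => x j) x = if j = k then 1 else 0 := by
  rw [pd, (hasFDerivAt_coord j x).fderiv]
  simp [PiLp.single_apply]

theorem isBoundedC1_coord (j : Fin 3) : IsBoundedC1 fun x => x j := by
  refine ⟨by fun_prop, ⟨2, fun x hx => (abs_coord_lt_two hx j).le⟩, 1, fun k x _ => ?_⟩
  rw [pd_coord]
  split_ifs <;> simp

theorem IsBoundedC1.mul {v w : E3 → ℝ} (hv : IsBoundedC1 v) (hw : IsBoundedC1 w) :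
    IsBoundedC1 fun x => v x * w x := by
  obtain ⟨A, hA⟩ := hv.bound
  obtain ⟨A', hA'⟩ := hv.bound_pd
  obtain ⟨B, hB⟩ := hw.bound
  obtain ⟨B', hB'⟩ := hw.bound_pd
  have key {a b c d : ℝ} (h1 : |a| ≤ c) (h2 : |b| ≤ d) : |a * b| ≤ c * d := by
    rw [abs_mul]
    exact mul_le_mul h1 h2 (abs_nonneg _) ((abs_nonneg _).trans h1)
  refine ⟨hv.contDiffOn.mul hw.contDiffOn, ⟨A * B, fun x hx => key (hA x hx) (hB x hx)⟩,
    A' * B + A * B', fun k x hx => ?_⟩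
  rw [pd_mul (differentiableAt_of_contDiffOn hv.contDiffOn hx)
    (differentiableAt_of_contDiffOn hw.contDiffOn hx)]
  exact (abs_add_le _ _).trans (add_le_add (key (hA' k x hx) (hB x hx)) (key (hA x hx) (hB' k x hx)))

theorem IsBoundedC1.const_mul {w : E3 → ℝ} (hw : IsBoundedC1 w) (c : ℝ) :
    IsBoundedC1 fun x => c * w x := by
  refine IsBoundedC1.mul ⟨contDiffOn_const, ⟨|c|, fun _ _ => le_rfl⟩, 0, fun k x _ => ?_⟩ hw
  simp [pd]

theorem IsBoundedC1.pd_const_mul {w : E3 → ℝ} (hw : IsBoundedC1 w) (c : ℝ) {x : E3}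
    (hx : x ∈ cylinder) (k : Fin 3) : pd k (fun x => c * w x) x = c * pd k w x := by
  rw [pd, fderiv_const_mul (differentiableAt_of_contDiffOn hw.contDiffOn hx), smul_apply, pd,
    smul_eq_mul]

/-- A bounded `C¹` field is in `H¹`. -/
theorem isSobolev_of_isBoundedC1 {u : Fin 3 → E3 → ℝ} (hu : ∀ i, IsBoundedC1 (u i)) :
    IsSobolev u fun i j => pd j (u i) := by
  choose A hA using fun i => (hu i).bound
  choose B hB using fun i => (hu i).bound_pd
  have hle (f : Fin 3 → ℝ) (i : Fin 3) : f i ≤ ∑ i, |f i| :=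
    (le_abs_self _).trans (Finset.single_le_sum (f := fun i => |f i|) (fun i _ => abs_nonneg _)
      (Finset.mem_univ i))
  have h0 (f : Fin 3 → ℝ) : 0 ≤ ∑ i, |f i| := Finset.sum_nonneg fun i _ => abs_nonneg _
  refine IsSobolev.of_contDiffOn (C := (∑ i, |A i|) + ∑ i, |B i|) (fun i => (hu i).contDiffOn)
    (fun i j x hx => rfl) (fun i x hx => ?_) (fun i j x hx => ?_)
  · linarith [hA i x hx, hle A i, h0 B]
  · linarith [hB i j x hx, hle B i, h0 A]

theorem VanishesAlong.of_le_fa {w : E3 → ℝ} {C : ℝ} (hC : 0 ≤ C)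
    (hw : ∀ x ∈ cylinder, |w x| ≤ C * fa x) {k : Fin 3} (hk : k ≠ 2) : VanishesAlong w k := by
  refine ⟨C * 4, by positivity, fun x hx => ⟨?_, ?_⟩⟩
  · have h1 := hw x hx
    have h2 : |pd k fa x| ≤ 4 := by
      have h0 := abs_coord_lt_two hx 0
      have h1 := abs_coord_lt_two hx 1
      rw [pd_fa]
      fin_cases k
      · change |-2 * x 0| ≤ 4
        rw [abs_mul]
        norm_num
        linarith
      · change |-2 * x 1| ≤ 4
        rw [abs_mul]
        norm_num
        linarith
      · exact absurd rfl hk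
    rw [abs_mul]
    have hfa := ((mem_cylinder_iff x).1 hx).1
    calc |w x| * |pd k fa x| ≤ C * fa x * 4 :=
          mul_le_mul h1 h2 (abs_nonneg _) (mul_nonneg hC hfa.le)
      _ = C * 4 * fa x := by ring
  · have hfb := ((mem_cylinder_iff x).1 hx).2
    have : pd k fb x = 0 := by
      rw [pd_fb]
      fin_cases k
      · rfl
      · rfl
      · exact absurd rfl hk
    rw [this, mul_zero, abs_zero]
    positivity

theorem VanishesAlong.of_le_fb {w : E3 → ℝ} {C : ℝ} (hC : 0 ≤ C)
    (hw : ∀ x ∈ cylinder, |w x| ≤ C * fb x) : VanishesAlong w 2 := by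
  refine ⟨C * 4, by positivity, fun x hx => ⟨?_, ?_⟩⟩
  · have hfa := ((mem_cylinder_iff x).1 hx).1
    have : pd 2 fa x = 0 := by rw [pd_fa]; rfl
    rw [this, mul_zero, abs_zero]
    positivity
  · have h1 := hw x hx
    have h2 : |pd 2 fb x| ≤ 4 := by
      rw [pd_fb]
      change |-8 * (x 2 - 1 / 2)| ≤ 4
      obtain ⟨-, h3, h4⟩ := hx
      rw [abs_le]
      constructor <;> linarith
    rw [abs_mul]
    have hfb := ((mem_cylinder_iff x).1 hx).2
    calc |w x| * |pd 2 fb x| ≤ C * fb x * 4 :=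
          mul_le_mul h1 h2 (abs_nonneg _) (mul_nonneg hC hfb.le)
      _ = C * 4 * fb x := by ring

/-- The horizontal projection. -/
def horiz : E3 →L[ℝ] E2 :=
  LinearMap.toContinuousLinearMap
    { toFun := fun x => !₂[x 0, x 1]
      map_add' := fun x y => by ext i; fin_cases i <;> simp
      map_smul' := fun c x => by ext i; fin_cases i <;> simp }

theorem horiz_apply (x : E3) : horiz x = !₂[x 0, x 1] := rfl

theorem norm_sq_horiz (x : E3) : ‖horiz x‖ ^ 2 = x 0 ^ 2 + x 1 ^ 2 := by
  rw [norm_sq_E2]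
  rfl

theorem horiz_mem_disc {x : E3} (hx : x ∈ cylinder) : horiz x ∈ disc := by
  rw [mem_ball_zero_iff]
  have h1 := norm_sq_horiz x
  have h2 := hx.1
  nlinarith [norm_nonneg (horiz x)]

theorem one_sub_norm_horiz_le {x : E3} (hx : x ∈ cylinder) : 1 - ‖horiz x‖ ≤ fa x := by
  have h1 := norm_sq_horiz x
  have h2 := mem_ball_zero_iff.1 (horiz_mem_disc hx)
  rw [fa]
  nlinarith [norm_nonneg (horiz x)]

theorem pd_comp_horiz {f : E2 → ℝ} {x : E3} (hf : DifferentiableAt ℝ f (horiz x)) (k : Fin 3) :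
    pd k (fun x => f (horiz x)) x = ![pd2 0 f (horiz x), pd2 1 f (horiz x), 0] k := by
  have h : HasFDerivAt (fun x => f (horiz x)) ((fderiv ℝ f (horiz x)).comp horiz) x :=
    hf.hasFDerivAt.comp x horiz.hasFDerivAt
  rw [pd, h.fderiv, ContinuousLinearMap.comp_apply, fderiv_apply_eq_pd2, horiz_apply]
  fin_cases k <;> simp

theorem isBoundedC1_comp_horiz {f : E2 → ℝ} (hf : ContDiffOn ℝ 1 f disc) {A B : ℝ}
    (hA : ∀ y ∈ disc, |f y| ≤ A) (hB : ∀ y ∈ disc, ‖fderiv ℝ f y‖ ≤ B) :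
    IsBoundedC1 fun x => f (horiz x) := by
  refine ⟨hf.comp horiz.contDiff.contDiffOn fun x hx => horiz_mem_disc hx,
    ⟨A, fun x hx => hA _ (horiz_mem_disc hx)⟩, B, fun k x hx => ?_⟩
  have hd := horiz_mem_disc hx
  have hb (j : Fin 2) : |pd2 j f (horiz x)| ≤ B := by
    refine ((fderiv ℝ f (horiz x)).le_opNorm _).trans ?_
    simpa using hB _ hd
  rw [pd_comp_horiz ((hf.contDiffAt (Metric.isOpen_ball.mem_nhds hd)).differentiableAt
    (by norm_num))]
  fin_cases k
  · exact hb 0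
  · exact hb 1
  · change |(0 : ℝ)| ≤ B
    rw [abs_zero]
    exact (abs_nonneg _).trans (hb 0)

/-! ### Functions of the height alone. -/

theorem pd_comp_vertical {g : ℝ → ℝ} {x : E3} {g' : ℝ} (hg : HasDerivAt g g' (x 2)) (k : Fin 3) :
    pd k (fun x => g (x 2)) x = ![0, 0, g'] k := by
  have h : HasFDerivAt (fun x : E3 => g (x 2)) _ x := hg.comp_hasFDerivAt x (hasFDerivAt_coord 2 x)
  rw [pd, h.fderiv]
  fin_cases k <;> simp

theorem vertical_mem {x : E3} (hx : x ∈ cylinder) : x 2 ∈ Ioo (0 : ℝ) 1 := hx.2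

/-- The primitive vanishing at `0`. -/
def prim (g : ℝ → ℝ) (z : ℝ) : ℝ := ∫ t in (0 : ℝ)..z, g t

theorem hasDerivAt_prim {g : ℝ → ℝ} (hg : ContinuousOn g (Icc 0 1))
    {z : ℝ} (hz : z ∈ Ioo (0 : ℝ) 1) : HasDerivAt (prim g) (g z) z := by
  refine intervalIntegral.integral_hasDerivAt_right ?_ ?_ ?_
  · exact ContinuousOn.intervalIntegrable_of_Icc hz.1.le (hg.mono (Icc_subset_Icc_right hz.2.le))
  · exact (hg.mono Ioo_subset_Icc_self).stronglyMeasurableAtFilter isOpen_Ioo z hz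
  · exact hg.continuousAt (Icc_mem_nhds hz.1 hz.2)

theorem continuousOn_prim {g : ℝ → ℝ} (hg : ContinuousOn g (Icc 0 1)) :
    ContinuousOn (prim g) (Icc 0 1) := by
  have := intervalIntegral.continuousOn_primitive_interval (μ := volume) (f := g) (a := 0) (b := 1)
    (by rw [uIcc_of_le zero_le_one]; exact hg.integrableOn_Icc)
  rwa [uIcc_of_le zero_le_one] at this

theorem isBoundedC1_prim {g : ℝ → ℝ} (hg : ContinuousOn g (Icc 0 1)) :
    IsBoundedC1 fun x => prim g (x 2) := by
  obtain ⟨A, hA⟩ := isCompact_Icc.exists_bound_of_continuousOn (continuousOn_prim hg)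
  obtain ⟨B, hB⟩ := isCompact_Icc.exists_bound_of_continuousOn hg
  have hc : ContDiffOn ℝ 1 (prim g) (Ioo 0 1) := by
    rw [show (1 : WithTop ℕ∞) = 0 + 1 from rfl, contDiffOn_succ_iff_deriv_of_isOpen isOpen_Ioo,
      contDiffOn_zero]
    exact ⟨fun z hz => (hasDerivAt_prim hg hz).differentiableAt.differentiableWithinAt, by simp,
      (hg.mono Ioo_subset_Icc_self).congr fun z hz => (hasDerivAt_prim hg hz).deriv⟩
  refine ⟨hc.comp (by fun_prop) fun x hx => vertical_mem hx,
    ⟨A, fun x hx => hA _ (Ioo_subset_Icc_self (vertical_mem hx))⟩, B, fun k x hx => ?_⟩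
  rw [pd_comp_vertical (hasDerivAt_prim hg (vertical_mem hx))]
  have hb := hB _ (Ioo_subset_Icc_self (vertical_mem hx))
  fin_cases k
  · change |(0 : ℝ)| ≤ B
    rw [abs_zero]
    exact (norm_nonneg _).trans hb
  · change |(0 : ℝ)| ≤ B
    rw [abs_zero]
    exact (norm_nonneg _).trans hb
  · exact hb

/-- Zero mean makes the primitive vanish at both ends, so it is at most `B min(z, 1 - z) ≤ 4B z(1 -
z)`, and `fb` is `4z(1 - z)`. -/
theorem vanishesAlong_prim {g : ℝ → ℝ} (hg : ContinuousOn g (Icc 0 1))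
    (h0 : ∫ t in (0 : ℝ)..1, g t = 0) :
    VanishesAlong (fun x => prim g (x 2)) 2 := by
  obtain ⟨B, hB⟩ := isCompact_Icc.exists_bound_of_continuousOn hg
  have hB0 : 0 ≤ B := (norm_nonneg _).trans (hB 0 (by simp))
  refine VanishesAlong.of_le_fb hB0 fun x hx => ?_
  obtain ⟨h1, h2⟩ := vertical_mem hx
  have i1 : IntervalIntegrable g volume 0 (x 2) :=
    ContinuousOn.intervalIntegrable_of_Icc h1.le (hg.mono (Icc_subset_Icc_right h2.le))
  have i2 : IntervalIntegrable g volume (x 2) 1 :=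
    ContinuousOn.intervalIntegrable_of_Icc h2.le (hg.mono (Icc_subset_Icc_left h1.le))
  have hs := intervalIntegral.integral_add_adjacent_intervals i1 i2
  have e1 : ‖∫ t in (0 : ℝ)..x 2, g t‖ ≤ B * |x 2 - 0| :=
    intervalIntegral.norm_integral_le_of_norm_le_const fun t ht => by
      rw [uIoc_of_le h1.le] at ht
      exact hB t ⟨ht.1.le, ht.2.trans h2.le⟩
  have e2 : ‖∫ t in x 2..1, g t‖ ≤ B * |1 - x 2| :=
    intervalIntegral.norm_integral_le_of_norm_le_const fun t ht => by
      rw [uIoc_of_le h2.le] at ht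
      exact hB t ⟨h1.le.trans ht.1.le, ht.2⟩
  rw [h0] at hs
  have e3 : ∫ t in x 2..1, g t = - ∫ t in (0 : ℝ)..x 2, g t := by linarith
  rw [e3, norm_neg, abs_of_pos (by linarith)] at e2
  rw [sub_zero, abs_of_pos h1] at e1
  change ‖∫ t in (0 : ℝ)..x 2, g t‖ ≤ _
  rw [fb]
  set N := ‖∫ t in (0 : ℝ)..x 2, g t‖
  rcases le_total (x 2) (1 / 2) with h | h
  · refine e1.trans (mul_le_mul_of_nonneg_left ?_ hB0)
    nlinarith
  · refine e2.trans (mul_le_mul_of_nonneg_left ?_ hB0)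
    nlinarith

/-- Integrals over the cylinder of functions of the height. -/
theorem exists_integral_vertical : ∃ c : ℝ, 0 ≤ c ∧ ∀ g : ℝ → ℝ,
    ∫ x in cylinder, g (x 2) = c * ∫ z in (0 : ℝ)..1, g z := by
  set e : E3 ≃ᵐ ℝ × (Fin 2 → ℝ) := (MeasurableEquiv.toLp 2 (Fin 3 → ℝ)).symm.trans
    (MeasurableEquiv.piFinSuccAbove (fun _ : Fin 3 => ℝ) 2) with he
  have hmp : MeasurePreserving e volume volume :=
    (EuclideanSpace.volume_preserving_symm_measurableEquiv_toLp (Fin 3)).trans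
      (volume_preserving_piFinSuccAbove (fun _ : Fin 3 => ℝ) 2)
  set T : Set (Fin 2 → ℝ) := {y | y 0 ^ 2 + y 1 ^ 2 < 1} with hT
  have hpre : cylinder = e ⁻¹' (Ioo (0 : ℝ) 1 ×ˢ T) := by
    ext x
    change _ ↔ (x 2 ∈ Ioo (0 : ℝ) 1 ∧ x 0 ^ 2 + x 1 ^ 2 < 1)
    exact and_comm
  refine ⟨∫ y in T, (1 : ℝ), integral_nonneg fun _ => zero_le_one, fun g => ?_⟩
  have h1 := hmp.setIntegral_preimage_emb e.measurableEmbedding (fun p => g p.1 * 1)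
    (Ioo (0 : ℝ) 1 ×ˢ T)
  rw [← hpre] at h1
  have h2 := setIntegral_prod_mul (μ := (volume : Measure ℝ)) (ν := (volume : Measure (Fin 2 → ℝ)))
    g (fun _ => (1 : ℝ)) (Ioo (0 : ℝ) 1) T
  rw [Measure.volume_eq_prod, h2] at h1
  rw [intervalIntegral.integral_of_le zero_le_one, integral_Ioc_eq_integral_Ioo, mul_comm, ← h1]
  simp only [mul_one]
  rfl

/-! ### The work of the special loads -/

/-- The components of the body force are `∂ᵢ` of these functions. -/
def pot (φ : E2 → ℝ) (ψ : ℝ → ℝ) : Fin 3 → E3 → ℝ :=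
  ![fun x => φ (horiz x), fun x => φ (horiz x), fun x => prim ψ (x 2)]

/-- The components of the body force. -/
def force (φ : E2 → ℝ) (ψ : ℝ → ℝ) (i : Fin 3) (x : E3) : ℝ := bodyForce φ ψ x i

/-- The components of the radial field `a(r) (x, y)`. -/
def rad (φ : E2 → ℝ) (i : Fin 3) (x : E3) : ℝ := radialPot φ (horiz x) * x i

section Loads

variable {φ : E2 → ℝ} {Φ : ℝ → ℝ} {ψ : ℝ → ℝ}

theorem IsHorizontalPotential.isBoundedC1 (h : IsHorizontalPotential φ Φ) :
    IsBoundedC1 fun x => φ (horiz x) := by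
  obtain ⟨A, hA, hA'⟩ := h.abs_le
  obtain ⟨B, -, -, hB⟩ := h.exists_lipschitz
  exact isBoundedC1_comp_horiz h.contDiffOn_disc (fun y hy => (hA' y hy).trans
    (mul_le_of_le_one_right hA (by linarith [norm_nonneg y]))) hB

theorem IsHorizontalPotential.vanishesAlong (h : IsHorizontalPotential φ Φ) {k : Fin 3}
    (hk : k ≠ 2) : VanishesAlong (fun x => φ (horiz x)) k := by
  obtain ⟨A, hA, hA'⟩ := h.abs_le
  exact VanishesAlong.of_le_fa hA (fun x hx => (hA' _ (horiz_mem_disc hx)).trans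
    (mul_le_mul_of_nonneg_left (one_sub_norm_horiz_le hx) hA)) hk

theorem isBoundedC1_pot (h : IsHorizontalPotential φ Φ) (hψ : IsVerticalLoad ψ) (i : Fin 3) :
    IsBoundedC1 (pot φ ψ i) := by
  fin_cases i
  · exact h.isBoundedC1
  · exact h.isBoundedC1
  · exact isBoundedC1_prim hψ.continuousOn

theorem vanishesAlong_pot (h : IsHorizontalPotential φ Φ) (hψ : IsVerticalLoad ψ) (i : Fin 3) :
    VanishesAlong (pot φ ψ i) i := by
  fin_cases i
  · exact h.vanishesAlong (by decide)
  · exact h.vanishesAlong (by decide)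
  · exact vanishesAlong_prim hψ.continuousOn hψ.mean

theorem force_eq (h : IsHorizontalPotential φ Φ) (hψ : IsVerticalLoad ψ) (i : Fin 3) {x : E3}
    (hx : x ∈ cylinder) : force φ ψ i x = pd i (pot φ ψ i) x := by
  have hd := (h.hasFDerivAt (horiz_mem_disc hx)).differentiableAt
  fin_cases i
  · exact (pd_comp_horiz hd 0).symm
  · exact (pd_comp_horiz hd 1).symm
  · exact (pd_comp_vertical (hasDerivAt_prim hψ.continuousOn (vertical_mem hx)) 2).symm

theorem memLp_force (h : IsHorizontalPotential φ Φ) (hψ : IsVerticalLoad ψ) (i : Fin 3)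
    {p : ℝ≥0∞} : MemLp (force φ ψ i) p (volume.restrict cylinder) :=
  ((isBoundedC1_pot h hψ i).memLp_pd i).ae_eq
    ((ae_restrict_iff' measurableSet_cylinder).2 (ae_of_all _ fun _ hx => (force_eq h hψ i hx).symm))

/-- Each component of the force is a derivative of a potential vanishing on the matching part of the
boundary, so Gauss–Green leaves only gradients of the displacement. -/
theorem work_force (h : IsHorizontalPotential φ Φ) (hψ : IsVerticalLoad ψ)
    {u : Fin 3 → E3 → ℝ} {G : Fin 3 → Fin 3 → E3 → ℝ} (hu : IsSobolev u G) (R : Mat3) :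
    work (force φ ψ) R u = -∑ i, ∑ j, R i j * ∫ x in cylinder, G j i x * pot φ ψ i x := by
  rw [work, ← Finset.sum_neg_distrib]
  refine Finset.sum_congr rfl fun i _ => ?_
  rw [← Finset.sum_neg_distrib]
  refine Finset.sum_congr rfl fun j _ => ?_
  have e : ∫ x in cylinder, u j x * force φ ψ i x = ∫ x in cylinder, u j x * pd i (pot φ ψ i) x :=
    setIntegral_congr_fun measurableSet_cylinder fun x hx => by
      rw [force_eq h hψ i hx]
  rw [e, hu.integral_mul_pd (isBoundedC1_pot h hψ i) j (vanishesAlong_pot h hψ i)]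
  ring

theorem IsHorizontalPotential.isBoundedC1_radialPot (h : IsHorizontalPotential φ Φ) :
    IsBoundedC1 fun x => radialPot φ (horiz x) := by
  obtain ⟨A, hA, hA'⟩ := h.abs_radialPot_le
  obtain ⟨B, hB⟩ := h.norm_fderiv_radialPot_le
  exact isBoundedC1_comp_horiz h.contDiffOn_radialPot (fun y hy => (hA' y hy).trans
    (mul_le_of_le_one_right hA (by linarith [norm_nonneg y]))) hB

theorem IsHorizontalPotential.isBoundedC1_rad (h : IsHorizontalPotential φ Φ) (i : Fin 3) :
    IsBoundedC1 (rad φ i) :=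
  h.isBoundedC1_radialPot.mul (isBoundedC1_coord i)

theorem IsHorizontalPotential.vanishesAlong_rad (h : IsHorizontalPotential φ Φ) (i : Fin 3)
    {k : Fin 3} (hk : k ≠ 2) : VanishesAlong (rad φ i) k := by
  obtain ⟨A, hA, hA'⟩ := h.abs_radialPot_le
  refine VanishesAlong.of_le_fa (C := A * 2) (by positivity) (fun x hx => ?_) hk
  rw [rad, abs_mul]
  have h1 := (hA' _ (horiz_mem_disc hx)).trans
    (mul_le_mul_of_nonneg_left (one_sub_norm_horiz_le hx) hA)
  calc |radialPot φ (horiz x)| * |x i| ≤ A * fa x * 2 :=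
        mul_le_mul h1 (abs_coord_lt_two hx i).le (abs_nonneg _) ((abs_nonneg _).trans h1)
    _ = A * 2 * fa x := by ring

theorem IsHorizontalPotential.pd_rad (h : IsHorizontalPotential φ Φ) (i k : Fin 3) {x : E3}
    (hx : x ∈ cylinder) : pd k (rad φ i) x =
      ![pd2 0 (radialPot φ) (horiz x), pd2 1 (radialPot φ) (horiz x), 0] k * x i +
        radialPot φ (horiz x) * if i = k then 1 else 0 := by
  have := pd_mul (differentiableAt_of_contDiffOn h.isBoundedC1_radialPot.contDiffOn hx)
    (differentiableAt_of_contDiffOn (isBoundedC1_coord i).contDiffOn hx) k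
  rw [pd_coord, pd_comp_horiz
    (h.hasFDerivAt_radialPot (horiz_mem_disc hx)).differentiableAt] at this
  exact this

theorem IsHorizontalPotential.div_rad (h : IsHorizontalPotential φ Φ) {x : E3}
    (hx : x ∈ cylinder) : pd 0 (rad φ 0) x + pd 1 (rad φ 1) x = -φ (horiz x) / 8 := by
  rw [h.pd_rad 0 0 hx, h.pd_rad 1 1 hx, ← h.euler_radialPot (horiz_mem_disc hx)]
  simp [horiz_apply]
  ring

theorem IsHorizontalPotential.pd_rad_symm (h : IsHorizontalPotential φ Φ) {x : E3}
    (hx : x ∈ cylinder) : pd 1 (rad φ 0) x = pd 0 (rad φ 1) x := by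
  have := h.mul_pd2_radialPot (horiz_mem_disc hx)
  rw [h.pd_rad 0 1 hx, h.pd_rad 1 0 hx]
  simp [horiz_apply] at this ⊢
  linarith

theorem IsHorizontalPotential.pd_two_rad (h : IsHorizontalPotential φ Φ) {x : E3}
    (hx : x ∈ cylinder) {i : Fin 3} (hi : i ≠ 2) : pd 2 (rad φ i) x = 0 := by
  rw [h.pd_rad i 2 hx]
  simp [hi]

theorem IsBoundedC1.integral_pd_eq_zero {w : E3 → ℝ} (hw : IsBoundedC1 w) {k : Fin 3}
    (hk : VanishesAlong w k) : ∫ x in cylinder, pd k w x = 0 := by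
  have := (isSobolev_affine 0 fun _ => 1).integral_mul_pd hw 0 hk
  simpa [affine] using this

/-- Up to a factor, `φ` is the divergence of the radial field, which vanishes on the lateral
boundary. -/
theorem IsHorizontalPotential.integral_eq_zero (h : IsHorizontalPotential φ Φ) :
    ∫ x in cylinder, φ (horiz x) = 0 := by
  have e : ∫ x in cylinder, φ (horiz x) =
      ∫ x in cylinder, (-8) * (pd 0 (rad φ 0) x + pd 1 (rad φ 1) x) :=
    setIntegral_congr_fun measurableSet_cylinder fun x hx => by
      beta_reduce
      rw [h.div_rad hx]
      ring
  rw [e, integral_const_mul, integral_add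
    (((h.isBoundedC1_rad 0).memLp_pd 0 (p := 1)).integrable le_rfl)
    (((h.isBoundedC1_rad 1).memLp_pd 1 (p := 1)).integrable le_rfl),
    (h.isBoundedC1_rad 0).integral_pd_eq_zero (h.vanishesAlong_rad 0 (by decide)),
    (h.isBoundedC1_rad 1).integral_pd_eq_zero (h.vanishesAlong_rad 1 (by decide))]
  simp

/-- The vertical astatic load. -/
def vertMoment (ψ : ℝ → ℝ) : ℝ := -∫ x in cylinder, prim ψ (x 2)

/-- The gradient is constant, so only means of the potentials enter, and the two horizontal ones are
zero. -/
theorem work_force_affine (h : IsHorizontalPotential φ Φ) (hψ : IsVerticalLoad ψ) (R A : Mat3)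
    (b : Fin 3 → ℝ) :
    work (force φ ψ) R (affine A b) = vertMoment ψ * (R * A) 2 2 := by
  rw [work_force h hψ (isSobolev_affine A b)]
  simp only [integral_const_mul]
  rw [Fin.sum_univ_three]
  have e0 : ∫ x in cylinder, pot φ ψ 0 x = 0 := h.integral_eq_zero
  have e1 : ∫ x in cylinder, pot φ ψ 1 x = 0 := h.integral_eq_zero
  have e2 : ∫ x in cylinder, pot φ ψ 2 x = -vertMoment ψ := (neg_neg _).symm
  rw [e0, e1, e2, Matrix.mul_apply, Finset.mul_sum]
  simp only [mul_zero, Finset.sum_const_zero, zero_add, ← Finset.sum_neg_distrib]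
  exact Finset.sum_congr rfl fun i _ => by ring

/-- Integration by parts in the height turns `-∫Ψ` into the first moment of `ψ`. -/
theorem vertMoment_nonneg (hψ : IsVerticalLoad ψ) : 0 ≤ vertMoment ψ := by
  obtain ⟨c, hc, hg⟩ := exists_integral_vertical
  have h1 := (isSobolev_affine 1 0).integral_mul_pd (isBoundedC1_prim hψ.continuousOn) 2
    (vanishesAlong_prim hψ.continuousOn hψ.mean)
  have e : ∫ x in cylinder, affine 1 0 2 x * pd 2 (fun x => prim ψ (x 2)) x =
      ∫ x in cylinder, (fun z => z * ψ z) (x 2) :=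
    setIntegral_congr_fun measurableSet_cylinder fun x hx => by
      beta_reduce
      rw [pd_comp_vertical (hasDerivAt_prim hψ.continuousOn (vertical_mem hx)) 2]
      simp [affine, Matrix.one_apply]
  rw [e.trans (hg fun z => z * ψ z)] at h1
  simp only [Matrix.one_apply_eq, one_mul] at h1
  rw [vertMoment, ← h1]
  exact mul_nonneg hc hψ.moment

theorem abs_entry_le_one {R : Mat3} (hR : R ∈ SO3) (i j : Fin 3) : |R i j| ≤ 1 := by
  have h1 : R ∈ Matrix.unitaryGroup (Fin 3) ℝ := (Matrix.mem_specialOrthogonalGroup_iff.1 hR).1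
  exact entry_norm_bound_of_unitary h1 i j

theorem affine_one_zero : (affine 1 0) = fun i (x : E3) => x i := by
  ext i x
  simp [affine, Matrix.one_apply]

/-- Only the vertical diagonal entry is seen, so rotations about the vertical axis always belong to
the rotation kernel, whatever `ψ` is. -/
theorem load_rotation (h : IsHorizontalPotential φ Φ) (hψ : IsVerticalLoad ψ) (R : Mat3) :
    load cylinder (bodyForce φ ψ) (fun x => act (R - 1) x) = vertMoment ψ * (R 2 2 - 1) := by
  rw [load_act (fun i => memLp_force h hψ i) memLp_coord, ← affine_one_zero]
  refine (work_force_affine h hψ _ _ _).trans ?_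
  rw [mul_one, Matrix.sub_apply, Matrix.one_apply_eq]

theorem weaklyCompatible_bodyForce (h : IsHorizontalPotential φ Φ) (hψ : IsVerticalLoad ψ) :
    WeaklyCompatible (load cylinder (bodyForce φ ψ)) := by
  intro R hR
  rw [load_rotation h hψ]
  exact mul_nonpos_of_nonneg_of_nonpos (vertMoment_nonneg hψ)
    (sub_nonpos.2 (le_of_abs_le (abs_entry_le_one hR 2 2)))

theorem nullResultant_bodyForce (h : IsHorizontalPotential φ Φ) (hψ : IsVerticalLoad ψ) :
    NullResultant (load cylinder (bodyForce φ ψ)) := by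
  intro c
  rw [load_eq_work (fun i => memLp_force h hψ i) (fun i => memLp_const _)]
  have e : (fun i (x : E3) => c i) = affine 0 fun i => c i := by
    ext i x
    simp [affine]
  rw [e]
  refine (work_force_affine h hψ _ _ _).trans ?_
  simp

/-- Either the vertical moment is zero, or `R 2 2 = 1`; in the latter case orthonormality forces the
last row of `R` to be that of the identity, and the entry of `R * A` is a diagonal entry of a skew
matrix. -/
theorem work_rigid (h : IsHorizontalPotential φ Φ) (hψ : IsVerticalLoad ψ) {R : Mat3}
    (hR : R ∈ rotationKernel (load cylinder (bodyForce φ ψ))) {A : Mat3}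
    (hA : A.transpose = -A) (b : Fin 3 → ℝ) : work (force φ ψ) R (affine A b) = 0 := by
  obtain ⟨hR1, hR2⟩ := hR
  rw [load_rotation h hψ] at hR2
  rw [work_force_affine h hψ]
  rcases mul_eq_zero.1 hR2 with h0 | h1
  · rw [h0, zero_mul]
  · have hr : R * star R = 1 :=
      Matrix.mem_unitaryGroup_iff.1 (Matrix.mem_specialOrthogonalGroup_iff.1 hR1).1
    have h2 := congrFun (congrFun hr 2) 2
    simp only [Matrix.mul_apply, Fin.sum_univ_three, Matrix.star_apply, star_trivial,
      Matrix.one_apply_eq] at h2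
    have h3 : R 2 2 = 1 := by linarith
    rw [h3] at h2
    have h4 : R 2 0 = 0 := by nlinarith [sq_nonneg (R 2 0), sq_nonneg (R 2 1)]
    have h5 : R 2 1 = 0 := by nlinarith [sq_nonneg (R 2 0), sq_nonneg (R 2 1)]
    have h6 := congrFun (congrFun hA 2) 2
    simp only [Matrix.transpose_apply, Matrix.neg_apply] at h6
    have h7 : A 2 2 = 0 := by linarith
    rw [Matrix.mul_apply, Fin.sum_univ_three, h4, h5, h7]
    ring

end Loads

/-! ### The energy gap -/

theorem integrableOn_sum_mul {n : ℕ} (c : Fin n → ℝ) {p q : Fin n → E3 → ℝ}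
    (hp : ∀ i, MemLp (p i) 2 (volume.restrict cylinder))
    (hq : ∀ i, MemLp (q i) 2 (volume.restrict cylinder)) :
    IntegrableOn (fun x => ∑ i, c i * (p i x * q i x)) cylinder :=
  integrable_finsetSum _ fun i _ => ((hp i).integrable_mul (hq i)).const_mul _

theorem integral_sum_mul {n : ℕ} (c : Fin n → ℝ) {p q : Fin n → E3 → ℝ}
    (hp : ∀ i, MemLp (p i) 2 (volume.restrict cylinder))
    (hq : ∀ i, MemLp (q i) 2 (volume.restrict cylinder)) :
    ∫ x in cylinder, ∑ i, c i * (p i x * q i x) =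
      ∑ i, c i * ∫ x in cylinder, p i x * q i x := by
  have hi (i) : IntegrableOn (fun x => c i * (p i x * q i x)) cylinder :=
    ((hp i).integrable_mul (hq i)).const_mul _
  rw [integral_finsetSum _ fun i _ => hi i]
  exact Finset.sum_congr rfl fun i _ => integral_const_mul _ _

section Gap

variable {φ : E2 → ℝ} {Φ : ℝ → ℝ} {ψ : ℝ → ℝ}

theorem IsHorizontalPotential.isSobolev_rad (h : IsHorizontalPotential φ Φ) :
    IsSobolev (rad φ) fun i j => pd j (rad φ i) :=
  isSobolev_of_isBoundedC1 h.isBoundedC1_rad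

/-- The Jacobian determinant of the radial field has mean zero. -/
theorem IsHorizontalPotential.integral_det_rad (h : IsHorizontalPotential φ Φ) :
    ∫ x in cylinder, pd 1 (rad φ 1) x * pd 0 (rad φ 0) x =
      ∫ x in cylinder, pd 0 (rad φ 1) x * pd 1 (rad φ 0) x :=
  h.isSobolev_rad.integral_grad_mul_pd (h.isBoundedC1_rad 0) 1 (by decide)
    (h.vanishesAlong_rad 0 (by decide)) (h.vanishesAlong_rad 0 (by decide))

/-- The squared distance of the strain from the matrix with planar part `(a, d; d, b)` and vertical
entry `-s/8` is nonnegative. The trace condition rewrites `4(a² + b² + 2d²)` as `f²/16` plus a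
multiple of the determinant. -/
theorem elastic_pointwise {e00 e11 e22 e01 e02 e12 a b d f s : ℝ} (hf : a + b = -f / 8) :
    8 * (e00 * a + e11 * b + 2 * e01 * d) - e22 * s - f * f / 16 - s * s / 16 -
        8 * (d * d - b * a) ≤
      4 * (e00 ^ 2 + e11 ^ 2 + e22 ^ 2 + 2 * e01 ^ 2 + 2 * e02 ^ 2 + 2 * e12 ^ 2) := by
  have hf' : f = -8 * (a + b) := by linarith
  subst hf'
  nlinarith [sq_nonneg (e00 - a), sq_nonneg (e11 - b), sq_nonneg (e01 - d),
    sq_nonneg (e22 + s / 8), sq_nonneg e02, sq_nonneg e12]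

/-- A lower bound for the energy of linearized elasticity. -/
theorem energy_ge (h : IsHorizontalPotential φ Φ) (hψ : IsVerticalLoad ψ)
    {u : Fin 3 → E3 → ℝ} {G : Fin 3 → Fin 3 → E3 → ℝ} (hu : IsSobolev u G) :
    -(1 / 16) * (∫ x in cylinder, pot φ ψ 0 x * pot φ ψ 0 x) -
        1 / 16 * (∫ x in cylinder, pot φ ψ 2 x * pot φ ψ 2 x) ≤
      elasticEnergy G - work (force φ ψ) 1 u := by
  have mG := hu.memLp_grad
  have mD (i j : Fin 3) : MemLp (pd j (rad φ i)) 2 (volume.restrict cylinder) :=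
    (h.isBoundedC1_rad i).memLp_pd j
  have mP (i : Fin 3) : MemLp (pot φ ψ i) 2 (volume.restrict cylinder) :=
    (isBoundedC1_pot h hψ i).memLp
  -- The null Lagrangians: these identities cancel the last six of the eleven terms below, whose
  -- first five are the work and the two squares.
  have c1 := hu.integral_grad_mul_pd (h.isBoundedC1_rad 0) 1 (j := 1) (k := 0) (by decide)
    (h.vanishesAlong_rad 0 (by decide)) (h.vanishesAlong_rad 0 (by decide))
  have c2 := hu.integral_grad_mul_pd (h.isBoundedC1_rad 1) 0 (j := 0) (k := 1) (by decide)
    (h.vanishesAlong_rad 1 (by decide)) (h.vanishesAlong_rad 1 (by decide))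
  have c3 := h.integral_det_rad
  have hw : work (force φ ψ) 1 u = -((∫ x in cylinder, G 0 0 x * pot φ ψ 0 x) +
      (∫ x in cylinder, G 1 1 x * pot φ ψ 1 x) + ∫ x in cylinder, G 2 2 x * pot φ ψ 2 x) := by
    rw [work_force h hψ hu]
    simp [Fin.sum_univ_three, Matrix.one_apply]
  set c : Fin 11 → ℝ := ![-1, -1, -1, -1 / 16, -1 / 16, 8, -8, 8, -8, -8, 8] with hc
  set P : Fin 11 → E3 → ℝ := ![G 0 0, G 1 1, G 2 2, pot φ ψ 0, pot φ ψ 2, G 1 0, G 1 1, G 0 1,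
    G 0 0, pd 0 (rad φ 1), pd 1 (rad φ 1)] with hP
  set q : Fin 11 → E3 → ℝ := ![pot φ ψ 0, pot φ ψ 1, pot φ ψ 2, pot φ ψ 0, pot φ ψ 2,
    pd 1 (rad φ 0), pd 0 (rad φ 0), pd 0 (rad φ 1), pd 1 (rad φ 1), pd 1 (rad φ 0),
    pd 0 (rad φ 0)] with hq
  have mp : ∀ i, MemLp (P i) 2 (volume.restrict cylinder) := by
    intro i
    fin_cases i
    exacts [mG 0 0, mG 1 1, mG 2 2, mP 0, mP 2, mG 1 0, mG 1 1, mG 0 1, mG 0 0, mD 1 0, mD 1 1]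
  have mq : ∀ i, MemLp (q i) 2 (volume.restrict cylinder) := by
    intro i
    fin_cases i
    exacts [mP 0, mP 1, mP 2, mP 0, mP 2, mD 0 1, mD 0 0, mD 1 0, mD 1 1, mD 0 1, mD 0 0]
  have hsum := integral_sum_mul c mp mq
  have hle : ∫ x in cylinder, ∑ i, c i * (P i x * q i x) ≤ elasticEnergy G := by
    rw [elasticEnergy_eq_integral hu]
    refine setIntegral_mono_on (integrableOn_sum_mul c mp mq) (integrableOn_elastic hu)
      measurableSet_cylinder fun x hx => ?_
    have h1 := h.div_rad hx
    have h2 := h.pd_rad_symm hx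
    have key := elastic_pointwise (e00 := G 0 0 x) (e11 := G 1 1 x) (e22 := G 2 2 x)
      (e01 := 1 / 2 * (G 0 1 x + G 1 0 x)) (e02 := 1 / 2 * (G 0 2 x + G 2 0 x))
      (e12 := 1 / 2 * (G 1 2 x + G 2 1 x)) (d := pd 0 (rad φ 1) x) (s := pot φ ψ 2 x) h1
    have e1 : φ (horiz x) = pot φ ψ 0 x := rfl
    have e2 : φ (horiz x) = pot φ ψ 1 x := rfl
    refine le_trans (le_of_eq ?_) (key.trans (le_of_eq ?_))
    · simp only [hc, hP, hq, Fin.sum_univ_succ, Fin.sum_univ_zero]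
      simp only [Matrix.cons_val_zero, Matrix.cons_val_succ]
      rw [← e1, ← e2, h2]
      have h3 : pd 0 (rad φ 0) x = -φ (horiz x) / 8 - pd 1 (rad φ 1) x := by linarith
      rw [h3]
      ring
    · simp only [Fin.sum_univ_three]
      ring
  rw [hsum] at hle
  simp only [hc, hP, hq, Fin.sum_univ_succ, Fin.sum_univ_zero] at hle
  simp only [Matrix.cons_val_zero, Matrix.cons_val_succ] at hle
  rw [hw]
  linarith

/-- The rotation by a right angle about the vertical axis. -/
def quarterTurn : Mat3 := !![0, 1, 0; -1, 0, 0; 0, 0, 1]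

theorem quarterTurn_mem_rotationKernel (h : IsHorizontalPotential φ Φ) (hψ : IsVerticalLoad ψ) :
    quarterTurn ∈ rotationKernel (load cylinder (bodyForce φ ψ)) := by
  refine ⟨Matrix.mem_specialOrthogonalGroup_iff.2 ⟨(Matrix.mem_orthogonalGroup_iff _ _).2 ?_, ?_⟩, ?_⟩
  · ext i j
    fin_cases i <;> fin_cases j <;>
      simp [quarterTurn, Matrix.mul_apply, Fin.sum_univ_three]
  · simp [quarterTurn, Matrix.det_fin_three]
  · rw [load_rotation h hψ]
    simp [quarterTurn]

/-- The trial displacement: a twist of the cross sections and a multiple of a vertical stretch. -/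
def trial (φ : E2 → ℝ) (ψ : ℝ → ℝ) (s : ℝ) : Fin 3 → E3 → ℝ :=
  ![fun x => -2 * rad φ 1 x, fun x => 2 * rad φ 0 x, fun x => -(s / 8) * prim (prim ψ) (x 2)]

theorem isBoundedC1_trial (h : IsHorizontalPotential φ Φ) (hψ : IsVerticalLoad ψ) (s : ℝ)
    (i : Fin 3) : IsBoundedC1 (trial φ ψ s i) := by
  fin_cases i
  · exact (h.isBoundedC1_rad 1).const_mul _
  · exact (h.isBoundedC1_rad 0).const_mul _
  · exact (isBoundedC1_prim (continuousOn_prim hψ.continuousOn)).const_mul _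

theorem isSobolev_trial (h : IsHorizontalPotential φ Φ) (hψ : IsVerticalLoad ψ) (s : ℝ) :
    IsSobolev (trial φ ψ s) fun i j => pd j (trial φ ψ s i) :=
  isSobolev_of_isBoundedC1 (isBoundedC1_trial h hψ s)

theorem pd_trial_zero (h : IsHorizontalPotential φ Φ) (s : ℝ) {x : E3} (hx : x ∈ cylinder)
    (k : Fin 3) : pd k (trial φ ψ s 0) x = -2 * pd k (rad φ 1) x :=
  (h.isBoundedC1_rad 1).pd_const_mul _ hx k

theorem pd_trial_one (h : IsHorizontalPotential φ Φ) (s : ℝ) {x : E3} (hx : x ∈ cylinder)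
    (k : Fin 3) : pd k (trial φ ψ s 1) x = 2 * pd k (rad φ 0) x :=
  (h.isBoundedC1_rad 0).pd_const_mul _ hx k

theorem pd_trial_two (hψ : IsVerticalLoad ψ) (s : ℝ) {x : E3}
    (hx : x ∈ cylinder) (k : Fin 3) :
    pd k (trial φ ψ s 2) x = -(s / 8) * ![0, 0, pot φ ψ 2 x] k := by
  have hc := continuousOn_prim hψ.continuousOn
  rw [← pd_comp_vertical (g := prim (prim ψ)) (x := x) (g' := pot φ ψ 2 x)
    (hasDerivAt_prim hc (vertical_mem hx)) k]
  exact (isBoundedC1_prim hc).pd_const_mul _ hx k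

/-- The divergence of the turned field is the planar curl of the radial one; the parameter `0`
removes the vertical stretch. -/
theorem traceFree_trial (h : IsHorizontalPotential φ Φ) (hψ : IsVerticalLoad ψ) :
    TraceFree fun i j => pd j (trial φ ψ 0 i) := by
  refine (ae_restrict_iff' measurableSet_cylinder).2 (ae_of_all _ fun x hx => ?_)
  rw [Fin.sum_univ_three]
  beta_reduce
  rw [pd_trial_zero h 0 hx, pd_trial_one h 0 hx, pd_trial_two hψ 0 hx,
    h.pd_rad_symm hx]
  ring

/-- The energy of the trial displacement under the rotated load. -/
theorem energy_trial (h : IsHorizontalPotential φ Φ) (hψ : IsVerticalLoad ψ) (s : ℝ) :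
    elasticEnergy (fun i j => pd j (trial φ ψ s i)) -
        work (force φ ψ) quarterTurn (trial φ ψ s) =
      -(1 / 8) * (∫ x in cylinder, pot φ ψ 0 x * pot φ ψ 0 x) +
        (s ^ 2 / 16 - s / 8) * ∫ x in cylinder, pot φ ψ 2 x * pot φ ψ 2 x := by
  have hu := isSobolev_trial h hψ s
  have mD (i j : Fin 3) : MemLp (pd j (rad φ i)) 2 (volume.restrict cylinder) :=
    (h.isBoundedC1_rad i).memLp_pd j
  have mP (i : Fin 3) : MemLp (pot φ ψ i) 2 (volume.restrict cylinder) :=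
    (isBoundedC1_pot h hψ i).memLp
  have c3 := h.integral_det_rad
  -- With planar gradient entries `a, b, d` of the radial field, the planar strain energy is `32d² +
  -- 8(a - b)² = 8(a + b)² + 32(d² - ab)`, and the last term integrates to zero.
  have hE : elasticEnergy (fun i j => pd j (trial φ ψ s i)) =
      1 / 8 * (∫ x in cylinder, pot φ ψ 0 x * pot φ ψ 0 x) +
        s ^ 2 / 16 * ∫ x in cylinder, pot φ ψ 2 x * pot φ ψ 2 x := by
    set c : Fin 4 → ℝ := ![1 / 8, s ^ 2 / 16, 32, -32] with hc
    set P : Fin 4 → E3 → ℝ := ![pot φ ψ 0, pot φ ψ 2, pd 0 (rad φ 1), pd 1 (rad φ 1)] with hP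
    set q : Fin 4 → E3 → ℝ := ![pot φ ψ 0, pot φ ψ 2, pd 1 (rad φ 0), pd 0 (rad φ 0)] with hq
    have mp : ∀ i, MemLp (P i) 2 (volume.restrict cylinder) := by
      intro i
      fin_cases i
      exacts [mP 0, mP 2, mD 1 0, mD 1 1]
    have mq : ∀ i, MemLp (q i) 2 (volume.restrict cylinder) := by
      intro i
      fin_cases i
      exacts [mP 0, mP 2, mD 0 1, mD 0 0]
    have hsum := integral_sum_mul c mp mq
    have e : elasticEnergy (fun i j => pd j (trial φ ψ s i)) =
        ∫ x in cylinder, ∑ i, c i * (P i x * q i x) := by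
      rw [elasticEnergy_eq_integral hu]
      refine setIntegral_congr_fun measurableSet_cylinder fun x hx => ?_
      have h1 := h.div_rad hx
      have h2 := h.pd_rad_symm hx
      have e1 : φ (horiz x) = pot φ ψ 0 x := rfl
      simp only [hc, hP, hq, Fin.sum_univ_succ, Fin.sum_univ_zero]
      simp only [Matrix.cons_val_zero, Matrix.cons_val_succ, Fin.succ_zero_eq_one,
        Fin.succ_one_eq_two]
      simp only [pd_trial_zero h s hx, pd_trial_one h s hx, pd_trial_two hψ s hx,
        h.pd_two_rad hx (by decide : (0 : Fin 3) ≠ 2), h.pd_two_rad hx (by decide : (1 : Fin 3) ≠ 2),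
        h2]
      simp only [Matrix.cons_val_zero, Matrix.cons_val_one, Matrix.cons_val]
      rw [← e1, show φ (horiz x) = -8 * (pd 0 (rad φ 0) x + pd 1 (rad φ 1) x) by rw [h1]; ring]
      linear_combination (-32 * pd 0 (rad φ 1) x) * h2
    rw [e, hsum]
    simp only [hc, hP, hq, Fin.sum_univ_succ, Fin.sum_univ_zero]
    simp only [Matrix.cons_val_zero, Matrix.cons_val_succ]
    rw [c3]
    ring
  -- The quarter turn maps the twist back to twice the radial field. A multiple `λ` in place of `2`
  -- would give `(λ²/32 - λ/8)∫φ²`, minimal at `λ = 2`; similarly `s = 1` minimizes `s²/16 - s/8`.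
  have hW : work (force φ ψ) quarterTurn (trial φ ψ s) =
      1 / 4 * (∫ x in cylinder, pot φ ψ 0 x * pot φ ψ 0 x) +
        s / 8 * ∫ x in cylinder, pot φ ψ 2 x * pot φ ψ 2 x := by
    have i1 : IntegrableOn (fun x => pd 0 (rad φ 0) x * pot φ ψ 0 x) cylinder :=
      (mD 0 0).integrable_mul (mP 0)
    have i2 : IntegrableOn (fun x => pd 1 (rad φ 1) x * pot φ ψ 0 x) cylinder :=
      (mD 1 1).integrable_mul (mP 0)
    have e0 : ∫ x in cylinder, pd 0 (trial φ ψ s 1) x * pot φ ψ 0 x =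
        2 * ∫ x in cylinder, pd 0 (rad φ 0) x * pot φ ψ 0 x := by
      rw [← integral_const_mul]
      refine setIntegral_congr_fun measurableSet_cylinder fun x hx => ?_
      rw [pd_trial_one h s hx]
      ring
    have e1 : ∫ x in cylinder, pd 1 (trial φ ψ s 0) x * pot φ ψ 1 x =
        -2 * ∫ x in cylinder, pd 1 (rad φ 1) x * pot φ ψ 0 x := by
      rw [← integral_const_mul]
      refine setIntegral_congr_fun measurableSet_cylinder fun x hx => ?_
      rw [pd_trial_zero h s hx, show pot φ ψ 1 x = pot φ ψ 0 x from rfl]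
      ring
    have e2 : ∫ x in cylinder, pd 2 (trial φ ψ s 2) x * pot φ ψ 2 x =
        -(s / 8) * ∫ x in cylinder, pot φ ψ 2 x * pot φ ψ 2 x := by
      rw [← integral_const_mul]
      refine setIntegral_congr_fun measurableSet_cylinder fun x hx => ?_
      rw [pd_trial_two hψ s hx]
      simp only [Matrix.cons_val]
      ring
    have e3 : (∫ x in cylinder, pd 0 (rad φ 0) x * pot φ ψ 0 x) +
        ∫ x in cylinder, pd 1 (rad φ 1) x * pot φ ψ 0 x =
          -(1 / 8) * ∫ x in cylinder, pot φ ψ 0 x * pot φ ψ 0 x := by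
      rw [← integral_add i1 i2, ← integral_const_mul]
      refine setIntegral_congr_fun measurableSet_cylinder fun x hx => ?_
      rw [← add_mul, h.div_rad hx, show φ (horiz x) = pot φ ψ 0 x from rfl]
      ring
    rw [work_force h hψ hu]
    simp only [Fin.sum_univ_three]
    simp only [quarterTurn, Matrix.of_apply, Matrix.cons_val', Matrix.cons_val_zero,
      Matrix.cons_val_one, Matrix.cons_val]
    rw [e0, e1, e2]
    linarith
  rw [hE, hW]
  ring

/-- Otherwise `φ` would vanish on the disc by continuity, and so would its Laplacian. -/
theorem IsHorizontalPotential.integral_sq_pos (h : IsHorizontalPotential φ Φ) :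
    0 < ∫ x in cylinder, φ (horiz x) * φ (horiz x) := by
  have hnn : 0 ≤ ∫ x in cylinder, φ (horiz x) * φ (horiz x) :=
    integral_nonneg fun x => mul_self_nonneg _
  refine lt_of_le_of_ne hnn fun h0 => ?_
  have hm := h.isBoundedC1.memLp
  have hae := (integral_eq_zero_iff_of_nonneg (fun x => mul_self_nonneg (φ (horiz x)))
    (hm.integrable_mul hm)).1 h0.symm
  have hc : ContinuousOn (fun x => φ (horiz x) * φ (horiz x)) cylinder :=
    h.isBoundedC1.contDiffOn.continuousOn.mul h.isBoundedC1.contDiffOn.continuousOn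
  have hz := Measure.eqOn_open_of_ae_eq hae isOpen_cylinder hc continuousOn_const
  obtain ⟨y, hy, hne⟩ := h.laplacian_ne
  have hφ0 : ∀ y ∈ disc, φ y = 0 := fun y hy => by
    have hx : (!₂[y 0, y 1, 1 / 2] : E3) ∈ cylinder := by
      have hy' := mem_ball_zero_iff.1 hy
      have h1 : y 0 ^ 2 + y 1 ^ 2 < 1 := by
        rw [← norm_sq_E2]
        nlinarith [norm_nonneg y]
      refine ⟨h1, ?_, ?_⟩
      · change (0 : ℝ) < 1 / 2
        norm_num
      · change (1 / 2 : ℝ) < 1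
        norm_num
    have e : horiz !₂[y 0, y 1, 1 / 2] = y := by
      ext i
      fin_cases i <;> rfl
    have := hz hx
    simp only [e] at this
    exact mul_self_eq_zero.1 this
  have hev : φ =ᶠ[𝓝 y] fun _ => (0 : ℝ) := by
    filter_upwards [Metric.isOpen_ball.mem_nhds hy] with z hz using hφ0 z hz
  refine hne ?_
  rw [(InnerProductSpace.laplacian_congr_nhds hev).eq_of_nhds]
  simp [InnerProductSpace.laplacian_eq_iteratedFDeriv_stdOrthonormalBasis]

/-- On an interval of length one the `L¹` norm is at most the `L²` norm. -/
theorem abs_prim_lt (hψ : IsVerticalLoad ψ) {δ : ℝ}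
    (hδ : eLpNorm ψ 2 (volume.restrict (Ioo 0 1)) < ENNReal.ofReal δ) {z : ℝ}
    (hz : z ∈ Ioo (0 : ℝ) 1) : |prim ψ z| < δ := by
  have hprob : IsProbabilityMeasure (volume.restrict (Ioo (0 : ℝ) 1)) := ⟨by simp⟩
  have hm : AEStronglyMeasurable ψ (volume.restrict (Ioo (0 : ℝ) 1)) :=
    (hψ.continuousOn.mono Ioo_subset_Icc_self).aestronglyMeasurable measurableSet_Ioo
  have h1 : ‖prim ψ z‖ₑ ≤ eLpNorm ψ 2 (volume.restrict (Ioo 0 1)) := by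
    calc ‖prim ψ z‖ₑ = ‖∫ t in Ioc 0 z, ψ t‖ₑ := by
          rw [prim, intervalIntegral.integral_of_le hz.1.le]
      _ ≤ ∫⁻ t in Ioc 0 z, ‖ψ t‖ₑ := enorm_integral_le_lintegral_enorm _
      _ ≤ ∫⁻ t in Ioo 0 1, ‖ψ t‖ₑ :=
          lintegral_mono_set fun t ht => ⟨ht.1, ht.2.trans_lt hz.2⟩
      _ = eLpNorm ψ 1 (volume.restrict (Ioo 0 1)) := eLpNorm_one_eq_lintegral_enorm.symm
      _ ≤ _ := eLpNorm_le_eLpNorm_of_exponent_le (by norm_num) hm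
  have h2 := h1.trans_lt hδ
  rw [← ofReal_norm] at h2
  exact (ENNReal.ofReal_lt_ofReal_iff_of_nonneg (norm_nonneg _)).1 h2

theorem integral_sq_prim_le (hψ : IsVerticalLoad ψ) {δ : ℝ}
    (hδ : eLpNorm ψ 2 (volume.restrict (Ioo 0 1)) < ENNReal.ofReal δ) :
    ∫ x in cylinder, prim ψ (x 2) * prim ψ (x 2) ≤ δ ^ 2 * volume.real cylinder := by
  have hm := (isBoundedC1_prim hψ.continuousOn).memLp
  calc ∫ x in cylinder, prim ψ (x 2) * prim ψ (x 2) ≤ ∫ x in cylinder, δ ^ 2 := by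
        refine setIntegral_mono_on (hm.integrable_mul hm) (integrable_const _)
          measurableSet_cylinder fun x hx => ?_
        have := abs_prim_lt hψ hδ (vertical_mem hx)
        rw [← pow_two]
        exact sq_le_sq' (by linarith [neg_abs_le (prim ψ (x 2))])
          (by linarith [le_abs_self (prim ψ (x 2))])
    _ = δ ^ 2 * volume.real cylinder := by
        rw [integral_const, measureReal_restrict_apply_univ, smul_eq_mul, mul_comm]

end Gap

end TractionGap

end

/-! ### The theorem. -/

open TractionGap

theorem theorem2p6 (φ : TractionGap.E2 → ℝ) (Φ : ℝ → ℝ)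
    (hφ : TractionGap.IsHorizontalPotential φ Φ) :
    ∃ δ : ℝ, 0 < δ ∧
      ∀ (ψ : ℝ → ℝ), TractionGap.IsVerticalLoad ψ →
      ∀ (p : ℝ), 1 < p → p ≤ 2 →
      ∀ (W : TractionGap.Mat3 → ℝ≥0∞), TractionGap.IsEnergyDensity p W →
        TractionGap.HasModelLinearization W →
        -- the hypotheses on the domain and on the loads hold
        TractionGap.IsReferenceConfiguration TractionGap.cylinder ∧
        Finite (ConnectedComponents (frontier TractionGap.cylinder)) ∧
        MemLp (TractionGap.bodyForce φ ψ) (ENNReal.ofReal (3 * p / (4 * p - 3)))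
          (volume.restrict TractionGap.cylinder) ∧
        TractionGap.NullResultant
          (TractionGap.load TractionGap.cylinder (TractionGap.bodyForce φ ψ)) ∧
        TractionGap.WeaklyCompatible
          (TractionGap.load TractionGap.cylinder (TractionGap.bodyForce φ ψ)) ∧
        -- the compressible case
        TractionGap.HasEnergyGap TractionGap.cylinder p (TractionGap.Q W)
          (TractionGap.load TractionGap.cylinder (TractionGap.bodyForce φ ψ)) ∧
        -- the incompressible case
        (eLpNorm ψ 2 (volume.restrict (Ioo 0 1)) < ENNReal.ofReal δ →
          TractionGap.HasEnergyGap TractionGap.cylinder p (TractionGap.QI W)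
            (TractionGap.load TractionGap.cylinder (TractionGap.bodyForce φ ψ))) := by
  have hpos := hφ.integral_sq_pos
  set X := ∫ x in cylinder, φ (horiz x) * φ (horiz x) with hX
  have hv : 0 ≤ volume.real cylinder := measureReal_nonneg
  -- Chosen from `φ` alone so that `δ²` times the volume is below `∫φ²`; the `1` makes this strict.
  refine ⟨√(X / (volume.real cylinder + 1)), Real.sqrt_pos.2 (by positivity), ?_⟩
  intro ψ hψ p hp1 hp2 W hW hlin
  have hf := fun i => memLp_force hφ hψ i (p := 2)
  have hY : 0 ≤ ∫ x in cylinder, pot φ ψ 2 x * pot φ ψ 2 x :=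
    integral_nonneg fun x => mul_self_nonneg _
  refine ⟨isReferenceConfiguration_cylinder, finite_connectedComponents_frontier,
    MemLp.of_eval_piLp fun i => memLp_force hφ hψ i, nullResultant_bodyForce hφ hψ,
    weaklyCompatible_bodyForce hφ hψ,
    hasEnergyGap_of_trial hp2 (isModelDensity_Q hlin) hf
      (fun R hR A hA b => work_rigid hφ hψ hR hA b)
      ⟨quarterTurn, quarterTurn_mem_rotationKernel hφ hψ, _, _, isSobolev_trial hφ hψ 1,
        False.elim, fun u' G' hu' _ => ?_⟩,
    fun hδ => hasEnergyGap_of_trial hp2 (isModelDensity_QI hlin) hf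
      (fun R hR A hA b => work_rigid hφ hψ hR hA b)
      ⟨quarterTurn, quarterTurn_mem_rotationKernel hφ hψ, _, _, isSobolev_trial hφ hψ 0,
        fun _ => traceFree_trial hφ hψ, fun u' G' hu' _ => ?_⟩⟩
  -- With `s = 1` the terms in Ψ agree on both sides, and `-(1/8)∫φ² < -(1/16)∫φ²` remains.
  · refine lt_of_lt_of_le ?_ (energy_ge hφ hψ hu')
    refine (energy_trial hφ hψ 1).trans_lt ?_
    have : X = ∫ x in cylinder, pot φ ψ 0 x * pot φ ψ 0 x := rfl
    linarith
  -- With `s = 0` the trial energy is `-(1/8)∫φ²`. The lower bound holds for all `H¹` fields, in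
  -- particular for trace-free ones, and is larger because `∫Ψ² < ∫φ²`.
  · refine lt_of_lt_of_le ?_ (energy_ge hφ hψ hu')
    refine (energy_trial hφ hψ 0).trans_lt ?_
    have h0 : X = ∫ x in cylinder, pot φ ψ 0 x * pot φ ψ 0 x := rfl
    have h1 : ∫ x in cylinder, pot φ ψ 2 x * pot φ ψ 2 x ≤ _ := integral_sq_prim_le hψ hδ
    rw [Real.sq_sqrt (by positivity), div_mul_eq_mul_div] at h1
    have h2 : X * volume.real cylinder / (volume.real cylinder + 1) < X := by
      rw [div_lt_iff₀ (by positivity)]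
      linarith
    linarith
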